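/- Fix a distance $\operatorname{dist}$ on $\mathbb{R}^d$ (for every $d$) with $\operatorname{dist}(x,y)\ge 0$ and $\operatorname{dist}(x,x)=0$ such that every cluster (finite multiset $C$ of vectors in $\mathbb{Z}^d$) has an optimal centroid, i.e. $\operatorname{cost}(C)=\min_{c\in\mathbb{R}^d}\sum_{x\in C}\operatorname{dist}(x,c)$ is attained. Suppose that $\operatorname{dist}$ has the $\alpha$-property for some $\alpha>0$: every cluster $C$ with $s\ge 2$ distinct vectors satisfies $\operatorname{cost}(C)\ge\alpha(s-1)$. $k$-Clustering: given a multiset $X$ of $n\ge 1$ vectors in $\mathbb{Z}^d$ ($d\ge1$), an integer $k\ge1$ and a real $D\ge 0$, decide whether $X$ can be partitioned into $k$ (possibly empty) clusters $C_1,\dots,C_k$ with centroids $c_1,\dots,c_k\in\mathbb{R}^d$ such that $\sum_{i=1}^k\sum_{x\in C_i}\operatorname{dist}(x,c_i)\le D$. Cluster Selection: given $t\ge1$ disjoint nonempty sets $X_1,\dots,X_t$ of vectors in $\mathbb{Z}^d$ ($d\ge 1$) with $m$ vectors in total, positive integer weights $w$ of these vectors and a real $D\ge0$, decide whether one can choose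 one vector $x_i\in X_i$ from each set such that $\min_{c\in\mathbb{R}^d}\sum_{i=1}^t w(x_i)\operatorname{dist}(x_i,c)\le D$. Running times are numbers of steps of deterministic programs (without random access, on binary trees with real numbers at the leaves) with unit-cost tree operations, branching, loops, and unit-cost addition, subtraction and comparison of real numbers, possibly together with a fixed family of further unit-cost binary operations on real numbers. Assume that Cluster Selection is solvable in time $\Phi(m,d,t,D)$, where $\Phi\ge 1$ is non-decreasing in each of its arguments ($m,d\ge1$ integers, $t,D\ge0$ reals). Then there are a program and a constant $K$ such that, given $d$, $X$, $k$, $D$, $\alpha$, and a finite list $\mathcal{D}$ of numbers in $[0,D]$ which contains the cost of every nonempty cluster $C\subseteq X$ with $\operatorname{cost}(C)\le D$, the program decides whether $(X,k,D)$ is a yes-instance of $k$-Clustering in at most \[2^{K(D\log_2 D+1)}\,(nd)^{K}\,|\mathcal{D}|\,\Phi(n,d,2D/\alpha,D)\] steps, where $0\log_2 0=0$ and $|\mathcal D|$ is the length of the list; that is, in time $2^{\mathcal{O}(D\log D)}(nd)^{\mathcal{O}(1)}|\mathcal{D}|\,\Phi(n,d,2D/\alpha,D)$. -/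

import Mathlib

namespace Clust

/-! ### The computation model

Data are binary trees with real numbers at the leaves.  A program is built from tree operations,
real arithmetic, exact comparison of reals, composition, branching and `while` loops; every executed
construct costs one step.  (On a pointer machine with real registers each step takes constant time:
a tree is a pointer and trees are never copied.)  Besides the constant `1`, addition, subtraction
and comparison, a machine may have an arbitrary further family `prim` of binary operations on reals
as unit-cost instructions (multiplication, division, powers, ...). -/

/-- Data: `nil`, a real number, or an ordered pair. -/
inductive Val : Type
  | nil : Val
  | num (r : ℝ) : Val
  | cons (a b : Val) : Val

namespace Val

/-- First component of a pair (`nil` on other data). -/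
def head : Val → Val
  | cons a _ => a
  | _ => nil

/-- Second component of a pair (`nil` on other data). -/
def tail : Val → Val
  | cons _ b => b
  | _ => nil

/-- A binary operation on numbers (`nil` on other data). -/
def map₂ (f : ℝ → ℝ → ℝ) : Val → Val → Val
  | num a, num b => num (f a b)
  | _, _ => nil

open Classical in
/-- Comparison of numbers: `num 1` for true, `nil` for false (and on other data). -/
noncomputable def le : Val → Val → Val
  | num a, num b => if a ≤ b then num 1 else nil
  | _, _ => nil

/-- A list as data. -/
def ofList : List Val → Val
  | [] => nil
  | a :: l => cons a (ofList l)

/-- An integer vector as data: the list of its coordinates. -/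
def ofVec {d : ℕ} (x : Fin d → ℤ) : Val :=
  ofList (List.ofFn fun i => num (x i))

end Val

/-- Programs with additional arithmetic instructions named by `ι`. A program maps data to data. -/
inductive Code (ι : Type) : Type
  | id : Code ι
  | nil : Code ι
  | one : Code ι
  | head : Code ι
  | tail : Code ι
  | cons (f g : Code ι) : Code ι
  | add (f g : Code ι) : Code ι
  | sub (f g : Code ι) : Code ι
  | le (f g : Code ι) : Code ι
  | prim (i : ι) (f g : Code ι) : Code ι
  | comp (g f : Code ι) : Code ι
  | ite (c f g : Code ι) : Code ι
  | loop (c b : Code ι) : Code ι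

/-- `Runs prim p v u t`: the program `p` on input `v` halts with output `u` after exactly `t` steps.
`ite c f g` runs `f` if `c` returns something other than `nil`, and `g` otherwise; `loop c b` is
"while `c` does not return `nil`, replace the current value by the output of `b` on it". -/
inductive Runs {ι : Type} (prim : ι → ℝ → ℝ → ℝ) : Code ι → Val → Val → ℕ → Prop
  | id (v : Val) : Runs prim Code.id v v 1
  | nil (v : Val) : Runs prim Code.nil v Val.nil 1
  | one (v : Val) : Runs prim Code.one v (Val.num 1) 1
  | head (v : Val) : Runs prim Code.head v v.head 1
  | tail (v : Val) : Runs prim Code.tail v v.tail 1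
  | cons {f g : Code ι} {v a b : Val} {s t : ℕ} (hf : Runs prim f v a s) (hg : Runs prim g v b t) :
      Runs prim (Code.cons f g) v (Val.cons a b) (s + t + 1)
  | add {f g : Code ι} {v a b : Val} {s t : ℕ} (hf : Runs prim f v a s) (hg : Runs prim g v b t) :
      Runs prim (Code.add f g) v (Val.map₂ (fun x y => x + y) a b) (s + t + 1)
  | sub {f g : Code ι} {v a b : Val} {s t : ℕ} (hf : Runs prim f v a s) (hg : Runs prim g v b t) :
      Runs prim (Code.sub f g) v (Val.map₂ (fun x y => x - y) a b) (s + t + 1)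
  | le {f g : Code ι} {v a b : Val} {s t : ℕ} (hf : Runs prim f v a s) (hg : Runs prim g v b t) :
      Runs prim (Code.le f g) v (Val.le a b) (s + t + 1)
  | prim (i : ι) {f g : Code ι} {v a b : Val} {s t : ℕ} (hf : Runs prim f v a s)
      (hg : Runs prim g v b t) :
      Runs prim (Code.prim i f g) v (Val.map₂ (prim i) a b) (s + t + 1)
  | comp {g f : Code ι} {v a b : Val} {s t : ℕ} (hf : Runs prim f v a s) (hg : Runs prim g a b t) :
      Runs prim (Code.comp g f) v b (s + t + 1)
  | ite_true {c f g : Code ι} {v r u : Val} {s t : ℕ} (hc : Runs prim c v r s) (hr : r ≠ Val.nil)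
      (hf : Runs prim f v u t) : Runs prim (Code.ite c f g) v u (s + t + 1)
  | ite_false {c f g : Code ι} {v u : Val} {s t : ℕ} (hc : Runs prim c v Val.nil s)
      (hg : Runs prim g v u t) : Runs prim (Code.ite c f g) v u (s + t + 1)
  | loop_done {c b : Code ι} {v : Val} {s : ℕ} (hc : Runs prim c v Val.nil s) :
      Runs prim (Code.loop c b) v v (s + 1)
  | loop_step {c b : Code ι} {v r v' u : Val} {s t q : ℕ} (hc : Runs prim c v r s)
      (hr : r ≠ Val.nil) (hb : Runs prim b v v' t) (hl : Runs prim (Code.loop c b) v' u q) :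
      Runs prim (Code.loop c b) v u (s + t + q + 1)

/-- On input `v` the program `p` halts within `bound` steps and answers the question `Q` correctly
(any output other than `nil` means "yes"). -/
def Decides {ι : Type} (prim : ι → ℝ → ℝ → ℝ) (p : Code ι) (v : Val) (Q : Prop) (bound : ℝ) :
    Prop :=
  ∃ (u : Val) (t : ℕ), Runs prim p v u t ∧ (t : ℝ) ≤ bound ∧ (u ≠ Val.nil ↔ Q)

/-! ### Clusters and distances -/

/-- An integer vector as a real vector. -/
def toReal {d : ℕ} (x : Fin d → ℤ) : Fin d → ℝ := fun i => (x i : ℝ)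

/-- The total distance of the vectors of the cluster `C` to the centroid `c`. -/
noncomputable def distSum (dist : ∀ d : ℕ, (Fin d → ℝ) → (Fin d → ℝ) → ℝ) {d : ℕ}
    (C : Multiset (Fin d → ℤ)) (c : Fin d → ℝ) : ℝ :=
  (C.map fun x => dist d (toReal x) c).sum

/-- The cost of a cluster: the total distance to an optimal centroid. -/
noncomputable def clusterCost (dist : ∀ d : ℕ, (Fin d → ℝ) → (Fin d → ℝ) → ℝ) {d : ℕ}
    (C : Multiset (Fin d → ℤ)) : ℝ :=
  ⨅ c : Fin d → ℝ, distSum dist C c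

/-- What is taken for granted about a distance (given in every dimension): it is nonnegative, points
have distance `0` to themselves, and every cluster has an optimal centroid. No symmetry or triangle
inequality is required. -/
structure IsDistance (dist : ∀ d : ℕ, (Fin d → ℝ) → (Fin d → ℝ) → ℝ) : Prop where
  nonneg : ∀ (d : ℕ) (x y : Fin d → ℝ), 0 ≤ dist d x y
  self : ∀ (d : ℕ) (x : Fin d → ℝ), dist d x x = 0
  exists_optimal : ∀ (d : ℕ) (C : Multiset (Fin d → ℤ)),
    ∃ c : Fin d → ℝ, ∀ c' : Fin d → ℝ, distSum dist C c ≤ distSum dist C c'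

/-- The `α`-property: a composite cluster consisting of `s` initial clusters, that is, with `s ≥ 2`
distinct vectors, costs at least `α (s - 1)`. -/
def AlphaProperty (dist : ∀ d : ℕ, (Fin d → ℝ) → (Fin d → ℝ) → ℝ) (α : ℝ) : Prop :=
  ∀ (d : ℕ) (C : Multiset (Fin d → ℤ)), 2 ≤ C.toFinset.card →
    α * ((C.toFinset.card : ℝ) - 1) ≤ clusterCost dist C

/-! ### `k`-Clustering -/

/-- `(X, k, D)` is a yes-instance: `X` splits into `k` (possibly empty) clusters which admit
centroids of total distance at most `D`. -/
def KClustering (dist : ∀ d : ℕ, (Fin d → ℝ) → (Fin d → ℝ) → ℝ) {d : ℕ}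
    (X : Multiset (Fin d → ℤ)) (k : ℕ) (D : ℝ) : Prop :=
  ∃ (C : Fin k → Multiset (Fin d → ℤ)) (c : Fin k → Fin d → ℝ),
    (∑ i, C i) = X ∧ (∑ i, distSum dist (C i) (c i)) ≤ D

/-- The list `𝒟` contains the costs of all clusters of vectors from `X` that cost at most `D`, and
consists of numbers in `[0, D]`. -/
def IsCostList (dist : ∀ d : ℕ, (Fin d → ℝ) → (Fin d → ℝ) → ℝ) {d : ℕ}
    (X : Multiset (Fin d → ℤ)) (D : ℝ) (𝒟 : List ℝ) : Prop :=
  (∀ δ ∈ 𝒟, 0 ≤ δ ∧ δ ≤ D) ∧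
    ∀ C : Multiset (Fin d → ℤ), C ≤ X → C ≠ 0 → clusterCost dist C ≤ D → clusterCost dist C ∈ 𝒟

/-- The input `d, k, D, α, 𝒟, X` of an algorithm for `k`-Clustering. -/
def clusteringInput {d : ℕ} (X : List (Fin d → ℤ)) (k : ℕ) (D α : ℝ) (𝒟 : List ℝ) : Val :=
  Val.ofList [Val.num d, Val.num k, Val.num D, Val.num α, Val.ofList (𝒟.map Val.num),
    Val.ofList (X.map Val.ofVec)]

/-! ### Cluster Selection -/

/-- An instance of Cluster Selection: disjoint nonempty sets `X₁, …, X_t` (`t ≥ 1`) of integer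
vectors with positive integer weights, each set being listed without repetition, and a budget. -/
structure SelectionInstance (d : ℕ) where
  groups : List (List ((Fin d → ℤ) × ℕ))
  budget : ℝ
  groups_ne : groups ≠ []
  group_ne : ∀ G ∈ groups, G ≠ []
  nodup : (groups.flatten.map Prod.fst).Nodup
  weight_pos : ∀ x ∈ groups.flatten, 0 < x.2
  budget_nonneg : 0 ≤ budget

namespace SelectionInstance

/-- The number `m` of vectors. -/
def size {d : ℕ} (I : SelectionInstance d) : ℕ := I.groups.flatten.length

/-- One vector can be selected from each set so that, for some centroid, the weighted total distance
is at most the budget. -/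
def IsYes (dist : ∀ d : ℕ, (Fin d → ℝ) → (Fin d → ℝ) → ℝ) {d : ℕ} (I : SelectionInstance d) :
    Prop :=
  ∃ s : List ((Fin d → ℤ) × ℕ), List.Forall₂ (fun x G => x ∈ G) s I.groups ∧
    ∃ c : Fin d → ℝ, (s.map fun x => (x.2 : ℝ) * dist d (toReal x.1) c).sum ≤ I.budget

/-- The input `d, budget, X₁, …, X_t` of an algorithm for Cluster Selection. -/
def input {d : ℕ} (I : SelectionInstance d) : Val :=
  Val.ofList [Val.num d, Val.num I.budget,
    Val.ofList (I.groups.map fun G =>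
      Val.ofList (G.map fun x => Val.cons (Val.ofVec x.1) (Val.num x.2)))]

end SelectionInstance

/-- Cluster Selection is solvable in time `Φ(m, d, t, D)`. -/
def SelectionSolvableInTime {ι : Type} (prim : ι → ℝ → ℝ → ℝ)
    (dist : ∀ d : ℕ, (Fin d → ℝ) → (Fin d → ℝ) → ℝ) (Φ : ℕ → ℕ → ℝ → ℝ → ℝ) : Prop :=
  ∃ q : Code ι, ∀ (d : ℕ) (I : SelectionInstance d), 1 ≤ d →
    Decides prim q I.input (I.IsYes dist) (Φ I.size d I.groups.length I.budget)

/-- `Φ(m, d, t, D)` is at least `1` and nondecreasing in all arguments (`m, d ≥ 1`, `t, D ≥ 0`). -/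
structure IsTimeBound (Φ : ℕ → ℕ → ℝ → ℝ → ℝ) : Prop where
  one_le : ∀ (m d : ℕ) (t D : ℝ), 1 ≤ m → 1 ≤ d → 0 ≤ t → 0 ≤ D → 1 ≤ Φ m d t D
  mono : ∀ (m m' d d' : ℕ) (t t' D D' : ℝ), 1 ≤ m → 1 ≤ d → 0 ≤ t → 0 ≤ D →
    m ≤ m' → d ≤ d' → t ≤ t' → D ≤ D' → Φ m d t D ≤ Φ m' d' t' D'

end Clust

open Clust

/-!
Vectors with equal coordinates may be assumed to lie in the same cluster, since assigning every
vector to its nearest centroid does not increase the cost (`exists_labelling`).  By the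
`α`-property, the clusters with at least two distinct vectors then contain at most `2 D / α`
distinct vectors in total, and every other distinct vector is a cluster of its own, at no cost
(`exists_composite`).  If these few vectors were known to lie in different cells of a given
partition of all distinct vectors, and if it were known which cells belong to the same cluster, then
Cluster Selection, with the multiplicities as weights, would find the cheapest choice for every
cluster; as the optimal costs occur in the list `𝒟`, it suffices to ask for the budgets in `𝒟`.
Conversely, any selection of affordable clusters gives a clustering once the unselected vectors are
made clusters of their own (`kClustering_of_selectable`).

The partitions are found without random colourings.  Some `L ≤ log₂ (2 n)` tests (sets of vectors)
separate any two of the at most `n` distinct vectors (`exists_separating_test`).  With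
`T = ⌊2 D / α⌋`, a search splits cells by tests or puts them into clusters; within `2 T` steps, each
with at most `L + T + 1` choices, it reaches a partition that separates the vectors of the composite
clusters and groups the cells correctly (`exists_compatible_search`), and every state that it
reaches with all cells in clusters has at most `T` cells (`SearchInv`).  The inequality `xᵐ ≤ m! eˣ` bounds the number
`(L + T + 1) ^ (2 T)` of states by `2 ^ O(T log T + 1) n²` (`states_le`), and `T log T` is
`O(D log D + 1)` (`exists_exponent_bound`).

Apart from the computation of `T` by repeated subtraction and from the choice of the costs, all steps
of the program are list functions computable in polynomial time (`PolyTime`) in the size of their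
data, which is polynomial in `n`, `d` and the number of states.  The list `𝒟` is only traversed, once
for every cluster of every candidate (`runsIn_affordable`), so the running time is linear in its
length.
-/

namespace Clust

/-! ### Encoded data and time-bounded runs -/

/-- Types whose elements are represented as machine data. -/
class Enc (A : Type) where
  /-- The machine representation of an element. -/
  enc : A → Val

open Enc

instance : Enc ℝ := ⟨Val.num⟩
instance : Enc ℕ := ⟨fun n => Val.num n⟩
instance : Enc ℤ := ⟨fun n => Val.num n⟩
instance : Enc Unit := ⟨fun _ => Val.nil⟩
/-- The truth values `num 1` and `nil` are those of the comparison of numbers. -/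
instance : Enc Bool := ⟨fun b => if b then Val.num 1 else Val.nil⟩
instance {A B : Type} [Enc A] [Enc B] : Enc (A × B) := ⟨fun x => Val.cons (enc x.1) (enc x.2)⟩
instance {A : Type} [Enc A] : Enc (List A) := ⟨fun l => Val.ofList (l.map enc)⟩

section Encoding

variable {A : Type} [Enc A]

@[simp] theorem enc_true : enc true = Val.num 1 := rfl
@[simp] theorem enc_false : enc false = Val.nil := rfl
@[simp] theorem enc_nil : enc ([] : List A) = Val.nil := rfl
theorem enc_cons (a : A) (l : List A) : enc (a :: l) = Val.cons (enc a) (enc l) := rfl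

end Encoding

/-- The number of nodes of a tree. -/
def Val.size : Val → ℕ
  | .nil => 1
  | .num _ => 1
  | .cons a b => 1 + a.size + b.size

/-- The number of nodes of the representation of `a`. -/
def sz {A : Type} [Enc A] (a : A) : ℕ := (enc a).size

section Size

variable {A B : Type} [Enc A] [Enc B]

@[simp] theorem sz_nat (n : ℕ) : sz n = 1 := rfl
@[simp] theorem sz_int (n : ℤ) : sz n = 1 := rfl
@[simp] theorem sz_unit (n : Unit) : sz n = 1 := rfl
@[simp] theorem sz_bool (b : Bool) : sz b = 1 := by cases b <;> rfl
@[simp] theorem sz_pair (x : A × B) : sz x = 1 + sz x.1 + sz x.2 := rfl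
@[simp] theorem sz_nil : sz ([] : List A) = 1 := rfl
@[simp] theorem sz_cons (a : A) (l : List A) : sz (a :: l) = 1 + sz a + sz l := rfl

theorem sz_list (l : List A) : sz l = 1 + (l.map fun a => 1 + sz a).sum := by
  induction l with
  | nil => rfl
  | cons a l ih => simp [ih]; ring

theorem sz_append (l m : List A) : sz (l ++ m) + 1 = sz l + sz m := by
  simp only [sz_list, List.map_append, List.sum_append]; ring

theorem sz_perm {l m : List A} (h : l.Perm m) : sz l = sz m := by
  rw [sz_list, sz_list, (h.map _).sum_eq]

theorem sz_reverse (l : List A) : sz l.reverse = sz l := sz_perm l.reverse_perm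

theorem sz_sublist {l m : List A} (h : l.Sublist m) : sz l ≤ sz m := by
  induction h with
  | slnil => rfl
  | cons a _ ih => simp; omega
  | cons_cons a _ ih => simp; omega

theorem length_le_sz (l : List A) : l.length + 1 ≤ sz l := by
  induction l with
  | nil => simp
  | cons a l ih => simp; omega

theorem sz_le_of_mem {a : A} {l : List A} (h : a ∈ l) : sz a ≤ sz l := by
  induction l with
  | nil => simp at h
  | cons b l ih =>
    rcases List.mem_cons.1 h with rfl | h
    · simp; omega
    · have := ih h; simp; omega

theorem sz_le_of_forall {l : List A} {m : ℕ} (h : ∀ a ∈ l, sz a ≤ m) :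
    sz l ≤ 1 + l.length * (1 + m) := by
  induction l with
  | nil => simp
  | cons a l ih =>
    have h1 := h a (by simp)
    have h2 := ih fun b hb => h b (by simp [hb])
    simp only [sz_cons, List.length_cons]
    nlinarith

end Size

variable {ι : Type} (prim : ι → ℝ → ℝ → ℝ)

/-- On input `v` the program `p` halts with output `u` after at most `B` steps. -/
def RunsIn (p : Code ι) (v u : Val) (B : ℕ) : Prop := ∃ t ≤ B, Runs prim p v u t

variable {prim}

namespace RunsIn

theorem mono {p : Code ι} {v u : Val} {B B' : ℕ} (h : RunsIn prim p v u B) (hB : B ≤ B') :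
    RunsIn prim p v u B' :=
  let ⟨t, ht, hr⟩ := h; ⟨t, ht.trans hB, hr⟩

theorem id (v : Val) : RunsIn prim Code.id v v 1 := ⟨1, le_rfl, .id v⟩
theorem nil (v : Val) : RunsIn prim Code.nil v Val.nil 1 := ⟨1, le_rfl, .nil v⟩
theorem one (v : Val) : RunsIn prim Code.one v (Val.num 1) 1 := ⟨1, le_rfl, .one v⟩
theorem head (a b : Val) : RunsIn prim Code.head (.cons a b) a 1 := ⟨1, le_rfl, .head _⟩
theorem tail (a b : Val) : RunsIn prim Code.tail (.cons a b) b 1 := ⟨1, le_rfl, .tail _⟩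

theorem cons {f g : Code ι} {v a b : Val} {s t : ℕ} (hf : RunsIn prim f v a s)
    (hg : RunsIn prim g v b t) : RunsIn prim (.cons f g) v (.cons a b) (s + t + 1) :=
  let ⟨_, h1, r1⟩ := hf; let ⟨_, h2, r2⟩ := hg; ⟨_, by omega, .cons r1 r2⟩

theorem add {f g : Code ι} {v : Val} {a b : ℝ} {s t : ℕ} (hf : RunsIn prim f v (.num a) s)
    (hg : RunsIn prim g v (.num b) t) : RunsIn prim (.add f g) v (.num (a + b)) (s + t + 1) :=
  let ⟨_, h1, r1⟩ := hf; let ⟨_, h2, r2⟩ := hg; ⟨_, by omega, .add r1 r2⟩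

theorem sub {f g : Code ι} {v : Val} {a b : ℝ} {s t : ℕ} (hf : RunsIn prim f v (.num a) s)
    (hg : RunsIn prim g v (.num b) t) : RunsIn prim (.sub f g) v (.num (a - b)) (s + t + 1) :=
  let ⟨_, h1, r1⟩ := hf; let ⟨_, h2, r2⟩ := hg; ⟨_, by omega, .sub r1 r2⟩

open Classical in
theorem le {f g : Code ι} {v : Val} {a b : ℝ} {s t : ℕ} (hf : RunsIn prim f v (.num a) s)
    (hg : RunsIn prim g v (.num b) t) :
    RunsIn prim (.le f g) v (enc (decide (a ≤ b))) (s + t + 1) := by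
  obtain ⟨_, h1, r1⟩ := hf
  obtain ⟨_, h2, r2⟩ := hg
  have hr := Runs.le r1 r2
  have he : Val.le (.num a) (.num b) = enc (decide (a ≤ b)) := by
    by_cases h : a ≤ b <;> simp [Val.le, h]
  exact ⟨_, by omega, he ▸ hr⟩

theorem comp {g f : Code ι} {v a b : Val} {s t : ℕ} (hf : RunsIn prim f v a s)
    (hg : RunsIn prim g a b t) : RunsIn prim (.comp g f) v b (s + t + 1) :=
  let ⟨_, h1, r1⟩ := hf; let ⟨_, h2, r2⟩ := hg; ⟨_, by omega, .comp r1 r2⟩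

theorem ite_pos {c f g : Code ι} {v r u : Val} {s t : ℕ} (hc : RunsIn prim c v r s)
    (hr : r ≠ .nil) (hf : RunsIn prim f v u t) : RunsIn prim (.ite c f g) v u (s + t + 1) :=
  let ⟨_, h1, r1⟩ := hc; let ⟨_, h2, r2⟩ := hf; ⟨_, by omega, .ite_true r1 hr r2⟩

theorem ite_neg {c f g : Code ι} {v u : Val} {s t : ℕ} (hc : RunsIn prim c v .nil s)
    (hg : RunsIn prim g v u t) : RunsIn prim (.ite c f g) v u (s + t + 1) :=
  let ⟨_, h1, r1⟩ := hc; let ⟨_, h2, r2⟩ := hg; ⟨_, by omega, .ite_false r1 r2⟩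

theorem ite {c f g : Code ι} {v u w : Val} {b : Bool} {s t : ℕ}
    (hc : RunsIn prim c v (enc b) s) (hf : b = true → RunsIn prim f v u t)
    (hg : b = false → RunsIn prim g v w t) :
    RunsIn prim (.ite c f g) v (if b then u else w) (s + t + 1) := by
  cases b
  · exact ite_neg hc (hg rfl)
  · exact ite_pos hc (by simp) (hf rfl)

theorem loop_done {c b : Code ι} {v : Val} {s : ℕ} (hc : RunsIn prim c v .nil s) :
    RunsIn prim (.loop c b) v v (s + 1) :=
  let ⟨_, h1, r1⟩ := hc; ⟨_, by omega, .loop_done r1⟩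

theorem loop_step {c b : Code ι} {v r v' u : Val} {s t q : ℕ} (hc : RunsIn prim c v r s)
    (hr : r ≠ .nil) (hb : RunsIn prim b v v' t) (hl : RunsIn prim (.loop c b) v' u q) :
    RunsIn prim (.loop c b) v u (s + t + q + 1) :=
  let ⟨_, h1, r1⟩ := hc; let ⟨_, h2, r2⟩ := hb; let ⟨_, h3, r3⟩ := hl
  ⟨_, by omega, .loop_step r1 hr r2 r3⟩

end RunsIn

/-! ### Folding over a list -/

/-- The loop of `foldCode`; its state is `(e, s, l)`, where `l` is the rest of the list. -/
def foldLoop (c : Code ι) : Code ι :=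
  .loop (.comp .tail .tail)
    (.cons .head
      (.cons
        (.comp c (.cons .head (.cons (.comp .head .tail) (.comp .head (.comp .tail .tail)))))
        (.comp .tail (.comp .tail .tail))))

/-- Maps `(e, s, l)` to the left fold of `l` from `s`, when `c` maps `(e, s, a)` to the next
state. -/
def foldCode (c : Code ι) : Code ι := .comp (.comp .head .tail) (foldLoop c)

section Fold

variable {E S A : Type} [Enc E] [Enc S] [Enc A]

/-- Only the states that occur in the fold need a time bound for the step. -/
theorem RunsIn.foldLoop {c : Code ι} {step : S → A → S} {e : E} {B : ℕ} (l : List A) (s : S)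
    (h : ∀ l₁ a l₂, l = l₁ ++ a :: l₂ →
      RunsIn prim c (enc (e, l₁.foldl step s, a)) (enc (step (l₁.foldl step s) a)) B) :
    RunsIn prim (foldLoop c) (enc (e, s, l)) (enc (e, l.foldl step s, ([] : List A)))
      (l.length * (B + 30) + 5) := by
  induction l generalizing s with
  | nil =>
    refine RunsIn.mono (RunsIn.loop_done (s := 3) ?_) (by omega)
    exact (RunsIn.tail _ _).comp (RunsIn.tail _ _)
  | cons a l ih =>
    have hl : RunsIn prim (.comp .tail .tail : Code ι) (enc (e, s, a :: l)) (enc (a :: l)) 3 :=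
      (RunsIn.tail _ _).comp (RunsIn.tail _ _)
    have hstep := h [] a l rfl
    have hrec := ih (step s a) fun l₁ b l₂ hl => h (a :: l₁) b l₂ (by simp [hl])
    refine RunsIn.mono (RunsIn.loop_step (t := B + 25) hl (by simp [enc_cons]) ?_ hrec) ?_
    · refine RunsIn.mono ((RunsIn.head _ _).cons (RunsIn.cons (RunsIn.comp
        ((RunsIn.head _ _).cons (RunsIn.cons ((RunsIn.tail _ _).comp (RunsIn.head _ _))
          (hl.comp (RunsIn.head _ _)))) hstep) (hl.comp (RunsIn.tail _ _)))) (by omega)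
    · simp only [List.length_cons]
      nlinarith

theorem RunsIn.foldCode {c : Code ι} {step : S → A → S} {e : E} {B : ℕ} (l : List A) (s : S)
    (h : ∀ l₁ a l₂, l = l₁ ++ a :: l₂ →
      RunsIn prim c (enc (e, l₁.foldl step s, a)) (enc (step (l₁.foldl step s) a)) B) :
    RunsIn prim (foldCode c) (enc (e, s, l)) (enc (l.foldl step s))
      (l.length * (B + 30) + 9) :=
  ((RunsIn.foldLoop l s h).comp ((RunsIn.tail _ _).comp (RunsIn.head _ _))).mono (by omega)

end Fold

/-! ### Polynomially bounded functions -/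

/-- Monotone functions with a polynomial bound. -/
structure PolyFn (p : ℕ → ℕ) : Prop where
  mono : Monotone p
  bound : ∃ K, ∀ n, p n ≤ (n + 2) ^ K

namespace PolyFn

theorem id : PolyFn fun n => n := ⟨monotone_id, 1, fun n => by simp⟩

theorem const (c : ℕ) : PolyFn fun _ => c :=
  ⟨monotone_const, c, fun n => (Nat.lt_two_pow_self).le.trans (Nat.pow_le_pow_left (by omega) _)⟩

theorem add {p q : ℕ → ℕ} (hp : PolyFn p) (hq : PolyFn q) : PolyFn fun n => p n + q n := by
  obtain ⟨mp, K, hK⟩ := hp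
  obtain ⟨mq, L, hL⟩ := hq
  refine ⟨mp.add mq, K + L + 1, fun n => ?_⟩
  have h1 : (n + 2) ^ K ≤ (n + 2) ^ (K + L) := Nat.pow_le_pow_right (by omega) (by omega)
  have h2 : (n + 2) ^ L ≤ (n + 2) ^ (K + L) := Nat.pow_le_pow_right (by omega) (by omega)
  rw [pow_succ]
  nlinarith [hK n, hL n, Nat.zero_le (n * (n + 2) ^ (K + L))]

theorem mul {p q : ℕ → ℕ} (hp : PolyFn p) (hq : PolyFn q) : PolyFn fun n => p n * q n := by
  obtain ⟨mp, K, hK⟩ := hp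
  obtain ⟨mq, L, hL⟩ := hq
  refine ⟨fun a b h => Nat.mul_le_mul (mp h) (mq h), K + L, fun n => ?_⟩
  rw [pow_add]
  exact Nat.mul_le_mul (hK n) (hL n)

theorem comp {p q : ℕ → ℕ} (hp : PolyFn p) (hq : PolyFn q) : PolyFn fun n => p (q n) := by
  obtain ⟨mp, K, hK⟩ := hp
  obtain ⟨mq, L, hL⟩ := hq
  refine ⟨mp.comp mq, (L + 2) * K, fun n => (hK _).trans ?_⟩
  rw [pow_mul]
  refine Nat.pow_le_pow_left ?_ _
  have h1 : 1 ≤ (n + 2) ^ L := Nat.one_le_pow _ _ (by omega)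
  have := hL n
  rw [pow_add, pow_two]
  nlinarith [Nat.zero_le (n * (n + 2) ^ L), Nat.zero_le (n * n * (n + 2) ^ L)]

end PolyFn

/-! ### Functions computable in polynomial time -/

variable (prim) in
/-- `f` is computed by a program whose running time and output size are polynomially bounded in the
size of the input.  (Size of the output is bounded separately because a machine can build trees of
exponential size by sharing.) -/
def PolyTime {A B : Type} [Enc A] [Enc B] (f : A → B) : Prop :=
  ∃ (c : Code ι) (p : ℕ → ℕ), PolyFn p ∧
    ∀ a, RunsIn prim c (enc a) (enc (f a)) (p (sz a)) ∧ sz (f a) ≤ p (sz a)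

namespace PolyTime

variable {A B C X : Type} [Enc A] [Enc B] [Enc C] [Enc X]

theorem size_bound {f : A → B} (hf : PolyTime prim f) :
    ∃ p, PolyFn p ∧ ∀ a, sz (f a) ≤ p (sz a) :=
  let ⟨_, p, hp, h⟩ := hf; ⟨p, hp, fun a => (h a).2⟩

/-- A function whose program has constant running time and whose output is not larger than the
input by more than a constant. -/
theorem of_const {f : A → B} (c : Code ι) (k : ℕ)
    (h : ∀ a, RunsIn prim c (enc a) (enc (f a)) k ∧ sz (f a) ≤ sz a + k) : PolyTime prim f :=
  ⟨c, fun n => n + k, PolyFn.id.add (PolyFn.const k), fun a =>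
    ⟨(h a).1.mono (Nat.le_add_left _ _), (h a).2⟩⟩

protected theorem id : PolyTime prim fun a : A => a :=
  of_const .id 1 fun _ => ⟨RunsIn.id _, by omega⟩

theorem comp {g : B → C} {f : A → B} (hg : PolyTime prim g) (hf : PolyTime prim f) :
    PolyTime prim fun a => g (f a) := by
  obtain ⟨c, p, hp, hc⟩ := hg
  obtain ⟨c', q, hq, hc'⟩ := hf
  refine ⟨.comp c c', fun n => q n + p (q n) + 1, (hq.add (hp.comp hq)).add (PolyFn.const 1),
    fun a => ⟨?_, ?_⟩⟩
  · refine ((hc' a).1.comp (hc (f a)).1).mono ?_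
    have := hp.mono (hc' a).2
    beta_reduce
    omega
  · have := hp.mono (hc' a).2
    have := (hc (f a)).2
    beta_reduce
    omega

theorem pair {f : X → A} {g : X → B} (hf : PolyTime prim f) (hg : PolyTime prim g) :
    PolyTime prim fun x => (f x, g x) := by
  obtain ⟨c, p, hp, hc⟩ := hf
  obtain ⟨c', q, hq, hc'⟩ := hg
  refine ⟨.cons c c', fun n => p n + q n + 1, (hp.add hq).add (PolyFn.const 1), fun a =>
    ⟨(hc a).1.cons (hc' a).1, ?_⟩⟩
  have h1 := (hc a).2
  have h2 := (hc' a).2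
  simp only [sz_pair]
  omega

theorem fst {f : X → A × B} (hf : PolyTime prim f) : PolyTime prim fun x => (f x).1 :=
  comp (g := Prod.fst) (of_const .head 1 fun _ => ⟨RunsIn.head _ _, by simp; omega⟩) hf

theorem snd {f : X → A × B} (hf : PolyTime prim f) : PolyTime prim fun x => (f x).2 :=
  comp (g := Prod.snd) (of_const .tail 1 fun _ => ⟨RunsIn.tail _ _, by simp; omega⟩) hf

theorem nil : PolyTime prim fun _ : X => ([] : List A) :=
  of_const .nil 1 fun _ => ⟨RunsIn.nil _, by simp⟩

theorem constTrue : PolyTime prim fun _ : X => true :=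
  of_const .one 1 fun _ => ⟨RunsIn.one _, by simp⟩

theorem constFalse : PolyTime prim fun _ : X => false :=
  of_const .nil 1 fun _ => ⟨RunsIn.nil _, by simp⟩

/-- Numbers are built from the constant `1` of the machine. -/
theorem constOne : PolyTime prim fun _ : X => 1 :=
  of_const (f := fun _ : X => 1) .one 1 fun _ => ⟨by simpa [enc] using RunsIn.one _, by simp⟩

theorem constZero : PolyTime prim fun _ : X => 0 :=
  of_const (f := fun _ : X => 0) (.sub .one .one) 3 fun _ =>
    ⟨by simpa [enc] using (RunsIn.one _).sub (RunsIn.one _), by simp⟩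

theorem cons {f : X → A} {g : X → List A} (hf : PolyTime prim f) (hg : PolyTime prim g) :
    PolyTime prim fun x => f x :: g x := by
  obtain ⟨c, p, hp, h⟩ := hf.pair hg
  exact ⟨c, p, hp, h⟩

theorem add {f g : X → ℕ} (hf : PolyTime prim f) (hg : PolyTime prim g) :
    PolyTime prim fun x => f x + g x := by
  refine comp (g := fun y : ℕ × ℕ => y.1 + y.2) (of_const (.add .head .tail) 3 fun y => ⟨?_, ?_⟩)
    (hf.pair hg)
  · simpa [enc] using (RunsIn.head _ _).add (RunsIn.tail _ _)
  · simp

theorem le {f g : X → ℕ} (hf : PolyTime prim f) (hg : PolyTime prim g) :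
    PolyTime prim fun x => decide (f x ≤ g x) := by
  refine comp (g := fun y : ℕ × ℕ => decide (y.1 ≤ y.2))
    (of_const (.le .head .tail) 3 fun y => ⟨?_, ?_⟩) (hf.pair hg)
  · simpa [enc] using (RunsIn.head (prim := prim) (.num y.1) (.num y.2)).le (RunsIn.tail _ _)
  · simp

theorem intLe {f g : X → ℤ} (hf : PolyTime prim f) (hg : PolyTime prim g) :
    PolyTime prim fun x => decide (f x ≤ g x) := by
  refine comp (g := fun y : ℤ × ℤ => decide (y.1 ≤ y.2))
    (of_const (.le .head .tail) 3 fun y => ⟨?_, ?_⟩) (hf.pair hg)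
  · simpa [enc] using (RunsIn.head (prim := prim) (.num y.1) (.num y.2)).le (RunsIn.tail _ _)
  · simp

theorem ite {b : X → Bool} {f g : X → A} (hb : PolyTime prim b) (hf : PolyTime prim f)
    (hg : PolyTime prim g) : PolyTime prim fun x => if b x then f x else g x := by
  obtain ⟨c, p, hp, hc⟩ := hb
  obtain ⟨c₁, p₁, hp₁, hc₁⟩ := hf
  obtain ⟨c₂, p₂, hp₂, hc₂⟩ := hg
  refine ⟨.ite c c₁ c₂, fun n => p n + (p₁ n + p₂ n) + 1,
    (hp.add (hp₁.add hp₂)).add (PolyFn.const 1), fun a => ⟨?_, ?_⟩⟩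
  · rw [apply_ite enc]
    exact (hc a).1.ite (fun _ => (hc₁ a).1.mono (by omega)) (fun _ => (hc₂ a).1.mono (by omega))
  · have h1 := (hc₁ a).2
    have h2 := (hc₂ a).2
    beta_reduce
    split_ifs <;> omega

theorem and {f g : X → Bool} (hf : PolyTime prim f) (hg : PolyTime prim g) :
    PolyTime prim fun x => f x && g x := by
  convert hf.ite hg constFalse using 2 with x
  cases f x <;> simp

theorem or {f g : X → Bool} (hf : PolyTime prim f) (hg : PolyTime prim g) :
    PolyTime prim fun x => f x || g x := by
  convert hf.ite constTrue hg using 2 with x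
  cases f x <;> simp

theorem not {f : X → Bool} (hf : PolyTime prim f) : PolyTime prim fun x => !(f x) := by
  convert hf.ite constFalse constTrue using 2 with x
  cases f x <;> simp

end PolyTime

/-- Case distinction on a list. -/
def listCase {A B : Type} (l : List A) (b : B) (f : A → List A → B) : B :=
  match l with
  | [] => b
  | a :: l => f a l

@[simp] theorem listCase_nil {A B : Type} (b : B) (f : A → List A → B) :
    listCase [] b f = b := rfl

@[simp] theorem listCase_cons {A B : Type} (a : A) (l : List A) (b : B) (f : A → List A → B) :
    listCase (a :: l) b f = f a l := rfl

namespace PolyTime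

variable {A B C X S : Type} [Enc A] [Enc B] [Enc C] [Enc X] [Enc S]

theorem listCase {g : X → List A} {b : X → B} {f : X → A → List A → B} (hg : PolyTime prim g)
    (hb : PolyTime prim b) (hf : PolyTime prim fun y : X × A × List A => f y.1 y.2.1 y.2.2) :
    PolyTime prim fun x => listCase (g x) (b x) (f x) := by
  obtain ⟨c, p, hp, hc⟩ := hg
  obtain ⟨c₁, p₁, hp₁, hc₁⟩ := hb
  obtain ⟨c₂, p₂, hp₂, hc₂⟩ := hf
  have hsz : ∀ x a l, g x = a :: l → sz (x, a, l) ≤ sz x + p (sz x) + 2 := by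
    intro x a l h
    have := (hc x).2
    rw [h] at this
    simp only [sz_pair, sz_cons] at this ⊢
    omega
  refine ⟨.ite c (.comp c₂ (.cons .id (.cons (.comp .head c) (.comp .tail c)))) c₁,
    fun n => p₁ n + 3 * p n + p₂ (n + p n + 2) + 10,
    ((hp₁.add ((PolyFn.const 3).mul hp)).add (hp₂.comp ((PolyFn.id.add hp).add
      (PolyFn.const 2)))).add (PolyFn.const 10), fun x => ?_⟩
  obtain ⟨h1, h2⟩ := hc x
  cases hx : g x with
  | nil =>
    rw [hx] at h1
    obtain ⟨h3, h4⟩ := hc₁ x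
    beta_reduce
    simp only [hx, Clust.listCase]
    exact ⟨(h1.ite_neg h3).mono (by omega), by omega⟩
  | cons a l =>
    have h6 := hp₂.mono (hsz x a l hx)
    rw [hx] at h1
    obtain ⟨h3, h4⟩ := hc₂ (x, a, l)
    beta_reduce
    simp only [hx, Clust.listCase]
    refine ⟨(h1.ite_pos (by simp [enc_cons]) (((RunsIn.id _).cons ((h1.comp
      (RunsIn.head _ _)).cons (h1.comp (RunsIn.tail _ _)))).comp h3)).mono ?_, ?_⟩
    · omega
    · simp only at h4
      omega

/-- A left fold is computable in polynomial time if the intermediate states have polynomial size. -/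
theorem foldl {g : X → List A} {s : X → S} {step : X → S → A → S} (hg : PolyTime prim g)
    (hs : PolyTime prim s) (hstep : PolyTime prim fun y : X × S × A => step y.1 y.2.1 y.2.2)
    (hb : ∃ q, PolyFn q ∧ ∀ x l, l <+: g x → sz (l.foldl (step x) (s x)) ≤ q (sz x)) :
    PolyTime prim fun x => (g x).foldl (step x) (s x) := by
  obtain ⟨c, p, hp, hc⟩ := PolyTime.id.pair (hs.pair hg)
  obtain ⟨pg, hpg, hg⟩ := hg.size_bound
  obtain ⟨c₂, p₂, hp₂, hc₂⟩ := hstep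
  obtain ⟨q, hq, hb⟩ := hb
  refine ⟨.comp (foldCode c₂) c,
    fun n => p n + pg n * (p₂ (n + q n + pg n + 2) + 30) + q n + 10,
    ((hp.add (hpg.mul ((hp₂.comp (((PolyFn.id.add hq).add hpg).add (PolyFn.const 2))).add
      (PolyFn.const 30)))).add hq).add (PolyFn.const 10), fun x => ⟨?_, ?_⟩⟩
  · refine ((hc x).1.comp (RunsIn.foldCode (B := p₂ (sz x + q (sz x) + pg (sz x) + 2))
      (g x) (s x) ?_)).mono ?_
    · intro l₁ a l₂ h
      refine (hc₂ (x, l₁.foldl (step x) (s x), a)).1.mono (hp₂.mono ?_)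
      have h1 := hb x l₁ ⟨_, h.symm⟩
      have h2 : sz a ≤ sz (g x) := sz_le_of_mem (by simp [h])
      have h3 := hg x
      simp only [sz_pair]
      omega
    · have h1 := length_le_sz (g x)
      have h2 := Nat.mul_le_mul_right (p₂ (sz x + q (sz x) + pg (sz x) + 2) + 30)
        ((Nat.le_succ _).trans (h1.trans (hg x)))
      beta_reduce
      omega
  · have := hb x (g x) List.prefix_rfl
    beta_reduce
    omega

theorem reverse {g : X → List A} (hg : PolyTime prim g) : PolyTime prim fun x => (g x).reverse := by
  have h := foldl (s := fun _ => []) (step := fun _ s a => a :: s) hg nil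
    (PolyTime.id.snd.snd.cons PolyTime.id.snd.fst) ?_
  · simpa using h
  · obtain ⟨p, hp, h⟩ := hg.size_bound
    refine ⟨p, hp, fun x l hl => ?_⟩
    simp only [List.foldl_flip_cons_eq_append', List.append_nil, sz_reverse]
    exact (sz_sublist hl.sublist).trans (h x)

/-- A right fold is computable in polynomial time if the intermediate states have polynomial
size. -/
theorem foldr {g : X → List A} {s : X → S} {step : X → A → S → S} (hg : PolyTime prim g)
    (hs : PolyTime prim s) (hstep : PolyTime prim fun y : X × A × S => step y.1 y.2.1 y.2.2)
    (hb : ∃ q, PolyFn q ∧ ∀ x l, l <:+ g x → sz (l.foldr (step x) (s x)) ≤ q (sz x)) :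
    PolyTime prim fun x => (g x).foldr (step x) (s x) := by
  have h := foldl (s := s) (step := fun x s a => step x a s) hg.reverse hs
    (hstep.comp (PolyTime.id.fst.pair (PolyTime.id.snd.snd.pair PolyTime.id.snd.fst))) ?_
  · simpa using h
  · obtain ⟨q, hq, hb⟩ := hb
    refine ⟨q, hq, fun x l hl => ?_⟩
    rw [← List.foldr_reverse]
    exact hb x _ (List.reverse_prefix.1 (by simpa using hl))

theorem append {f g : X → List A} (hf : PolyTime prim f) (hg : PolyTime prim g) :
    PolyTime prim fun x => f x ++ g x := by
  have h := foldr (step := fun _ a s => a :: s) hf hg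
    (PolyTime.id.snd.fst.cons PolyTime.id.snd.snd) ?_
  · simpa using h
  · obtain ⟨p, hp, hf⟩ := hf.size_bound
    obtain ⟨q, hq, hg⟩ := hg.size_bound
    refine ⟨_, hp.add hq, fun x l hl => ?_⟩
    have h1 := sz_append l (g x)
    have h2 := (sz_sublist hl.sublist).trans (hf x)
    have h3 := hg x
    simp only [List.foldr_cons_eq_append', ]
    omega

/-- Here and in the following lemmas, the function applied to the entries of the list may depend on
the input `x`. -/
theorem map {g : X → List A} {f : X → A → B} (hg : PolyTime prim g)
    (hf : PolyTime prim fun y : X × A => f y.1 y.2) : PolyTime prim fun x => (g x).map (f x) := by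
  have h := foldr (s := fun _ => []) (step := fun x a s => f x a :: s) hg nil
    ((hf.comp (PolyTime.id.fst.pair PolyTime.id.snd.fst)).cons PolyTime.id.snd.snd) ?_
  · simpa using h
  · obtain ⟨p, hp, hf⟩ := hf.size_bound
    obtain ⟨q, hq, hg⟩ := hg.size_bound
    refine ⟨_, (PolyFn.const 1).add (hq.mul ((PolyFn.const 1).add
      (hp.comp ((PolyFn.const 1).add (PolyFn.id.add hq))))), fun x l hl => ?_⟩
    have h1 : l.foldr (fun a s => f x a :: s) [] = l.map (f x) := by simp
    rw [h1]
    refine (sz_le_of_forall (m := p (1 + (sz x + q (sz x)))) ?_).trans ?_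
    · intro b hb
      obtain ⟨a, ha, rfl⟩ := List.mem_map.1 hb
      refine (hf (x, a)).trans (hp.mono ?_)
      have := (sz_le_of_mem (hl.mem ha)).trans (hg x)
      simp only [sz_pair]
      omega
    · have h2 := length_le_sz l
      have h3 := (sz_sublist hl.sublist).trans (hg x)
      rw [List.length_map]
      gcongr
      omega

theorem flatten {g : X → List (List A)} (hg : PolyTime prim g) :
    PolyTime prim fun x => (g x).flatten := by
  have h := foldr (s := fun _ => []) (step := fun _ a s => a ++ s) hg nil
    (PolyTime.id.snd.fst.append PolyTime.id.snd.snd) ?_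
  · convert h using 2 with x
    induction g x with
    | nil => rfl
    | cons a l ih => simp [ih]
  · obtain ⟨q, hq, hg⟩ := hg.size_bound
    refine ⟨q, hq, fun x l hl => ?_⟩
    refine le_trans ?_ ((sz_sublist hl.sublist).trans (hg x))
    clear hl
    induction l with
    | nil => simp
    | cons a l ih =>
      have := sz_append a (l.foldr (fun a s => a ++ s) [])
      simp only [List.foldr_cons, sz_cons]
      omega

theorem flatMap {g : X → List A} {f : X → A → List B} (hg : PolyTime prim g)
    (hf : PolyTime prim fun y : X × A => f y.1 y.2) :
    PolyTime prim fun x => (g x).flatMap (f x) := by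
  simpa [List.flatMap] using (hg.map hf).flatten

theorem filter {g : X → List A} {f : X → A → Bool} (hg : PolyTime prim g)
    (hf : PolyTime prim fun y : X × A => f y.1 y.2) :
    PolyTime prim fun x => (g x).filter (f x) := by
  have h := hg.flatMap (f := fun x a => if f x a then [a] else [])
    (hf.ite (PolyTime.id.snd.cons nil) nil)
  convert h using 2 with x
  induction g x with
  | nil => rfl
  | cons a l ih => cases hfa : f x a <;> simp [hfa, ih]

theorem any {g : X → List A} {f : X → A → Bool} (hg : PolyTime prim g)
    (hf : PolyTime prim fun y : X × A => f y.1 y.2) :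
    PolyTime prim fun x => (g x).any (f x) := by
  have h := foldr (s := fun _ => false) (step := fun x a s => f x a || s) hg constFalse
    ((hf.comp (PolyTime.id.fst.pair PolyTime.id.snd.fst)).or PolyTime.id.snd.snd)
    ⟨_, PolyFn.const 1, fun x l _ => by simp⟩
  convert h using 2 with x
  induction g x with
  | nil => rfl
  | cons a l ih => simp [ih]

theorem isEmpty {g : X → List A} (hg : PolyTime prim g) : PolyTime prim fun x => (g x).isEmpty := by
  convert listCase hg constTrue (f := fun _ _ _ => false) constFalse using 2 with x
  cases g x <;> rfl

theorem length {g : X → List A} (hg : PolyTime prim g) : PolyTime prim fun x => (g x).length := by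
  have h := foldr (s := fun _ => 0) (step := fun _ _ s => s + 1) hg constZero
    (PolyTime.id.snd.snd.add constOne) ⟨_, PolyFn.const 1, fun x l _ => by simp⟩
  simpa using h

/-- The pairs of entries at equal positions of two lists, last pair first. -/
theorem zipReverse {f : X → List A} {g : X → List B} (hf : PolyTime prim f)
    (hg : PolyTime prim g) : PolyTime prim fun x => ((f x).zip (g x)).reverse := by
  have key : ∀ (l : List A) (m : List B) (r : List (A × B)),
      l.foldl (fun s a => Clust.listCase s.1 s fun b m => (m, (a, b) :: s.2)) (m, r)
        = (m.drop l.length, (l.zip m).reverse ++ r) := by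
    intro l
    induction l with
    | nil => simp
    | cons a l ih =>
      intro m r
      cases m with
      | nil => simp [ih]
      | cons b m => simp [ih]
  have h := foldl (s := fun x => (g x, ([] : List (A × B))))
    (step := fun _ s a => Clust.listCase s.1 s fun b m => (m, (a, b) :: s.2)) hf (hg.pair nil)
    (listCase PolyTime.id.snd.fst.fst PolyTime.id.snd.fst (PolyTime.id.snd.snd.pair
      (PolyTime.cons (PolyTime.pair PolyTime.id.fst.snd.snd PolyTime.id.snd.fst)
        PolyTime.id.fst.snd.fst.snd))) ?_
  · convert h.snd using 2 with x
    simp [key]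
  · obtain ⟨p, hp, hf⟩ := hf.size_bound
    obtain ⟨q, hq, hg⟩ := hg.size_bound
    refine ⟨_, (PolyFn.const 1).add (hq.add ((PolyFn.const 1).add (hp.mul ((PolyFn.const 1).add
      ((PolyFn.const 1).add (hp.add hq)))))), fun x l hl => ?_⟩
    have h3 := (sz_sublist hl.sublist).trans (hf x)
    have h4 := length_le_sz l
    rw [key, List.append_nil]
    simp only [sz_pair, sz_reverse]
    have h5 := (sz_sublist ((g x).drop_sublist l.length)).trans (hg x)
    have h6 : sz (l.zip (g x)) ≤ 1 + (l.zip (g x)).length * (1 + (1 + (p (sz x) + q (sz x)))) := by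
      refine sz_le_of_forall fun y hy => ?_
      obtain ⟨h7, h8⟩ := List.of_mem_zip (a := y.1) (b := y.2) hy
      have h9 := sz_le_of_mem h7
      have h10 := (sz_le_of_mem h8).trans (hg x)
      simp only [sz_pair]
      omega
    have h7 : (l.zip (g x)).length ≤ p (sz x) := by
      rw [List.length_zip]
      omega
    have h8 := Nat.mul_le_mul_right (1 + (1 + (p (sz x) + q (sz x)))) h7
    omega

end PolyTime

variable (prim) in
/-- Types on which equality can be tested in polynomial time. -/
def PolyEq (A : Type) [Enc A] [DecidableEq A] : Prop :=
  PolyTime prim fun y : A × A => decide (y.1 = y.2)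

namespace PolyEq

variable {A B X : Type} [Enc A] [Enc B] [Enc X] [DecidableEq A] [DecidableEq B]

theorem nat : PolyEq prim ℕ := by
  unfold PolyEq
  convert (PolyTime.id.fst.le PolyTime.id.snd).and
    ((PolyTime.id (A := ℕ × ℕ)).snd.le PolyTime.id.fst) using 2 with y
  rw [← Bool.decide_and, decide_eq_decide]
  omega

theorem int : PolyEq prim ℤ := by
  unfold PolyEq
  convert (PolyTime.id.fst.intLe PolyTime.id.snd).and
    ((PolyTime.id (A := ℤ × ℤ)).snd.intLe PolyTime.id.fst) using 2 with y
  rw [← Bool.decide_and, decide_eq_decide]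
  omega

theorem eq (h : PolyEq prim A) {f g : X → A} (hf : PolyTime prim f) (hg : PolyTime prim g) :
    PolyTime prim fun x => decide (f x = g x) :=
  PolyTime.comp (g := fun y : A × A => decide (y.1 = y.2)) h (hf.pair hg)

theorem prod (h₁ : PolyEq prim A) (h₂ : PolyEq prim B) : PolyEq prim (A × B) := by
  unfold PolyEq
  convert (h₁.eq (PolyTime.id (A := (A × B) × (A × B))).fst.fst PolyTime.id.snd.fst).and
    (h₂.eq PolyTime.id.fst.snd PolyTime.id.snd.snd) using 2 with y
  rw [← Bool.decide_and, decide_eq_decide, Prod.ext_iff]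

/-- Two lists are equal if they have equal lengths and equal entries at equal positions. -/
theorem list (h : PolyEq prim A) : PolyEq prim (List A) := by
  unfold PolyEq
  have hz := PolyTime.zipReverse (PolyTime.id (prim := prim) (A := List A × List A)).fst
    PolyTime.id.snd
  have hlen := nat.eq (PolyTime.id (prim := prim) (A := List A × List A)).fst.length
    PolyTime.id.snd.length
  convert hlen.and (hz.any (f := fun _ p => !decide (p.1 = p.2))
    (h.eq PolyTime.id.snd.fst PolyTime.id.snd.snd).not).not using 2 with y
  obtain ⟨l, m⟩ := y
  simp only [List.any_reverse]
  induction l generalizing m with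
  | nil => cases m <;> simp
  | cons a l ih =>
    cases m with
    | nil => simp
    | cons b m =>
      have := ih m
      by_cases hab : a = b <;> simp_all

theorem mem (h : PolyEq prim A) {f : X → A} {g : X → List A} (hf : PolyTime prim f)
    (hg : PolyTime prim g) : PolyTime prim fun x => decide (f x ∈ g x) := by
  convert hg.any (f := fun x a => decide (f x = a)) (h.eq (hf.comp PolyTime.id.fst)
    PolyTime.id.snd) using 2 with x
  rw [Bool.eq_iff_iff]
  simp

end PolyEq

/-! ### Tests separating the elements of a list -/

section Tests

variable {A : Type}

/-- If there are fewer than `N` words, doubles their number: a new letter is either prepended or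
not. -/
def extendWords (N : ℕ) (s : List ℕ × List (List ℕ)) : List ℕ × List (List ℕ) :=
  if decide (N ≤ s.2.length) then s
  else (s.1.length :: s.1, s.2 ++ s.2.map (s.1.length :: ·))

/-- The letters `L - 1, …, 0` and the `2 ^ L` words (subsets of the letters) for the least `L` with
at least `Y.length` words. -/
def words (Y : List A) : List ℕ × List (List ℕ) :=
  Y.foldl (fun s _ => extendWords Y.length s) ([], [[]])

/-- For every letter, the elements of `Y` whose word contains the letter. -/
def tests (Y : List A) : List (List A) :=
  (words Y).1.map fun j =>
    ((((words Y).2.zip Y).reverse.filter fun y => decide (j ∈ y.1)).map Prod.snd)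

/-- The states reached by doubling words. -/
theorem foldl_extendWords (N : ℕ) (hN : 1 ≤ N) (l : List A) :
    ∃ L, l.foldl (fun s _ => extendWords N s) ([], [[]])
        = ((List.range L).reverse, (List.range L).reverse.sublists') ∧
      L ≤ l.length ∧ 2 ^ L ≤ 2 * N ∧ (L = l.length ∨ N ≤ 2 ^ L) := by
  induction l using List.reverseRecOn with
  | nil => exact ⟨0, by simp, by simp, by simp; omega, by simp⟩
  | append_singleton l a ih =>
    obtain ⟨L, h1, h2, h3, h4⟩ := ih
    rw [List.foldl_append, h1]
    simp only [List.foldl_cons, List.foldl_nil, extendWords, List.length_sublists',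
      List.length_reverse, List.length_range]
    by_cases h : N ≤ 2 ^ L
    · exact ⟨L, by simp [h], by simp; omega, h3, Or.inr h⟩
    · refine ⟨L + 1, ?_, by simp; omega, by rw [pow_succ]; omega, ?_⟩
      · simp [h, List.range_succ]
      · simp; omega

theorem words_spec {Y : List A} (hY : Y ≠ []) :
    ∃ L, words Y = ((List.range L).reverse, (List.range L).reverse.sublists') ∧
      2 ^ L ≤ 2 * Y.length ∧ Y.length ≤ 2 ^ L := by
  obtain ⟨L, h1, -, h3, h4⟩ :=
    foldl_extendWords Y.length (List.length_pos_iff.2 hY) Y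
  exact ⟨L, h1, h3, h4.elim (fun h => h ▸ Nat.lt_two_pow_self.le) fun h => h⟩

/-- The number of tests is logarithmic, as the number of words is less than doubled beyond need. -/
theorem two_pow_length_tests_le {Y : List A} (hY : Y ≠ []) :
    2 ^ (tests Y).length ≤ 2 * Y.length := by
  obtain ⟨L, h1, h2, -⟩ := words_spec hY
  simpa [tests, h1] using h2

/-- Different subsets of the letters differ in a letter. -/
theorem exists_separating_letter {L : ℕ} {v w : List ℕ}
    (hv : v.Sublist (List.range L).reverse) (hw : w.Sublist (List.range L).reverse) (h : v ≠ w) :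
    ∃ j ∈ (List.range L).reverse, ¬ (j ∈ v ↔ j ∈ w) := by
  by_contra! hc
  apply h
  have hs : (List.range L).reverse.Pairwise (· > ·) := by
    rw [List.pairwise_reverse]
    exact List.pairwise_lt_range
  have hnd : (List.range L).reverse.Nodup := by simp [List.nodup_range]
  have hp : v.Perm w := by
    rw [List.perm_ext_iff_of_nodup (hv.nodup hnd) (hw.nodup hnd)]
    intro j
    by_cases hj : j ∈ (List.range L).reverse
    · exact hc j hj
    · exact ⟨fun h => absurd (hv.mem h) hj, fun h => absurd (hw.mem h) hj⟩
  exact hp.eq_of_pairwise (fun a b _ _ h1 h2 => absurd h1 (lt_asymm h2)) (hs.sublist hv)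
    (hs.sublist hw)

/-- Any two elements are separated by a test. -/
theorem exists_separating_test {Y : List A} (hY : Y.Nodup) {x y : A} (hx : x ∈ Y) (hy : y ∈ Y)
    (hxy : x ≠ y) : ∃ F ∈ tests Y, ¬ (x ∈ F ↔ y ∈ F) := by
  obtain ⟨L, h1, -, h3⟩ := words_spec (List.ne_nil_of_mem hx)
  set W := (List.range L).reverse.sublists' with hW
  have hWnd : W.Nodup := by simp [hW, List.nodup_range]
  have hsnd : (W.zip Y).map Prod.snd = Y := by
    rw [List.map_snd_zip]
    simpa [hW] using h3
  have hfst : ((W.zip Y).map Prod.fst).Nodup := by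
    refine hWnd.sublist ?_
    generalize W = W
    clear * -
    induction W generalizing Y with
    | nil => simp
    | cons a W ih => cases Y <;> simp [ih]
  have hinj : ∀ {v w z}, (v, z) ∈ W.zip Y → (w, z) ∈ W.zip Y → v = w := by
    intro v w z hv hw
    have := List.inj_on_of_nodup_map (f := Prod.snd) (by rw [hsnd]; exact hY) hv hw rfl
    exact congrArg Prod.fst this
  have hex : ∀ {z}, z ∈ Y → ∃ v, (v, z) ∈ W.zip Y := by
    intro z hz
    rw [← hsnd] at hz
    obtain ⟨⟨v, z'⟩, hv, rfl⟩ := List.mem_map.1 hz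
    exact ⟨v, hv⟩
  obtain ⟨v, hv⟩ := hex hx
  obtain ⟨w, hw⟩ := hex hy
  have hvw : v ≠ w := by
    rintro rfl
    have := List.inj_on_of_nodup_map hfst hv hw rfl
    exact hxy (congrArg Prod.snd this)
  obtain ⟨j, hj, hjvw⟩ := exists_separating_letter
    (List.mem_sublists'.1 (List.of_mem_zip hv).1) (List.mem_sublists'.1 (List.of_mem_zip hw).1) hvw
  have hmem : ∀ {v z}, (v, z) ∈ W.zip Y →
      (z ∈ (((W.zip Y).reverse.filter fun y => decide (j ∈ y.1)).map Prod.snd) ↔ j ∈ v) := by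
    intro v z hv
    simp only [List.mem_map, List.mem_filter, List.mem_reverse, decide_eq_true_eq]
    constructor
    · rintro ⟨⟨v', z'⟩, ⟨h, hj⟩, rfl⟩
      exact hinj hv h ▸ hj
    · exact fun h => ⟨(v, z), ⟨hv, h⟩, rfl⟩
  refine ⟨_, List.mem_map.2 ⟨j, by rw [h1]; exact hj, rfl⟩, ?_⟩
  rw [h1, hmem hv, hmem hw]
  exact hjvw

variable {ι : Type} {prim : ι → ℝ → ℝ → ℝ} [Enc A]

theorem PolyTime.extendWords {X : Type} [Enc X] {N : X → ℕ} {s : X → List ℕ × List (List ℕ)}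
    (hN : PolyTime prim N) (hs : PolyTime prim s) :
    PolyTime prim fun x => extendWords (N x) (s x) :=
  (hN.le hs.snd.length).ite hs ((hs.fst.length.cons hs.fst).pair (hs.snd.append
    (hs.snd.map (PolyTime.cons (hs.fst.length.comp PolyTime.id.fst) PolyTime.id.snd))))

theorem polyTime_words : PolyTime prim fun Y : List A => words Y := by
  have hstep : PolyTime prim fun y : List A × (List ℕ × List (List ℕ)) × A =>
      Clust.extendWords y.1.length y.2.1 :=
    PolyTime.extendWords PolyTime.id.fst.length PolyTime.id.snd.fst
  refine PolyTime.foldl (s := fun _ => ([], [[]])) (step := fun Y s _ =>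
    Clust.extendWords Y.length s) PolyTime.id (PolyTime.nil.pair (PolyTime.nil.cons PolyTime.nil))
    hstep ?_
  refine ⟨fun n => 2 + (1 + n * 2) + (1 + (2 * n) * (1 + (1 + n * 2))), ?_, fun Y l hl => ?_⟩
  · exact ((PolyFn.const 2).add ((PolyFn.const 1).add (PolyFn.id.mul (PolyFn.const 2)))).add
      ((PolyFn.const 1).add (((PolyFn.const 2).mul PolyFn.id).mul ((PolyFn.const 1).add
        ((PolyFn.const 1).add (PolyFn.id.mul (PolyFn.const 2))))))
  · rcases Nat.eq_zero_or_pos Y.length with hY | hY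
    · rw [List.length_eq_zero_iff.1 hY] at hl ⊢
      rw [List.prefix_nil.1 hl]
      simp
    · obtain ⟨L, h1, h2, h3, -⟩ := foldl_extendWords Y.length hY l
      have h4 := hl.length_le
      have h5 := length_le_sz Y
      have hw : ∀ w : List ℕ, w.Sublist (List.range L).reverse → sz w ≤ 1 + sz Y * 2 := by
        intro w hw
        have h6 := hw.length_le
        refine (sz_le_of_forall (m := 1) fun a _ => by simp).trans ?_
        simp only [List.length_reverse, List.length_range] at h6
        gcongr
        omega
      rw [h1]
      have h6 := hw _ (List.Sublist.refl _)
      have h7 := sz_le_of_forall (l := (List.range L).reverse.sublists')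
        fun w h => hw w (List.mem_sublists'.1 h)
      simp only [List.length_sublists', List.length_reverse, List.length_range] at h7
      have h8 : 2 ^ L * (1 + (1 + sz Y * 2)) ≤ 2 * sz Y * (1 + (1 + sz Y * 2)) := by
        gcongr
        omega
      simp only [sz_pair]
      omega

theorem polyTime_tests : PolyTime prim fun Y : List A => tests Y := by
  have hz := polyTime_words.snd.zipReverse (PolyTime.id (prim := prim) (A := List A))
  exact polyTime_words.fst.map (((hz.comp PolyTime.id.fst).filter
    (PolyEq.nat.mem PolyTime.id.fst.snd PolyTime.id.snd.fst)).map PolyTime.id.snd.snd)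

end Tests

/-! ### The list of distinct vectors with multiplicities -/

/-- The distinct elements of a list with their multiplicities. -/
def weighted {A : Type} [DecidableEq A] (X : List A) : List (A × ℕ) :=
  X.dedup.map fun x => (x, X.count x)

section Weighted

variable {ι : Type} {prim : ι → ℝ → ℝ → ℝ} {A : Type} [Enc A] [DecidableEq A]

theorem polyTime_dedup (h : PolyEq prim A) : PolyTime prim fun X : List A => X.dedup := by
  have hfold : ∀ l : List A, l.foldr (fun a s => if decide (a ∈ s) then s else a :: s) []
      = l.dedup := by
    intro l
    induction l with
    | nil => rfl
    | cons a l ih =>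
      rw [List.foldr_cons, ih]
      by_cases ha : a ∈ l
      · simp [ha, List.dedup_cons_of_mem ha]
      · simp [ha, List.dedup_cons_of_notMem ha]
  have := PolyTime.foldr (s := fun _ => [])
    (step := fun _ a s => if decide (a ∈ s) then s else a :: s) (PolyTime.id (A := List A))
    PolyTime.nil ((h.mem PolyTime.id.snd.fst PolyTime.id.snd.snd).ite PolyTime.id.snd.snd
      (PolyTime.id.snd.fst.cons PolyTime.id.snd.snd))
    ⟨_, PolyFn.id, fun X l hl => by
      rw [hfold]
      exact sz_sublist ((List.dedup_sublist l).trans hl.sublist)⟩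
  simpa only [hfold] using this

theorem polyTime_weighted (h : PolyEq prim A) :
    PolyTime prim fun X : List A => weighted X := by
  have hc : PolyTime prim fun y : List A × A => y.1.count y.2 := by
    have := (PolyTime.id (prim := prim) (A := List A × A)).fst.filter
      (f := fun y a => decide (a = y.2)) (h.eq PolyTime.id.snd PolyTime.id.fst.snd)
    convert this.length using 2 with y
    rw [List.count_eq_length_filter]
    rfl
  exact (polyTime_dedup h).map (PolyTime.id.snd.pair hc)

end Weighted

/-! ### The search for clusterings of separated elements -/

section Search

/-- All results of adding `c` to one of the lists. -/
def insertions {A : Type} (c : A) : List (List A) → List (List (List A))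
  | [] => []
  | g :: P => ((c :: g) :: P) :: (insertions c P).map (g :: ·)

theorem length_insertions {A : Type} (c : A) (P : List (List A)) :
    (insertions c P).length = P.length := by
  induction P with
  | nil => rfl
  | cons g P ih => simp [insertions, ih]

theorem mem_insertions {A : Type} {c : A} {P R : List (List A)} :
    R ∈ insertions c P ↔ ∃ P₁ g P₂, P = P₁ ++ g :: P₂ ∧ R = P₁ ++ (c :: g) :: P₂ := by
  induction P generalizing R with
  | nil => simp [insertions]
  | cons g P ih =>
    simp only [insertions, List.mem_cons, List.mem_map, ih]
    constructor
    · rintro (rfl | ⟨_, ⟨P₁, g', P₂, rfl, rfl⟩, rfl⟩)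
      · exact ⟨[], g, P, rfl, rfl⟩
      · exact ⟨g :: P₁, g', P₂, rfl, rfl⟩
    · rintro ⟨P₁, g', P₂, h, rfl⟩
      cases P₁ with
      | nil =>
        simp only [List.nil_append, List.cons.injEq] at h
        exact Or.inl (by simp [h.1, h.2])
      | cons g₁ P₁ =>
        simp only [List.cons_append, List.cons.injEq] at h
        exact Or.inr ⟨_, ⟨P₁, g', P₂, h.2, rfl⟩, by simp [h.1]⟩

variable {A : Type}

/-- A state of the search: a list of open cells and a list of clusters, which are lists of closed
cells.  A cell is a list of elements, one of which is to be selected. -/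
abbrev SearchState (A : Type) : Type := List (List A) × List (List (List A))

/-- The cells of a state partition `Y`, cells and clusters are nonempty, and the number of open
cells plus twice the number of closed cells is at most `j + 1`. -/
structure SearchInv (Y : List A) (j : ℕ) (s : SearchState A) : Prop where
  perm : (s.1.flatten ++ s.2.flatten.flatten).Perm Y
  open_ne : ∀ c ∈ s.1, c ≠ []
  closed_ne : ∀ c ∈ s.2.flatten, c ≠ []
  cluster_ne : ∀ g ∈ s.2, g ≠ []
  potential : s.1.length + 2 * s.2.flatten.length ≤ j + 1

theorem length_le_length_flatten {B : Type} {C : List (List B)} (h : ∀ c ∈ C, c ≠ []) :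
    C.length ≤ C.flatten.length := by
  induction C with
  | nil => simp
  | cons c C ih =>
    have h1 := List.length_pos_iff.2 (h c (by simp))
    have h2 := ih fun d hd => h d (by simp [hd])
    simp only [List.length_cons, List.flatten_cons, List.length_append]
    omega

theorem sz_eq_sz_flatten {B : Type} [Enc B] (C : List (List B)) :
    sz C = sz C.flatten + 2 * C.length := by
  induction C with
  | nil => simp
  | cons c C ih =>
    have := sz_append c C.flatten
    simp only [sz_cons, List.flatten_cons, List.length_cons]
    omega

/-- As cells and clusters are nonempty, nesting increases the size by a constant factor only. -/
theorem SearchInv.sz_le [Enc A] {Y : List A} {j : ℕ} {s : SearchState A} (h : SearchInv Y j s) :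
    sz s ≤ 6 * sz Y := by
  have h1 := sz_perm h.perm
  have h2 := sz_append s.1.flatten s.2.flatten.flatten
  have h3 := sz_eq_sz_flatten s.1
  have h4 := sz_eq_sz_flatten s.2
  have h5 := sz_eq_sz_flatten s.2.flatten
  have h6 := length_le_length_flatten h.open_ne
  have h7 := length_le_length_flatten h.closed_ne
  have h8 := length_le_length_flatten h.cluster_ne
  have h9 := h.perm.length_eq
  have h10 := length_le_sz Y
  rw [List.length_append] at h9
  simp only [sz_pair]
  omega

theorem SearchInv.length_clusters_le {Y : List A} {j : ℕ} {s : SearchState A}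
    (h : SearchInv Y j s) : 2 * s.2.length ≤ j + 1 := by
  have := length_le_length_flatten h.cluster_ne
  have := h.potential
  omega

variable [DecidableEq A]

/-- The splittings of a cell by a test into two nonempty cells. -/
def splittings (ts : List (List A)) (c : List A) : List (List A × List A) :=
  (ts.map fun F => (c.filter fun a => decide (a ∈ F), c.filter fun a => !decide (a ∈ F))).filter
    fun h => !h.1.isEmpty && !h.2.isEmpty

theorem mem_splittings {ts : List (List A)} {c : List A} {h : List A × List A} :
    h ∈ splittings ts c ↔ (∃ F ∈ ts, h = (c.filter fun a => decide (a ∈ F),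
      c.filter fun a => !decide (a ∈ F))) ∧ h.1 ≠ [] ∧ h.2 ≠ [] := by
  simp only [splittings, List.mem_filter, List.mem_map, Bool.and_eq_true, Bool.not_eq_true',
    List.isEmpty_eq_false_iff, eq_comm (a := h)]

/-- The successors of a state: the first open cell is closed and becomes a new cluster or joins a
cluster, or it is split by a test. -/
def expand (ts : List (List A)) (s : SearchState A) : List (SearchState A) :=
  listCase s.1 [s] fun c C =>
    (([c] :: s.2) :: insertions c s.2).map (fun P => (C, P)) ++
      (splittings ts c).map fun h => (h.1 :: h.2 :: C, s.2)

/-- The states reached in exactly `U.length` steps from the single open cell `Y`. -/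
def search (ts : List (List A)) (Y : List A) (U : List Unit) : List (SearchState A) :=
  U.foldl (fun S _ => S.flatMap (expand ts)) [([Y], [])]

theorem SearchInv.expand {ts : List (List A)} {Y : List A} {j : ℕ} {s s' : SearchState A}
    (h : SearchInv Y j s) (hs : s' ∈ expand ts s) : SearchInv Y (j + 1) s' := by
  obtain ⟨C, P⟩ := s
  obtain ⟨h1, h2, h3, h4, h5⟩ := h
  cases C with
  | nil =>
    simp only [Clust.expand, listCase_nil, List.mem_singleton] at hs
    subst hs
    exact ⟨h1, h2, h3, h4, h5.trans (by omega)⟩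
  | cons c C =>
    simp only [List.flatten_cons, List.length_cons] at h1 h5
    have hc : c ≠ [] := h2 c (by simp)
    have hC : ∀ c ∈ C, c ≠ [] := fun d hd => h2 d (by simp [hd])
    simp only [Clust.expand, listCase_cons, List.mem_append, List.mem_map, List.mem_cons,
      mem_insertions] at hs
    rcases hs with ⟨R, rfl | ⟨P₁, g, P₂, rfl, rfl⟩, rfl⟩ | ⟨p, hp, rfl⟩
    · refine ⟨?_, hC, ?_, ?_, ?_⟩
      · refine List.Perm.trans ?_ h1
        simp only [List.flatten_cons, List.flatten_nil, List.append_nil,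
          List.append_assoc, List.flatten_append]
        exact List.perm_append_comm_assoc _ _ _
      · simpa [hc] using h3
      · simpa using h4
      · simp only [List.flatten_cons, List.length_append, List.length_singleton]
        omega
    · refine ⟨?_, hC, ?_, ?_, ?_⟩
      · refine List.Perm.trans ?_ h1
        simp only [List.flatten_cons, List.append_assoc, List.flatten_append]
        rw [List.perm_iff_count]
        intro a
        simp only [List.count_append]
        omega
      · intro d hd
        simp only [List.flatten_append, List.flatten_cons, List.mem_append, List.mem_cons,
          List.cons_append] at hd
        rcases hd with hd | rfl | hd | hd
        · exact h3 d (by simp only [List.flatten_append, List.mem_append]; exact Or.inl hd)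
        · exact hc
        · exact h3 d (by simp [hd])
        · refine h3 d ?_
          simp only [List.flatten_append, List.flatten_cons, List.mem_append]
          exact Or.inr (Or.inr hd)
      · intro g' hg'
        simp only [List.mem_append, List.mem_cons] at hg'
        rcases hg' with hg' | rfl | hg'
        · exact h4 g' (by simp [hg'])
        · simp
        · exact h4 g' (by simp [hg'])
      · simp only [List.flatten_cons, List.flatten_append, List.length_append,
          List.length_cons] at h5 ⊢
        omega
    · rw [mem_splittings] at hp
      obtain ⟨⟨F, -, rfl⟩, hp1, hp2⟩ := hp
      refine ⟨?_, ?_, h3, h4, ?_⟩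
      · refine List.Perm.trans ?_ h1
        simp only [List.flatten_cons]
        rw [← List.append_assoc (List.filter _ c)]
        exact ((List.filter_append_perm _ c).append_right _).append_right _
      · simpa [hp1, hp2] using hC
      · simp only [List.length_cons]
        omega

theorem searchInv_of_mem_search {ts : List (List A)} {Y : List A} (hY : Y ≠ []) {U : List Unit} :
    ∀ {s}, s ∈ search ts Y U → SearchInv Y U.length s := by
  induction U using List.reverseRecOn with
  | nil =>
    intro s hs
    simp only [search, List.foldl_nil, List.mem_singleton] at hs
    subst hs
    exact ⟨by simp, by simpa using hY, by simp, by simp, by simp⟩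
  | append_singleton U u ih =>
    intro s hs
    simp only [search, List.foldl_append, List.foldl_cons, List.foldl_nil, List.mem_flatMap] at hs
    obtain ⟨s₀, h0, h1⟩ := hs
    simpa using (ih h0).expand h1

theorem length_expand_le (ts : List (List A)) (s : SearchState A) :
    (expand ts s).length ≤ ts.length + s.2.length + 1 := by
  obtain ⟨C, P⟩ := s
  cases C with
  | nil => simp [expand]
  | cons c C =>
    have h : (splittings ts c).length ≤ ts.length := by
      simpa [splittings] using List.length_filter_le
        (fun h : List A × List A => !h.1.isEmpty && !h.2.isEmpty)
        (ts.map fun F => (c.filter fun a => decide (a ∈ F), c.filter fun a => !decide (a ∈ F)))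
    simp only [expand, listCase_cons, List.length_append, List.length_map, List.length_cons,
      length_insertions]
    omega

/-- In a state reached in `U.length` steps there are at most `(U.length + 1) / 2` clusters to join. -/
theorem length_search_le {ts : List (List A)} {Y : List A} (hY : Y ≠ []) {U : List Unit} {w : ℕ}
    (hw : ts.length + (U.length + 1) / 2 + 1 ≤ w) : (search ts Y U).length ≤ w ^ U.length := by
  induction U using List.reverseRecOn with
  | nil => simp [search]
  | append_singleton U u ih =>
    rw [List.length_append, List.length_singleton] at hw ⊢
    have h1 := ih (by omega)
    have h2 : search ts Y (U ++ [u]) = (search ts Y U).flatMap (expand ts) := by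
      simp [search]
    rw [h2, List.length_flatMap, pow_succ]
    refine (List.sum_le_card_nsmul _ w ?_).trans ?_
    · intro n hn
      obtain ⟨s, hs, rfl⟩ := List.mem_map.1 hn
      have h3 := (searchInv_of_mem_search hY hs).length_clusters_le
      have h4 := length_expand_le ts s
      omega
    · simpa using Nat.mul_le_mul_right w h1

/-! ### Completeness of the search -/

theorem exists_of_forall₂_append_left {B D : Type} {R : B → D → Prop} {l₁ l₂ : List B}
    {m : List D} (h : List.Forall₂ R (l₁ ++ l₂) m) :
    ∃ m₁ m₂, List.Forall₂ R l₁ m₁ ∧ List.Forall₂ R l₂ m₂ ∧ m = m₁ ++ m₂ := by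
  induction l₁ generalizing m with
  | nil => exact ⟨[], m, .nil, h, rfl⟩
  | cons a l₁ ih =>
    obtain ⟨b, m, hab, hm, rfl⟩ := List.forall₂_cons_left_iff.1 h
    obtain ⟨m₁, m₂, h1, h2, rfl⟩ := ih hm
    exact ⟨b :: m₁, m₂, .cons hab h1, h2, rfl⟩

/-- The states reached in exactly `n` steps from `s`. -/
def reach (ts : List (List A)) : ℕ → SearchState A → List (SearchState A)
  | 0, s => [s]
  | n + 1, s => (expand ts s).flatMap (reach ts n)

theorem search_eq_reach (ts : List (List A)) (Y : List A) (U : List Unit) :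
    search ts Y U = reach ts U.length ([Y], []) := by
  have h : ∀ S : List (SearchState A), U.foldl (fun S _ => S.flatMap (expand ts)) S
      = S.flatMap (reach ts U.length) := by
    induction U with
    | nil =>
      intro S
      simp only [List.foldl_nil, List.length_nil]
      change S = S.flatMap fun s => [s]
      simp
    | cons u U ih =>
      intro S
      rw [List.foldl_cons, ih, List.flatMap_assoc]
      rfl
  rw [search, h]
  simp

/-- A state is compatible with a labelling `f` of the list `S` of elements to be selected if every
open cell meets `S` and `S` consists of the elements in open cells and of one element from each
closed cell, such that two of the latter have equal labels exactly if their cells are in the same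
cluster. -/
def Compatible {Λ : Type} (f : A → Λ) (S : List A) (s : SearchState A) : Prop :=
  ∃ Q : List (List A), List.Forall₂ (List.Forall₂ (· ∈ ·)) Q s.2 ∧
    (∀ q ∈ Q, q ≠ [] ∧ ∀ x ∈ q, ∀ y ∈ q, f x = f y) ∧
    Q.Pairwise (fun q r => ∀ x ∈ q, ∀ y ∈ r, f x ≠ f y) ∧
    (Q.flatten ++ s.1.flatten.filter (· ∈ S)).Perm S ∧ ∀ c ∈ s.1, c.filter (· ∈ S) ≠ []

/-- Every open cell with `m` elements to be selected takes `m - 1` splittings and `m` closings. -/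
def remainingSteps (S : List A) (s : SearchState A) : ℕ :=
  (s.1.map fun c => 2 * (c.filter (· ∈ S)).length - 1).sum

theorem exists_compatible_reach {Λ : Type} {f : A → Λ} {S : List A} (hS : S.Nodup)
    {ts : List (List A)} (hts : ∀ x ∈ S, ∀ y ∈ S, x ≠ y → ∃ F ∈ ts, ¬ (x ∈ F ↔ y ∈ F)) (n : ℕ) :
    ∀ s : SearchState A, Compatible f S s → remainingSteps S s ≤ n →
      ∃ P, ([], P) ∈ reach ts n s ∧ Compatible f S ([], P) := by
  induction n with
  | zero =>
    rintro ⟨C, P⟩ hs hn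
    cases C with
    | nil => exact ⟨P, by simp [reach], hs⟩
    | cons c C =>
      obtain ⟨Q, -, -, -, -, h⟩ := hs
      have := List.length_pos_iff.2 (h c (by simp))
      simp only [remainingSteps, List.map_cons, List.sum_cons] at hn
      omega
  | succ n ih =>
    rintro ⟨C, P⟩ hs hn
    cases C with
    | nil =>
      obtain ⟨P', h1, h2⟩ := ih _ hs (by simp [remainingSteps])
      exact ⟨P', by simpa [reach, expand] using h1, h2⟩
    | cons c C =>
      -- One step keeps compatibility and decreases the number of remaining steps.
      suffices hstep : ∃ s' ∈ expand ts (c :: C, P), Compatible f S s' ∧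
          remainingSteps S s' + 1 ≤ remainingSteps S (c :: C, P) by
        obtain ⟨s', h1, h2, h3⟩ := hstep
        obtain ⟨P', h4, h5⟩ := ih s' h2 (by omega)
        exact ⟨P', List.mem_flatMap.2 ⟨s', h1, h4⟩, h5⟩
      obtain ⟨Q, hQ, hlab, hpw, hperm, hne⟩ := hs
      simp only at hQ
      have hc := hne c (by simp)
      have hC : ∀ c ∈ C, c.filter (· ∈ S) ≠ [] := fun d hd => hne d (by simp [hd])
      simp only [List.flatten_cons, List.filter_append] at hperm
      simp only [remainingSteps, List.map_cons, List.sum_cons]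
      obtain ⟨x, k, hxk⟩ := List.exists_cons_of_ne_nil hc
      cases k with
      | nil =>
        -- The cell is closed and joins the cluster with the label of `x`, if there is one.
        by_cases hx : ∃ q ∈ Q, ∃ y ∈ q, f y = f x
        · obtain ⟨q, hq, y, hy, hyx⟩ := hx
          obtain ⟨Q₁, Q₂, rfl⟩ := List.append_of_mem hq
          obtain ⟨P₁, P', hP₁, hP', rfl⟩ := exists_of_forall₂_append_left hQ
          obtain ⟨g, P₂, hg, hP₂, rfl⟩ := List.forall₂_cons_left_iff.1 hP'
          refine ⟨(C, P₁ ++ (c :: g) :: P₂), ?_, ⟨Q₁ ++ (x :: q) :: Q₂, ?_, ?_, ?_, ?_, hC⟩, ?_⟩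
          · simp only [expand, listCase_cons, List.mem_append, List.mem_map, List.mem_cons,
              mem_insertions]
            exact Or.inl ⟨_, Or.inr ⟨P₁, g, P₂, rfl, rfl⟩, rfl⟩
          · refine List.rel_append hP₁ (List.Forall₂.cons (List.Forall₂.cons ?_ hg) hP₂)
            exact List.mem_of_mem_filter (p := (· ∈ S)) (by rw [hxk]; simp)
          · have hqx : ∀ z ∈ q, f z = f x := fun z hz =>
              ((hlab q (by simp)).2 z hz y hy).trans hyx
            intro r hr
            simp only [List.mem_append, List.mem_cons] at hr
            rcases hr with hr | rfl | hr
            · exact hlab r (by simp [hr])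
            · refine ⟨by simp, fun a ha b hb => ?_⟩
              have h1 : ∀ z ∈ x :: q, f z = f x := by simpa using hqx
              rw [h1 a ha, h1 b hb]
            · exact hlab r (by simp [hr])
          · simp only [List.pairwise_append, List.pairwise_cons, List.mem_cons] at hpw ⊢
            obtain ⟨hp1, ⟨hp2, hp3⟩, hp4⟩ := hpw
            refine ⟨hp1, ⟨?_, hp3⟩, ?_⟩
            · rintro r hr a (rfl | ha) b hb
              · rw [← hyx]
                exact hp2 r hr y hy b hb
              · exact hp2 r hr a ha b hb
            · rintro r hr r' (rfl | hr') a ha b hb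
              · rcases List.mem_cons.1 hb with rfl | hb
                · rw [← hyx]
                  exact hp4 r hr q (Or.inl rfl) a ha y hy
                · exact hp4 r hr q (Or.inl rfl) a ha b hb
              · exact hp4 r hr r' (Or.inr hr') a ha b hb
          · refine List.Perm.trans ?_ hperm
            rw [hxk, List.perm_iff_count]
            intro a
            simp only [List.flatten_append, List.flatten_cons, List.count_append, List.count_cons,
              List.count_nil]
            omega
          · rw [hxk]
            simp
        · push Not at hx
          refine ⟨(C, [c] :: P), ?_, ⟨[x] :: Q, ?_, ?_, ?_, ?_, hC⟩, ?_⟩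
          · simp only [expand, listCase_cons, List.mem_append, List.mem_map, List.mem_cons]
            exact Or.inl ⟨_, Or.inl rfl, rfl⟩
          · refine List.Forall₂.cons (List.Forall₂.cons ?_ .nil) hQ
            exact List.mem_of_mem_filter (p := (· ∈ S)) (by rw [hxk]; simp)
          · simpa using hlab
          · refine List.pairwise_cons.2 ⟨?_, hpw⟩
            intro r hr a ha b hb
            rw [List.mem_singleton.1 ha]
            exact (hx r hr b hb).symm
          · refine List.Perm.trans ?_ hperm
            rw [hxk, List.perm_iff_count]
            intro a
            simp only [List.flatten_cons, List.count_append, List.count_cons, List.count_nil]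
            omega
          · rw [hxk]
            simp [Nat.add_comm]
      | cons y k =>
        -- A test that separates `x` and `y` splits the cell.
        have hnd : (c.filter (· ∈ S)).Nodup :=
          (List.nodup_append.1 (List.nodup_append.1 (hperm.nodup_iff.2 hS)).2.1).1
        have hxy : x ≠ y := by
          rw [hxk] at hnd
          rintro rfl
          simp at hnd
        obtain ⟨hxc, hxS⟩ := List.mem_filter.1 (show x ∈ c.filter (· ∈ S) by rw [hxk]; simp)
        obtain ⟨hyc, hyS⟩ := List.mem_filter.1 (show y ∈ c.filter (· ∈ S) by rw [hxk]; simp)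
        obtain ⟨F, hF, hFxy⟩ := hts x (by simpa using hxS) y (by simpa using hyS) hxy
        have hsel : (c.filter fun a => decide (a ∈ F)).filter (· ∈ S) ≠ [] ∧
            (c.filter fun a => !decide (a ∈ F)).filter (· ∈ S) ≠ [] := by
          by_cases hxF : x ∈ F
          · have hyF : y ∉ F := fun h => hFxy ⟨fun _ => h, fun _ => hxF⟩
            exact ⟨List.ne_nil_of_mem (a := x) (by simp_all),
              List.ne_nil_of_mem (a := y) (by simp_all)⟩
          · have hyF : y ∈ F := by_contra fun h => hFxy ⟨fun h' => absurd h' hxF,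
              fun h' => absurd h' h⟩
            exact ⟨List.ne_nil_of_mem (a := y) (by simp_all),
              List.ne_nil_of_mem (a := x) (by simp_all)⟩
        have hsplit : ((c.filter fun a => decide (a ∈ F)).filter (· ∈ S) ++
            (c.filter fun a => !decide (a ∈ F)).filter (· ∈ S)).Perm (c.filter (· ∈ S)) := by
          rw [← List.filter_append]
          exact (List.filter_append_perm _ c).filter _
        refine ⟨((c.filter fun a => decide (a ∈ F)) :: (c.filter fun a => !decide (a ∈ F)) :: C, P),
          ?_, ⟨Q, hQ, hlab, hpw, ?_, ?_⟩, ?_⟩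
        · simp only [expand, listCase_cons, List.mem_append, List.mem_map]
          refine Or.inr ⟨_, mem_splittings.2 ⟨⟨F, hF, rfl⟩, ?_, ?_⟩, rfl⟩
          · intro h
            exact hsel.1 (by simp only at h; rw [h]; rfl)
          · intro h
            exact hsel.2 (by simp only at h; rw [h]; rfl)
        · refine List.Perm.trans ?_ hperm
          simp only [List.flatten_cons, List.filter_append]
          rw [← List.append_assoc (List.filter _ (List.filter _ c))]
          exact (hsplit.append_right _).append_left _
        · intro d hd
          rcases List.mem_cons.1 hd with rfl | hd
          · exact hsel.1
          rcases List.mem_cons.1 hd with rfl | hd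
          · exact hsel.2
          · exact hC d hd
        · have h1 := hsplit.length_eq
          have h2 := List.length_pos_iff.2 hsel.1
          have h3 := List.length_pos_iff.2 hsel.2
          rw [List.length_append] at h1
          simp only [List.map_cons, List.sum_cons]
          omega

/-- Whatever elements `S` of `Y` are to be selected and however they are labelled, the search finds
a partition of `Y` into cells that separates `S` and groups the cells by the labels. -/
theorem exists_compatible_search {Λ : Type} (f : A → Λ) {Y S : List A} (hY : Y.Nodup)
    (hSY : S.Sublist Y) (hS : S ≠ []) {U : List Unit} (hU : 2 * S.length ≤ U.length + 1) :
    ∃ P, ([], P) ∈ search (tests Y) Y U ∧ Compatible f S ([], P) := by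
  rw [search_eq_reach]
  have hfilter : (Y.filter (· ∈ S)).Perm S := by
    rw [List.perm_ext_iff_of_nodup (hY.filter _) (hSY.nodup hY)]
    intro a
    simpa using fun ha => hSY.mem ha
  refine exists_compatible_reach (hSY.nodup hY) (fun x hx y hy hxy =>
    exists_separating_test hY (hSY.mem hx) (hSY.mem hy) hxy) _ _ ⟨[], .nil, by simp, .nil, ?_, ?_⟩ ?_
  · simpa using hfilter
  · intro c hc
    rw [List.mem_singleton.1 hc]
    intro h
    exact hS (List.perm_nil.1 (h ▸ hfilter).symm)
  · simp only [remainingSteps, List.map_cons, List.map_nil, List.sum_cons, List.sum_nil,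
      hfilter.length_eq]
    omega

end Search

/-! ### The running time of the search -/

section SearchTime

variable {ι : Type} {prim : ι → ℝ → ℝ → ℝ} {A X : Type} [Enc A] [Enc X]

theorem sz_insertions_le {c : A} {P : List (List A)} :
    sz (insertions c P) ≤ 1 + sz P * (1 + (1 + sz c + sz P)) := by
  have h1 := sz_le_of_forall (l := insertions c P) (m := 1 + sz c + sz P) fun R hR => by
    obtain ⟨P₁, g, P₂, rfl, rfl⟩ := mem_insertions.1 hR
    have h1 := sz_append P₁ (g :: P₂)
    have h2 := sz_append P₁ ((c :: g) :: P₂)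
    simp only [sz_cons] at h1 h2
    omega
  have h2 := length_le_sz P
  refine h1.trans ?_
  rw [length_insertions]
  gcongr
  omega

theorem PolyTime.insertions {c : X → A} {P : X → List (List A)} (hc : PolyTime prim c)
    (hP : PolyTime prim P) : PolyTime prim fun x => insertions (c x) (P x) := by
  have key : ∀ (a : A) (l : List (List A)),
      l.foldr (fun g s => (g :: s.1, ((a :: g) :: s.1) :: s.2.map (g :: ·))) ([], [])
        = (l, Clust.insertions a l) := by
    -- The state consists of the suffix already read and its insertions.
    intro a l
    induction l with
    | nil => rfl
    | cons g l ih => rw [List.foldr_cons, ih]; rfl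
  have hstep : PolyTime prim fun y : X × List A × (List (List A) × List (List (List A))) =>
      (y.2.1 :: y.2.2.1, ((c y.1 :: y.2.1) :: y.2.2.1) :: y.2.2.2.map (y.2.1 :: ·)) :=
    (PolyTime.id.snd.fst.cons PolyTime.id.snd.snd.fst).pair
      ((((hc.comp PolyTime.id.fst).cons PolyTime.id.snd.fst).cons PolyTime.id.snd.snd.fst).cons
        (PolyTime.id.snd.snd.snd.map (PolyTime.id.fst.snd.fst.cons PolyTime.id.snd)))
  have h := PolyTime.foldr (s := fun _ => ([], [])) (step := fun x g s =>
    (g :: s.1, ((c x :: g) :: s.1) :: s.2.map (g :: ·))) hP (PolyTime.nil.pair PolyTime.nil)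
    hstep ?_
  · simpa only [key] using h.snd
  · obtain ⟨p, hp, hc⟩ := hc.size_bound
    obtain ⟨q, hq, hP⟩ := hP.size_bound
    refine ⟨fun n => 1 + q n + (1 + q n * (1 + (1 + p n + q n))),
      ((PolyFn.const 1).add hq).add ((PolyFn.const 1).add (hq.mul ((PolyFn.const 1).add
        (((PolyFn.const 1).add hp).add hq)))), fun x l hl => ?_⟩
    rw [key]
    have h1 := (sz_sublist hl.sublist).trans (hP x)
    refine Nat.add_le_add (Nat.add_le_add_left h1 1) (sz_insertions_le.trans ?_)
    have := hc x
    gcongr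

variable [DecidableEq A]

theorem PolyTime.splittings (h : PolyEq prim A) {ts : X → List (List A)} {c : X → List A}
    (hts : PolyTime prim ts) (hc : PolyTime prim c) :
    PolyTime prim fun x => splittings (ts x) (c x) := by
  have hmem : PolyTime prim fun y : (X × List A) × A => decide (y.2 ∈ y.1.2) :=
    h.mem PolyTime.id.snd PolyTime.id.fst.snd
  exact (hts.map (((hc.comp PolyTime.id.fst).filter hmem).pair
    ((hc.comp PolyTime.id.fst).filter hmem.not))).filter
      (PolyTime.id.snd.fst.isEmpty.not.and PolyTime.id.snd.snd.isEmpty.not)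

theorem polyTime_expand (h : PolyEq prim A) :
    PolyTime prim fun y : List (List A) × SearchState A => expand y.1 y.2 := by
  have hclose : PolyTime prim fun y : (List (List A) × SearchState A) × List A × List (List A) =>
      (([y.2.1] :: y.1.2.2) :: Clust.insertions y.2.1 y.1.2.2).map fun P => (y.2.2, P) :=
    PolyTime.map ((((PolyTime.id.snd.fst.cons .nil).cons .nil).append PolyTime.id.fst.snd.snd).cons
      (PolyTime.insertions PolyTime.id.snd.fst PolyTime.id.fst.snd.snd))
      (PolyTime.id.fst.snd.snd.pair PolyTime.id.snd)
  have hsplit : PolyTime prim fun y : (List (List A) × SearchState A) × List A × List (List A) =>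
      (Clust.splittings y.1.1 y.2.1).map fun h => (h.1 :: h.2 :: y.2.2, y.1.2.2) :=
    (PolyTime.splittings h PolyTime.id.fst.fst PolyTime.id.snd.fst).map
      ((PolyTime.id.snd.fst.cons (PolyTime.id.snd.snd.cons PolyTime.id.fst.snd.snd)).pair
        PolyTime.id.fst.fst.snd.snd)
  exact PolyTime.id.snd.fst.listCase (PolyTime.id.snd.cons .nil) (hclose.append hsplit)

theorem sz_search_le {ts : List (List A)} {Y : List A} (hY : Y ≠ []) {U : List Unit} {w : ℕ}
    (hw : ts.length + (U.length + 1) / 2 + 1 ≤ w) :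
    sz (search ts Y U) ≤ 1 + w ^ U.length * (1 + 6 * sz Y) := by
  refine (sz_le_of_forall fun s hs => (searchInv_of_mem_search hY hs).sz_le).trans ?_
  have := length_search_le hY hw
  gcongr

/-- The search runs in time polynomial in the size of `Y` and the bound on the number of states. -/
theorem exists_search_code (h : PolyEq prim A) :
    ∃ (c : Code ι) (p : ℕ → ℕ), PolyFn p ∧ ∀ (ts : List (List A)) (Y : List A) (U : List Unit)
      (w M : ℕ), Y ≠ [] → ts.length + (U.length + 1) / 2 + 1 ≤ w → w ^ U.length ≤ M → sz ts ≤ M →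
      sz Y ≤ M → U.length ≤ M →
      RunsIn prim c (enc (ts, [([Y], ([] : List (List (List A))))], U)) (enc (search ts Y U))
        (p M) := by
  have hstep : PolyTime prim fun y : List (List A) × List (SearchState A) × Unit =>
      y.2.1.flatMap (expand y.1) :=
    PolyTime.id.snd.fst.flatMap ((polyTime_expand h).comp (PolyTime.id.fst.fst.pair
      PolyTime.id.snd))
  obtain ⟨c, p, hp, hc⟩ := hstep
  refine ⟨foldCode c, fun M => M * (p (M + (1 + M * (1 + 6 * M)) + 3) + 30) + 9,
    (PolyFn.id.mul ((hp.comp ((PolyFn.id.add ((PolyFn.const 1).add (PolyFn.id.mul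
      ((PolyFn.const 1).add ((PolyFn.const 6).mul PolyFn.id))))).add (PolyFn.const 3))).add
        (PolyFn.const 30))).add (PolyFn.const 9), fun ts Y U w M hY hw hM hts hszY hU => ?_⟩
  refine (RunsIn.foldCode (B := p (M + (1 + M * (1 + 6 * M)) + 3)) (A := Unit) (e := ts)
    (step := fun S _ => S.flatMap (expand ts)) U [([Y], [])] ?_).mono ?_
  · intro U₁ u U₂ hU'
    refine (hc (ts, search ts Y U₁, u)).1.mono (hp.mono ?_)
    have hlen : U₁.length ≤ U.length := by simp [hU']
    have h1 := sz_search_le (ts := ts) hY (U := U₁) (w := w) (by omega)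
    have h2 : w ^ U₁.length * (1 + 6 * sz Y) ≤ M * (1 + 6 * M) := by
      gcongr
      exact (Nat.pow_le_pow_right (by omega) hlen).trans hM
    simp only [sz_pair, sz_unit]
    omega
  · exact Nat.add_le_add_right (Nat.mul_le_mul_right _ hU) _

end SearchTime

section Candidates

variable {A : Type}

/-- The clusterings found by the search that use at most `k` clusters, every unselected element
being a cluster of its own. -/
def candidates (k : ℕ) (Y : List A) (S : List (SearchState A)) : List (List (List (List A))) :=
  (S.filter fun s => s.1.isEmpty &&
    decide (Y.length + s.2.length ≤ k + s.2.flatten.length)).map Prod.snd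

theorem mem_candidates {k : ℕ} {Y : List A} {S : List (SearchState A)}
    {P : List (List (List A))} :
    P ∈ candidates k Y S ↔ ([], P) ∈ S ∧ Y.length + P.length ≤ k + P.flatten.length := by
  simp only [candidates, List.mem_map, List.mem_filter, Bool.and_eq_true, List.isEmpty_iff,
    decide_eq_true_eq]
  constructor
  · rintro ⟨⟨C, P⟩, ⟨h1, rfl, h2⟩, rfl⟩
    exact ⟨h1, h2⟩
  · exact fun h => ⟨_, ⟨h.1, rfl, h.2⟩, rfl⟩

theorem polyTime_candidates {ι : Type} {prim : ι → ℝ → ℝ → ℝ} [Enc A] :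
    PolyTime prim fun y : ℕ × List A × List (SearchState A) => candidates y.1 y.2.1 y.2.2 := by
  have hle : PolyTime prim fun y : (ℕ × List A × List (SearchState A)) × SearchState A =>
      decide (y.1.2.1.length + y.2.2.length ≤ y.1.1 + y.2.2.flatten.length) :=
    (PolyTime.id.fst.snd.fst.length.add PolyTime.id.snd.snd.length).le
      (PolyTime.id.fst.fst.add PolyTime.id.snd.snd.flatten.length)
  exact (PolyTime.id.snd.snd.filter (PolyTime.id.snd.fst.isEmpty.and hle)).map PolyTime.id.snd.snd

end Candidates

/-! ### Choosing costs for the clusters of a candidate -/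

section Costs

variable {G : Type}

/-- The larger one of a number and an optional number. -/
noncomputable def better : Option ℝ → ℝ → Option ℝ
  | none, x => some x
  | some y, x => if decide (y ≤ x) then some x else some y

/-- The largest part of the budget `b` that can be left after paying for the cluster `g` an amount
from the list `l` for which `acc` accepts the cluster. -/
noncomputable def pay (acc : G → ℝ → Bool) (l : List ℝ) (g : G) (b : ℝ) : Option ℝ :=
  l.foldl (fun s δ => if acc g δ then better s (b - δ) else s) none

/-- The largest part of the budget that can be left after paying for all clusters of a candidate. -/
noncomputable def payAll (acc : G → ℝ → Bool) (l : List ℝ) (P : List G) (b : ℝ) : Option ℝ :=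
  P.foldl (fun s g => s.bind (pay acc l g)) (some b)

/-- Whether the budget suffices to pay for all clusters. -/
noncomputable def affordable (acc : G → ℝ → Bool) (l : List ℝ) (b : ℝ) (P : List G) : Bool :=
  (payAll acc l P b).any fun x => decide (0 ≤ x)

variable {acc : G → ℝ → Bool} {l : List ℝ}

theorem exists_of_pay_eq_some {g : G} {b x : ℝ} (h : pay acc l g b = some x) :
    ∃ δ ∈ l, acc g δ = true ∧ x = b - δ := by
  induction l using List.reverseRecOn generalizing x with
  | nil => simp [pay] at h
  | append_singleton l δ ih =>
    have hold : ∀ {y}, pay acc l g b = some y →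
        ∃ δ' ∈ l ++ [δ], acc g δ' = true ∧ y = b - δ' := by
      intro y hy
      obtain ⟨δ', h1, h2⟩ := ih hy
      exact ⟨δ', by simp [h1], h2⟩
    simp only [pay, List.foldl_append, List.foldl_cons, List.foldl_nil] at h
    change (if acc g δ = true then better (pay acc l g b) (b - δ) else pay acc l g b) = some x at h
    by_cases ha : acc g δ
    · rw [if_pos ha] at h
      have hnew : some (b - δ) = some x → ∃ δ' ∈ l ++ [δ], acc g δ' = true ∧ x = b - δ' := by
        intro hx
        exact ⟨δ, by simp, ha, (Option.some.inj hx).symm⟩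
      cases hp : pay acc l g b with
      | none =>
        rw [hp] at h
        exact hnew h
      | some y =>
        rw [hp] at h
        simp only [better] at h
        split_ifs at h with hy
        · exact hnew h
        · exact hold (hp.trans h)
    · rw [if_neg ha] at h
      exact hold h

theorem exists_le_pay {g : G} {b δ : ℝ} (hδ : δ ∈ l) (ha : acc g δ = true) :
    ∃ x, pay acc l g b = some x ∧ b - δ ≤ x := by
  induction l using List.reverseRecOn with
  | nil => simp at hδ
  | append_singleton l δ' ih =>
    have hlast : pay acc (l ++ [δ']) g b
        = if acc g δ' = true then better (pay acc l g b) (b - δ') else pay acc l g b := by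
      simp [pay]
    rw [hlast]
    rcases List.mem_append.1 hδ with hδ | hδ
    · obtain ⟨x, hx, hle⟩ := ih hδ
      rw [hx]
      by_cases ha' : acc g δ'
      · simp only [ha', if_true, better, decide_eq_true_eq]
        by_cases hxy : x ≤ b - δ'
        · exact ⟨_, if_pos hxy, hle.trans hxy⟩
        · exact ⟨_, if_neg hxy, hle⟩
      · exact ⟨x, by simp [ha'], hle⟩
    · rw [List.mem_singleton.1 hδ] at ha ⊢
      rw [if_pos ha]
      cases pay acc l g b with
      | none => exact ⟨_, rfl, le_rfl⟩
      | some y =>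
        simp only [better, decide_eq_true_eq]
        by_cases hxy : y ≤ b - δ'
        · exact ⟨_, if_pos hxy, le_rfl⟩
        · exact ⟨_, if_neg hxy, (not_le.1 hxy).le⟩

theorem foldl_bind_none {B D : Type} (f : D → B → Option B) (P : List D) :
    P.foldl (fun s g => s.bind (f g)) none = none := by
  induction P with
  | nil => rfl
  | cons g P ih => simpa using ih

/-- Whatever is left has been reached by paying an accepted amount for every cluster. -/
theorem exists_of_payAll_eq_some {P : List G} {b x : ℝ} (h : payAll acc l P b = some x) :
    ∃ δs : List ℝ, List.Forall₂ (fun δ g => δ ∈ l ∧ acc g δ = true) δs P ∧ x = b - δs.sum := by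
  induction P generalizing b with
  | nil =>
    simp only [payAll, List.foldl_nil, Option.some.injEq] at h
    exact ⟨[], .nil, by simp [h]⟩
  | cons g P ih =>
    simp only [payAll, List.foldl_cons, Option.bind_some] at h
    cases hp : pay acc l g b with
    | none =>
      rw [hp, foldl_bind_none] at h
      simp at h
    | some y =>
      rw [hp] at h
      obtain ⟨δ, h1, h2, rfl⟩ := exists_of_pay_eq_some hp
      obtain ⟨δs, h3, rfl⟩ := ih h
      exact ⟨δ :: δs, .cons ⟨h1, h2⟩ h3, by simp; ring⟩

/-- Greedily keeping the most budget is optimal: no accepted choice of amounts leaves more. -/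
theorem exists_le_payAll {P : List G} {δs : List ℝ}
    (h : List.Forall₂ (fun δ g => δ ∈ l ∧ acc g δ = true) δs P) (b : ℝ) :
    ∃ x, payAll acc l P b = some x ∧ b - δs.sum ≤ x := by
  induction h generalizing b with
  | nil => exact ⟨b, rfl, by simp⟩
  | cons hδ _ ih =>
    obtain ⟨y, hy, hle⟩ := exists_le_pay (b := b) hδ.1 hδ.2
    obtain ⟨x, hx, hle'⟩ := ih y
    refine ⟨x, ?_, ?_⟩
    · simp only [payAll, List.foldl_cons, Option.bind_some, hy]
      exact hx
    · rw [List.sum_cons]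
      linarith

theorem affordable_iff {P : List G} {b : ℝ} : affordable acc l b P = true ↔
    ∃ δs : List ℝ, List.Forall₂ (fun δ g => δ ∈ l ∧ acc g δ = true) δs P ∧ δs.sum ≤ b := by
  simp only [affordable, Option.any_eq_true, decide_eq_true_eq]
  constructor
  · rintro ⟨x, hx, h0⟩
    obtain ⟨δs, h1, rfl⟩ := exists_of_payAll_eq_some hx
    exact ⟨δs, h1, by linarith⟩
  · rintro ⟨δs, h1, h2⟩
    obtain ⟨x, hx, hle⟩ := exists_le_payAll h1 b
    exact ⟨x, hx, by linarith⟩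

end Costs

/-! ### Programs for choosing the costs -/

section CostPrograms

variable {ι : Type} {prim : ι → ℝ → ℝ → ℝ} {G : Type} [Enc G]

/-- Numbers differ from `nil`, so `none` needs no tag. -/
instance : Enc (Option ℝ) := ⟨fun x => x.elim Val.nil Val.num⟩

theorem enc_some (x : ℝ) : enc (some x) = Val.num x := rfl

/-- On every amount `δ` from `l` and every cluster of `P`, the program `q` for instances
`[d, δ, cluster]` answers like `acc` within `B` steps. -/
def Answers (prim : ι → ℝ → ℝ → ℝ) (q : Code ι) (d : ℕ) (acc : G → ℝ → Bool) (l : List ℝ)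
    (P : List G) (B : ℕ) : Prop :=
  ∀ g ∈ P, ∀ δ ∈ l, ∃ u, RunsIn prim q (Val.ofList [Val.num d, Val.num δ, enc g]) u B ∧
    (u ≠ Val.nil ↔ acc g δ = true)

/-- One step of `pay` on `((d, g, b), s, δ)`. -/
def payStep (q : Code ι) : Code ι :=
  let s : Code ι := .comp .head .tail
  let δ : Code ι := .comp .tail .tail
  let d : Code ι := .comp .head .head
  let g : Code ι := .comp .head (.comp .tail .head)
  let rest : Code ι := .sub (.comp .tail (.comp .tail .head)) δ
  .ite (.comp q (.cons d (.cons δ (.cons g .nil)))) (.ite s (.ite (.le s rest) rest s) rest) s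

theorem runsIn_payStep {q : Code ι} {d : ℕ} {acc : G → ℝ → Bool} {g : G} {δ b : ℝ}
    {B : ℕ} (hq : ∃ u, RunsIn prim q (Val.ofList [Val.num d, Val.num δ, enc g]) u B ∧
      (u ≠ Val.nil ↔ acc g δ = true)) (s : Option ℝ) :
    RunsIn prim (payStep q) (enc ((d, g, b), s, δ))
      (enc (if acc g δ then better s (b - δ) else s)) (B + 60) := by
  have hs : RunsIn prim (.comp .head .tail) (enc ((d, g, b), s, δ)) (enc s) 3 :=
    (RunsIn.tail _ _).comp (RunsIn.head _ _)
  have hδ : RunsIn prim (.comp .tail .tail) (enc ((d, g, b), s, δ)) (.num δ) 3 :=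
    (RunsIn.tail _ _).comp (RunsIn.tail _ _)
  have hd : RunsIn prim (.comp .head .head) (enc ((d, g, b), s, δ)) (.num d) 3 :=
    (RunsIn.head _ _).comp (RunsIn.head _ _)
  have hg : RunsIn prim (.comp .head (.comp .tail .head)) (enc ((d, g, b), s, δ)) (enc g) 5 :=
    ((RunsIn.head _ _).comp (RunsIn.tail _ _)).comp (RunsIn.head _ _)
  have hb : RunsIn prim (.comp .tail (.comp .tail .head)) (enc ((d, g, b), s, δ)) (.num b) 5 :=
    ((RunsIn.head _ _).comp (RunsIn.tail _ _)).comp (RunsIn.tail _ _)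
  have hrest := hb.sub hδ
  have hin := hd.cons (hδ.cons (hg.cons (RunsIn.nil _)))
  obtain ⟨u, hu, hiff⟩ := hq
  have hcond := hin.comp hu
  by_cases ha : acc g δ
  · rw [if_pos ha]
    refine (hcond.ite_pos (t := 40) (hiff.2 ha) ?_).mono (by omega)
    cases s with
    | none => exact (hs.ite_neg hrest).mono (by omega)
    | some y =>
      have h1 := (RunsIn.le hs hrest).ite (fun _ => hrest)
        (fun _ => hs.mono (show 3 ≤ 5 + 3 + 1 by omega))
      have h2 : (if decide (y ≤ b - δ) = true then Val.num (b - δ) else enc (some y))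
          = enc (better (some y) (b - δ)) := by
        simp only [better]
        split_ifs <;> rfl
      rw [h2] at h1
      exact (hs.ite_pos (by simp [enc_some]) h1).mono (by omega)
  · rw [if_neg ha]
    have hun : u = Val.nil := by
      by_contra h
      exact ha (hiff.1 h)
    exact (RunsIn.ite_neg (hun ▸ hcond) hs).mono (by omega)

/-- One step of `payAll` on `((d, l), s, g)`. -/
def payAllStep (q : Code ι) : Code ι :=
  let s : Code ι := .comp .head .tail
  let g : Code ι := .comp .tail .tail
  let d : Code ι := .comp .head .head
  let l : Code ι := .comp .tail .head
  .ite s (.comp (foldCode (payStep q)) (.cons (.cons d (.cons g s)) (.cons .nil l))) .nil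

theorem runsIn_payAllStep {q : Code ι} {d : ℕ} {acc : G → ℝ → Bool} {l : List ℝ} {g : G} {B : ℕ}
    (hq : Answers prim q d acc l [g] B) (s : Option ℝ) :
    RunsIn prim (payAllStep q) (enc ((d, l), s, g)) (enc (s.bind (pay acc l g)))
      (l.length * (B + 90) + 50) := by
  have hs : RunsIn prim (.comp .head .tail) (enc ((d, l), s, g)) (enc s) 3 :=
    (RunsIn.tail _ _).comp (RunsIn.head _ _)
  have hg : RunsIn prim (.comp .tail .tail) (enc ((d, l), s, g)) (enc g) 3 :=
    (RunsIn.tail _ _).comp (RunsIn.tail _ _)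
  have hd : RunsIn prim (.comp .head .head) (enc ((d, l), s, g)) (.num d) 3 :=
    (RunsIn.head _ _).comp (RunsIn.head _ _)
  have hl : RunsIn prim (.comp .tail .head) (enc ((d, l), s, g)) (enc l) 3 :=
    (RunsIn.head _ _).comp (RunsIn.tail _ _)
  cases s with
  | none => exact (hs.ite_neg (RunsIn.nil _)).mono (by omega)
  | some b =>
    have hfold : RunsIn prim (foldCode (payStep q)) (enc ((d, g, b), (none : Option ℝ), l))
        (enc (pay acc l g b)) (l.length * (B + 60 + 30) + 9) := by
      refine RunsIn.foldCode l none fun l₁ δ l₂ h => ?_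
      exact runsIn_payStep (hq g (by simp) δ (by simp [h])) _
    simp only [Nat.add_assoc, Nat.reduceAdd] at hfold
    exact (hs.ite_pos (by simp [enc_some]) (((hd.cons (hg.cons hs)).cons
      ((RunsIn.nil _).cons hl)).comp hfold)).mono (by omega)

/-- One step of testing whether some candidate `P` is affordable, on `((d, l, b), s, P)`. -/
def affordStep (q : Code ι) : Code ι :=
  let s : Code ι := .comp .head .tail
  let P : Code ι := .comp .tail .tail
  let d : Code ι := .comp .head .head
  let l : Code ι := .comp .head (.comp .tail .head)
  let b : Code ι := .comp .tail (.comp .tail .head)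
  .ite s .one (.comp (.ite .id (.le (.sub .one .one) .id) .nil)
    (.comp (foldCode (payAllStep q)) (.cons (.cons d l) (.cons b P))))

theorem runsIn_affordStep {q : Code ι} {d : ℕ} {acc : G → ℝ → Bool} {l : List ℝ} {P : List G}
    {B : ℕ} (hq : Answers prim q d acc l P B) (b : ℝ) (s : Bool) :
    RunsIn prim (affordStep q) (enc ((d, l, b), s, P)) (enc (s || affordable acc l b P))
      (P.length * (l.length * (B + 90) + 80) + 60) := by
  have hs : RunsIn prim (.comp .head .tail) (enc ((d, l, b), s, P)) (enc s) 3 :=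
    (RunsIn.tail _ _).comp (RunsIn.head _ _)
  have hP : RunsIn prim (.comp .tail .tail) (enc ((d, l, b), s, P)) (enc P) 3 :=
    (RunsIn.tail _ _).comp (RunsIn.tail _ _)
  have hd : RunsIn prim (.comp .head .head) (enc ((d, l, b), s, P)) (.num d) 3 :=
    (RunsIn.head _ _).comp (RunsIn.head _ _)
  have hl : RunsIn prim (.comp .head (.comp .tail .head)) (enc ((d, l, b), s, P)) (enc l) 5 :=
    ((RunsIn.head _ _).comp (RunsIn.tail _ _)).comp (RunsIn.head _ _)
  have hb : RunsIn prim (.comp .tail (.comp .tail .head)) (enc ((d, l, b), s, P)) (.num b) 5 :=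
    ((RunsIn.head _ _).comp (RunsIn.tail _ _)).comp (RunsIn.tail _ _)
  cases s with
  | true => exact (hs.ite_pos (by simp) (RunsIn.one _)).mono (by omega)
  | false =>
    have hfold : RunsIn prim (foldCode (payAllStep q)) (enc ((d, l), some b, P))
        (enc (payAll acc l P b)) (P.length * (l.length * (B + 90) + 50 + 30) + 9) := by
      refine RunsIn.foldCode P (some b) fun P₁ g P₂ h => ?_
      refine runsIn_payAllStep (fun g' hg' δ hδ => ?_) _
      rw [List.mem_singleton.1 hg']
      exact hq g (by simp [h]) δ hδ
    simp only [Nat.add_assoc, Nat.reduceAdd] at hfold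
    have htest : RunsIn prim (.ite .id (.le (.sub .one .one) .id) .nil) (enc (payAll acc l P b))
        (enc (affordable acc l b P)) 8 := by
      cases h : payAll acc l P b with
      | none =>
        simp only [affordable, h]
        exact ((RunsIn.id _).ite_neg (RunsIn.nil _)).mono (by omega)
      | some x =>
        have h0 : RunsIn prim (.sub .one .one) (enc (some x)) (.num 0) 3 := by
          simpa using (RunsIn.one (prim := prim) (enc (some x))).sub (RunsIn.one _)
        simp only [affordable, h]
        exact ((RunsIn.id _).ite_pos (by simp [enc_some]) (h0.le (RunsIn.id _))).mono (by omega)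
    refine (hs.ite_neg (((((hd.cons hl).cons (hb.cons hP)).comp hfold)).comp htest)).mono ?_
    omega

theorem foldl_or_eq_any {B : Type} (f : B → Bool) (l : List B) (s : Bool) :
    l.foldl (fun s a => s || f a) s = (s || l.any f) := by
  induction l generalizing s with
  | nil => simp
  | cons a l ih => simp [ih, Bool.or_assoc]

/-- The list `l` is traversed once for every cluster of every candidate. -/
theorem runsIn_affordable {q : Code ι} {d : ℕ} {acc : G → ℝ → Bool} {l : List ℝ}
    {Ps : List (List G)} {B m : ℕ} (hq : ∀ P ∈ Ps, Answers prim q d acc l P B)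
    (hm : ∀ P ∈ Ps, P.length ≤ m) (b : ℝ) :
    RunsIn prim (foldCode (affordStep q)) (enc ((d, l, b), false, Ps))
      (enc (Ps.any (affordable acc l b)))
      (Ps.length * (m * (l.length * (B + 90) + 80) + 90) + 9) := by
  have h : RunsIn prim (foldCode (affordStep q)) (enc ((d, l, b), false, Ps))
      (enc (Ps.foldl (fun s P => s || affordable acc l b P) false))
      (Ps.length * (m * (l.length * (B + 90) + 80) + 60 + 30) + 9) := by
    refine RunsIn.foldCode Ps false fun P₁ P P₂ h => ?_
    have hP : P ∈ Ps := by simp [h]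
    refine (runsIn_affordStep (hq P hP) b _).mono ?_
    have := Nat.mul_le_mul_right (l.length * (B + 90) + 80) (hm P hP)
    omega
  rwa [foldl_or_eq_any, Nat.add_assoc (m * _)] at h

end CostPrograms

/-! ### Clusterings and weighted vectors -/

section Clusters

variable {dist : ∀ d : ℕ, (Fin d → ℝ) → (Fin d → ℝ) → ℝ} {d : ℕ}

theorem distSum_zero (c : Fin d → ℝ) : distSum dist 0 c = 0 := by simp [distSum]

theorem distSum_add (M N : Multiset (Fin d → ℤ)) (c : Fin d → ℝ) :
    distSum dist (M + N) c = distSum dist M c + distSum dist N c := by simp [distSum]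

theorem distSum_replicate (n : ℕ) (x : Fin d → ℤ) (c : Fin d → ℝ) :
    distSum dist (Multiset.replicate n x) c = n * dist d (toReal x) c := by simp [distSum]

theorem IsDistance.distSum_nonneg (h : IsDistance dist) (M : Multiset (Fin d → ℤ))
    (c : Fin d → ℝ) : 0 ≤ distSum dist M c :=
  Multiset.sum_nonneg fun x hx => by
    obtain ⟨y, -, rfl⟩ := Multiset.mem_map.1 hx
    exact h.nonneg d _ _

theorem IsDistance.clusterCost_le (h : IsDistance dist) (M : Multiset (Fin d → ℤ))
    (c : Fin d → ℝ) : clusterCost dist M ≤ distSum dist M c :=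
  ciInf_le ⟨0, by rintro _ ⟨c, rfl⟩; exact h.distSum_nonneg M c⟩ c

theorem IsDistance.exists_distSum_eq (h : IsDistance dist) (M : Multiset (Fin d → ℤ)) :
    ∃ c, distSum dist M c = clusterCost dist M := by
  obtain ⟨c, hc⟩ := h.exists_optimal d M
  exact ⟨c, le_antisymm (le_ciInf hc) (h.clusterCost_le M c)⟩

/-- The multiset described by a list of vectors with multiplicities. -/
def weightedSum {A : Type} (l : List (A × ℕ)) : Multiset A :=
  (l.map fun y => Multiset.replicate y.2 y.1).sum

/-- The weighted total distance of a list of vectors with multiplicities. -/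
noncomputable def weightedCost (dist : ∀ d : ℕ, (Fin d → ℝ) → (Fin d → ℝ) → ℝ)
    (l : List ((Fin d → ℤ) × ℕ)) (c : Fin d → ℝ) : ℝ :=
  (l.map fun y => (y.2 : ℝ) * dist d (toReal y.1) c).sum

theorem distSum_weightedSum (l : List ((Fin d → ℤ) × ℕ)) (c : Fin d → ℝ) :
    distSum dist (weightedSum l) c = weightedCost dist l c := by
  induction l with
  | nil => simp [weightedSum, weightedCost, distSum_zero]
  | cons y l ih =>
    simp only [weightedSum, weightedCost, List.map_cons, List.sum_cons] at ih ⊢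
    rw [distSum_add, ih, distSum_replicate]

section WeightedSum

variable {A : Type}

theorem weightedSum_append (l m : List (A × ℕ)) :
    weightedSum (l ++ m) = weightedSum l + weightedSum m := by simp [weightedSum]

theorem weightedSum_flatten (L : List (List (A × ℕ))) :
    weightedSum L.flatten = (L.map weightedSum).sum := by
  induction L with
  | nil => rfl
  | cons l L ih => simp [weightedSum_append, ih]

theorem weightedSum_perm {l m : List (A × ℕ)} (h : l.Perm m) : weightedSum l = weightedSum m :=
  (h.map _).sum_eq

theorem weightedSum_filter (p : A → Prop) [DecidablePred p] (l : List (A × ℕ)) :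
    weightedSum (l.filter fun y => decide (p y.1)) = (weightedSum l).filter p := by
  induction l with
  | nil => rfl
  | cons y l ih =>
    have h : weightedSum (y :: l) = Multiset.replicate y.2 y.1 + weightedSum l := by
      simp [weightedSum]
    rw [h, Multiset.filter_add, ← ih]
    by_cases hy : p y.1
    · rw [List.filter_cons_of_pos (by simpa using hy), Multiset.filter_eq_self.2 (by
        intro a ha
        rwa [Multiset.eq_of_mem_replicate ha])]
      simp [weightedSum]
    · rw [List.filter_cons_of_neg (by simpa using hy), Multiset.filter_eq_nil.2 (by
        intro a ha
        rwa [Multiset.eq_of_mem_replicate ha]), zero_add]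

variable [DecidableEq A]

theorem weightedSum_weighted (X : List A) : weightedSum (weighted X) = (X : Multiset A) := by
  have h := Multiset.toFinset_sum_count_nsmul_eq (X : Multiset A)
  rw [Finset.sum, Multiset.toFinset_val, Multiset.coe_dedup, Multiset.map_coe,
    Multiset.sum_coe] at h
  rw [← h]
  simp [weightedSum, weighted, Multiset.nsmul_singleton, Function.comp_def]

theorem map_fst_weighted (X : List A) : (weighted X).map Prod.fst = X.dedup := by
  simp [weighted, Function.comp_def]

theorem nodup_weighted (X : List A) : (weighted X).Nodup :=
  List.Nodup.of_map Prod.fst (by rw [map_fst_weighted]; exact X.nodup_dedup)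

theorem weighted_ne_nil {X : List A} (h : X ≠ []) : weighted X ≠ [] := by
  intro h'
  have := map_fst_weighted X
  rw [h', List.map_nil, eq_comm, List.dedup_eq_nil] at this
  exact h this

theorem mem_weighted {X : List A} {y : A × ℕ} :
    y ∈ weighted X ↔ y.1 ∈ X ∧ y.2 = X.count y.1 := by
  simp only [weighted, List.mem_map, List.mem_dedup]
  constructor
  · rintro ⟨x, hx, rfl⟩
    exact ⟨hx, rfl⟩
  · rintro ⟨h1, h2⟩
    exact ⟨y.1, h1, by rw [← h2]⟩

theorem length_weighted_le (X : List A) : (weighted X).length ≤ X.length := by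
  rw [weighted, List.length_map]
  exact (List.dedup_sublist X).length_le

end WeightedSum

/-- A clustering may be given as a list of at most `k` clusters; it is padded by empty clusters. -/
theorem kClustering_of_list {X : Multiset (Fin d → ℤ)} {k : ℕ} {D : ℝ}
    (L : List (Multiset (Fin d → ℤ) × (Fin d → ℝ))) (hk : L.length ≤ k)
    (hX : (L.map Prod.fst).sum = X) (hD : (L.map fun z => distSum dist z.1 z.2).sum ≤ D) :
    KClustering dist X k D := by
  suffices h : ∀ L : List (Multiset (Fin d → ℤ) × (Fin d → ℝ)), L.length = k →
      (L.map Prod.fst).sum = X → (L.map fun z => distSum dist z.1 z.2).sum ≤ D →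
      KClustering dist X k D by
    refine h (L ++ List.replicate (k - L.length) (0, 0)) (by simp; omega) ?_ ?_
    · simpa using hX
    · simpa [distSum_zero] using hD
  rintro L rfl h1 h2
  refine ⟨fun i => L[i].1, fun i => L[i].2, ?_, ?_⟩
  · rw [← h1]
    exact Fin.sum_univ_fun_getElem L Prod.fst
  · refine le_trans (le_of_eq ?_) h2
    exact Fin.sum_univ_fun_getElem L fun z => distSum dist z.1 z.2

/-- Disjoint clusters of distinct vectors with centroids, completed by the remaining distinct
vectors as clusters of cost `0`, make a clustering. -/
theorem kClustering_of_selection (h : IsDistance dist) {X : List (Fin d → ℤ)} {k : ℕ} {D : ℝ}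
    (Z : List (List ((Fin d → ℤ) × ℕ) × (Fin d → ℝ))) (r : List ((Fin d → ℤ) × ℕ))
    (hperm : ((Z.map Prod.fst).flatten ++ r).Perm (weighted X)) (hk : Z.length + r.length ≤ k)
    (hD : (Z.map fun z => weightedCost dist z.1 z.2).sum ≤ D) :
    KClustering dist (X : Multiset (Fin d → ℤ)) k D := by
  refine kClustering_of_list (Z.map (fun z => (weightedSum z.1, z.2)) ++
    r.map fun y => (Multiset.replicate y.2 y.1, toReal y.1)) (by simpa using hk) ?_ ?_
  · rw [← weightedSum_weighted, ← weightedSum_perm hperm, weightedSum_append, weightedSum_flatten]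
    simp only [List.map_append, List.map_map, List.sum_append, Function.comp_def]
    rfl
  · have h1 : (r.map fun y => distSum dist (Multiset.replicate y.2 y.1) (toReal y.1)).sum = 0 := by
      simp [distSum_replicate, h.self]
    simpa [Function.comp_def, distSum_weightedSum, h1] using hD

theorem exists_perm_of_forall₂_mem {A : Type} {s : List A} {C : List (List A)}
    (h : List.Forall₂ (· ∈ ·) s C) :
    ∃ r, (s ++ r).Perm C.flatten ∧ s.length = C.length := by
  classical
  induction h with
  | nil => exact ⟨[], by simp, rfl⟩
  | @cons x c s C hx _ ih =>
    obtain ⟨r, h1, h2⟩ := ih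
    obtain ⟨a, b, rfl⟩ := List.append_of_mem hx
    refine ⟨a ++ b ++ r, ?_, by simp [h2]⟩
    simp only [List.perm_iff_count, List.count_append, List.count_cons, List.flatten_cons] at h1 ⊢
    intro z
    have := h1 z
    omega

theorem forall₂_flatten {A B : Type} {R : A → B → Prop} {L : List (List A)} {M : List (List B)}
    (h : List.Forall₂ (List.Forall₂ R) L M) : List.Forall₂ R L.flatten M.flatten := by
  induction h with
  | nil => exact .nil
  | cons h _ ih => exact List.rel_append h ih

/-- One vector can be selected from each cell so that the selected vectors have a centroid of total
distance at most `δ`. -/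
def Selectable (dist : ∀ d : ℕ, (Fin d → ℝ) → (Fin d → ℝ) → ℝ)
    (G : List (List ((Fin d → ℤ) × ℕ))) (δ : ℝ) : Prop :=
  ∃ s, List.Forall₂ (· ∈ ·) s G ∧ ∃ c, weightedCost dist s c ≤ δ

/-- Selections from the clusters of a candidate make a clustering. -/
theorem kClustering_of_selectable (h : IsDistance dist) {X : List (Fin d → ℤ)} {k : ℕ} {D : ℝ}
    {P : List (List (List ((Fin d → ℤ) × ℕ)))} {δs : List ℝ}
    (hperm : P.flatten.flatten.Perm (weighted X))
    (hk : (weighted X).length + P.length ≤ k + P.flatten.length)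
    (hsel : List.Forall₂ (fun δ G => Selectable dist G δ) δs P) (hD : δs.sum ≤ D) :
    KClustering dist (X : Multiset (Fin d → ℤ)) k D := by
  have hZ : ∃ Z : List (List ((Fin d → ℤ) × ℕ) × (Fin d → ℝ)),
      List.Forall₂ (List.Forall₂ (· ∈ ·)) (Z.map Prod.fst) P ∧
      (Z.map fun z => weightedCost dist z.1 z.2).sum ≤ δs.sum := by
    clear hperm hk hD
    induction hsel with
    | nil => exact ⟨[], .nil, le_rfl⟩
    | cons hG _ ih =>
      obtain ⟨Z, h1, h2⟩ := ih
      obtain ⟨s, hs, c, hc⟩ := hG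
      refine ⟨(s, c) :: Z, .cons hs h1, ?_⟩
      simp only [List.map_cons, List.sum_cons]
      exact add_le_add hc h2
  obtain ⟨Z, h1, h2⟩ := hZ
  obtain ⟨r, h3, h4⟩ := exists_perm_of_forall₂_mem (forall₂_flatten h1)
  have h5 := h1.length_eq
  have h6 := (h3.trans hperm).length_eq
  rw [List.length_append, h4] at h6
  rw [List.length_map] at h5
  exact kClustering_of_selection h Z r (h3.trans hperm) (by omega) (h2.trans hD)

/-- Labelling the vectors by their nearest centroids gives a clustering in which equal vectors are in
the same class, without increasing the cost. -/
theorem exists_labelling {X : Multiset (Fin d → ℤ)} {k : ℕ} (hk : 1 ≤ k)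
    {D : ℝ} (hX : KClustering dist X k D) :
    ∃ (g : (Fin d → ℤ) → Fin k) (c : Fin k → Fin d → ℝ),
      ∑ i, distSum dist (X.filter fun x => g x = i) (c i) ≤ D := by
  obtain ⟨C, c, rfl, hD⟩ := hX
  have : Nonempty (Fin k) := ⟨⟨0, hk⟩⟩
  choose g hg using fun x : Fin d → ℤ => Finite.exists_min fun i => dist d (toReal x) (c i)
  refine ⟨g, c, le_trans ?_ hD⟩
  have h1 : ∀ M : Multiset (Fin d → ℤ), ∑ i, distSum dist (M.filter fun x => g x = i) (c i)
      = (M.map fun x => dist d (toReal x) (c (g x))).sum := by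
    intro M
    induction M using Multiset.induction_on with
    | empty => simp [distSum]
    | cons a M ih =>
      have h2 : ∀ i, distSum dist ((a ::ₘ M).filter fun x => g x = i) (c i)
          = (if g a = i then dist d (toReal a) (c i) else 0) +
            distSum dist (M.filter fun x => g x = i) (c i) := by
        intro i
        by_cases hi : g a = i <;> simp [hi, distSum]
      simp only [h2, Finset.sum_add_distrib, ih, Multiset.map_cons, Multiset.sum_cons,
        Finset.sum_ite_eq, Finset.mem_univ, if_true]
  rw [h1]
  have h2 : ((∑ i, C i).map fun x => dist d (toReal x) (c (g x))).sum
      = ∑ i, ((C i).map fun x => dist d (toReal x) (c (g x))).sum := by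
    induction (Finset.univ : Finset (Fin k)) using Finset.induction_on with
    | empty => simp
    | insert a s ha ih => simp [Finset.sum_insert ha, ih]
  rw [h2]
  exact Finset.sum_le_sum fun i _ => Multiset.sum_map_le_sum_map _ _ fun x _ => hg x i

/-- In a yes-instance, there are a labelling and a list `S` of at most `2 D / α` distinct vectors,
those in composite classes, such that the classes of `S` are affordable and leave enough clusters
for the other vectors. -/
theorem exists_composite (h : IsDistance dist) {α : ℝ} (hprop : AlphaProperty dist α)
    {X : List (Fin d → ℤ)} {k : ℕ} (hk : 1 ≤ k) {D : ℝ} {l : List ℝ}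
    (hl : IsCostList dist (X : Multiset (Fin d → ℤ)) D l)
    (hX : KClustering dist (X : Multiset (Fin d → ℤ)) k D) :
    ∃ (f : (Fin d → ℤ) × ℕ → Fin k) (S : List ((Fin d → ℤ) × ℕ)), S.Sublist (weighted X) ∧
      α * S.length ≤ 2 * D ∧ (S = [] → (weighted X).length ≤ k) ∧
      ∀ Q : List (List ((Fin d → ℤ) × ℕ)),
        (∀ q ∈ Q, q ≠ [] ∧ ∀ x ∈ q, ∀ y ∈ q, f x = f y) →
        Q.Pairwise (fun q r => ∀ x ∈ q, ∀ y ∈ r, f x ≠ f y) → Q.flatten.Perm S →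
        (weighted X).length + Q.length ≤ k + S.length ∧
        ∃ δs : List ℝ, List.Forall₂ (fun δ q => δ ∈ l ∧ ∃ c, weightedCost dist q c ≤ δ) δs Q ∧
          δs.sum ≤ D := by
  classical
  obtain ⟨g, c, hD⟩ := exists_labelling hk hX
  set M : Fin k → Multiset (Fin d → ℤ) := fun i =>
    (X : Multiset (Fin d → ℤ)).filter fun x => g x = i with hM
  have hcost : ∀ i, clusterCost dist (M i) ≤ distSum dist (M i) (c i) :=
    fun i => h.clusterCost_le _ _
  have hDi : ∀ i, distSum dist (M i) (c i) ≤ D := fun i =>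
    (Finset.single_le_sum (f := fun i => distSum dist (M i) (c i))
      (fun i _ => h.distSum_nonneg _ _) (Finset.mem_univ i)).trans hD
  -- A vector is composite if its class contains a different vector.
  let comp : (Fin d → ℤ) × ℕ → Prop := fun y => ∃ x ∈ X, x ≠ y.1 ∧ g x = g y.1
  let f : (Fin d → ℤ) × ℕ → Fin k := fun y => g y.1
  let S := (weighted X).filter fun y => decide (comp y)
  let R := (weighted X).filter fun y => !decide (comp y)
  have hSR : S.length + R.length = (weighted X).length := by
    rw [← (List.filter_append_perm (fun y => decide (comp y)) (weighted X)).length_eq,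
      List.length_append]
  -- The classes of the other vectors are pairwise different.
  have hRnd : (R.map f).Nodup := by
    refine List.Nodup.map_on ?_ ((nodup_weighted X).filter _)
    intro y hy z hz hyz
    obtain ⟨hy1, hy2⟩ := List.mem_filter.1 hy
    obtain ⟨hz1, hz2⟩ := List.mem_filter.1 hz
    rw [mem_weighted] at hy1 hz1
    simp only [Bool.not_eq_true', decide_eq_false_iff_not] at hy2
    by_contra hne
    refine hy2 ⟨z.1, hz1.1, fun heq => hne ?_, hyz.symm⟩
    exact Prod.ext heq.symm (by rw [hy1.2, hz1.2, heq])
  have hcomp : ∀ {y}, comp y → y.1 ∈ X → 2 ≤ (M (f y)).toFinset.card := by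
    rintro y ⟨x, hx, hne, hxy⟩ hy
    exact Finset.one_lt_card.2 ⟨x, by simp [hM, hx, hxy, f], y.1, by simp [hM, hy, f], hne⟩
  have hcomp' : ∀ {y z}, comp y → y.1 ∈ X → f z = f y → comp z := by
    rintro y z ⟨x, hx1, hx2, hx3⟩ hy hzy
    by_cases hzy1 : z.1 = y.1
    · exact ⟨x, hx1, by rw [hzy1]; exact hx2, by rw [hzy1]; exact hx3⟩
    · exact ⟨y.1, hy, fun h => hzy1 h.symm, hzy.symm⟩
  refine ⟨f, S, List.filter_sublist, ?_, ?_, ?_⟩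
  · -- Every composite class with `s` distinct vectors costs at least `α (s - 1) ≥ α s / 2`.
    have hSnd : S.Nodup := (nodup_weighted X).filter _
    have hcard : S.length = ∑ i, (S.toFinset.filter fun y => f y = i).card := by
      rw [← List.toFinset_card_of_nodup hSnd]
      exact Finset.card_eq_sum_card_fiberwise fun _ _ => Finset.mem_coe.2 (Finset.mem_univ _)
    have hclass : ∀ i, α * ((S.toFinset.filter fun y => f y = i).card : ℝ)
        ≤ 2 * distSum dist (M i) (c i) := by
      intro i
      rcases (S.toFinset.filter fun y => f y = i).eq_empty_or_nonempty with he | ⟨y, hy⟩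
      · rw [he]
        simpa using h.distSum_nonneg (M i) (c i)
      · have hmem : ∀ {y}, y ∈ S.toFinset.filter (fun y => f y = i) →
            y.1 ∈ X ∧ y.2 = X.count y.1 ∧ comp y ∧ f y = i := by
          intro y hy
          rw [Finset.mem_filter, List.mem_toFinset, List.mem_filter, mem_weighted] at hy
          exact ⟨hy.1.1.1, hy.1.1.2, by simpa using hy.1.2, hy.2⟩
        obtain ⟨hy1, -, hy2, hy3⟩ := hmem hy
        have h2 : 2 ≤ (M i).toFinset.card := hy3 ▸ hcomp hy2 hy1
        have h3 : (S.toFinset.filter fun y => f y = i).card ≤ (M i).toFinset.card := by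
          refine Finset.card_le_card_of_injOn Prod.fst ?_ ?_
          · intro z hz
            obtain ⟨hz1, -, -, hz2⟩ := hmem hz
            simpa [hM] using ⟨hz1, hz2⟩
          · intro z hz w hw hzw
            obtain ⟨-, hz1, -⟩ := hmem hz
            obtain ⟨-, hw1, -⟩ := hmem hw
            exact Prod.ext hzw (by rw [hz1, hw1, hzw])
        have h4 := (hprop d (M i) h2).trans (hcost i)
        have h5 : (2 : ℝ) ≤ ((M i).toFinset.card : ℝ) := by exact_mod_cast h2
        have h6 : ((S.toFinset.filter fun y => f y = i).card : ℝ) ≤ (M i).toFinset.card := by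
          exact_mod_cast h3
        rcases le_or_gt 0 α with hα | hα
        · nlinarith
        · exact (mul_nonpos_of_nonpos_of_nonneg hα.le (Nat.cast_nonneg _)).trans
            (mul_nonneg zero_le_two (h.distSum_nonneg _ _))
    rw [hcard]
    push_cast
    rw [Finset.mul_sum]
    refine (Finset.sum_le_sum fun i _ => hclass i).trans ?_
    rw [← Finset.mul_sum]
    linarith
  · intro hS
    have h1 := hRnd.length_le_card
    rw [hS, List.length_nil, zero_add] at hSR
    rw [← hSR]
    simpa using h1
  · intro Q hlab hpw hperm
    have hsymm : Std.Symm fun q r : List ((Fin d → ℤ) × ℕ) => ∀ x ∈ q, ∀ y ∈ r, f x ≠ f y :=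
      ⟨fun _ _ h x hx y hy e => h y hy x hx e.symm⟩
    have hQS : ∀ {r z}, r ∈ Q → z ∈ r → z ∈ S := fun hr hz =>
      hperm.mem_iff.1 (List.mem_flatten.2 ⟨_, hr, hz⟩)
    -- Every list of `Q` is a complete class.
    have hclass : ∀ q, ∃ i, q ∈ Q → (∀ y ∈ q, f y = i) ∧
        q.Perm ((weighted X).filter fun z => decide (g z.1 = i)) ∧
        2 ≤ (M i).toFinset.card ∧ ∀ z, f z = i → comp z := by
      intro q
      by_cases hq : q ∈ Q
      swap
      · exact ⟨⟨0, hk⟩, fun h => absurd h hq⟩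
      obtain ⟨hq0, hqf⟩ := hlab q hq
      obtain ⟨y, hy⟩ := List.exists_mem_of_ne_nil q hq0
      have hyS := List.mem_filter.1 (hQS hq hy)
      have hyc : comp y := by simpa using hyS.2
      have hyX := (mem_weighted.1 hyS.1).1
      refine ⟨f y, fun _ => ⟨fun z hz => hqf z hz y hy, ?_, hcomp hyc hyX,
        fun z hz => hcomp' hyc hyX hz⟩⟩
      have hqnd : q.Nodup := (List.nodup_flatten.1 (hperm.nodup_iff.2
        ((nodup_weighted X).filter _))).1 q hq
      rw [List.perm_ext_iff_of_nodup hqnd ((nodup_weighted X).filter _)]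
      intro z
      rw [List.mem_filter, decide_eq_true_eq]
      constructor
      · exact fun hz => ⟨(List.mem_filter.1 (hQS hq hz)).1, hqf z hz y hy⟩
      · rintro ⟨hz, hzy⟩
        have hzS : z ∈ S := List.mem_filter.2 ⟨hz, decide_eq_true (hcomp' hyc hyX hzy)⟩
        obtain ⟨r, hr, hzr⟩ := List.mem_flatten.1 (hperm.mem_iff.2 hzS)
        by_cases hrq : r = q
        · exact hrq ▸ hzr
        · exact absurd hzy (hpw.forall hr hq hrq z hzr y hy)
    choose lab hlabf hlabp hlabc hlabz using hclass
    have hlnd : (Q.map lab).Nodup := by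
      rw [List.Nodup, List.pairwise_map]
      refine hpw.imp_of_mem fun {q r} hq hr hqr => ?_
      obtain ⟨x, hx⟩ := List.exists_mem_of_ne_nil q (hlab q hq).1
      obtain ⟨y, hy⟩ := List.exists_mem_of_ne_nil r (hlab r hr).1
      rw [← hlabf q hq x hx, ← hlabf r hr y hy]
      exact hqr x hx y hy
    constructor
    · have hnd : (Q.map lab ++ R.map f).Nodup := by
        refine List.Nodup.append hlnd hRnd ?_
        intro i hi hi'
        obtain ⟨q, hq, rfl⟩ := List.mem_map.1 hi
        obtain ⟨z, hz, hzq⟩ := List.mem_map.1 hi'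
        have h1 := (List.mem_filter.1 hz).2
        simp only [Bool.not_eq_true', decide_eq_false_iff_not] at h1
        exact h1 (hlabz q hq z hzq)
      have h1 := hnd.length_le_card
      simp only [List.length_append, List.length_map, Fintype.card_fin] at h1
      omega
    · refine ⟨Q.map fun q => clusterCost dist (M (lab q)), ?_, ?_⟩
      · rw [List.forall₂_map_left_iff, List.forall₂_same]
        intro q hq
        constructor
        · refine hl.2 _ (Multiset.filter_le _ _) ?_ ((hcost _).trans (hDi _))
          intro h0
          have h1 := hlabc q hq
          rw [h0] at h1
          simp at h1
        · obtain ⟨c', hc'⟩ := h.exists_distSum_eq (M (lab q))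
          refine ⟨c', le_of_eq ?_⟩
          rw [← hc', ← distSum_weightedSum, weightedSum_perm (hlabp q hq),
            weightedSum_filter (fun x => g x = lab q), weightedSum_weighted]
      · have h1 : (Q.map fun q => clusterCost dist (M (lab q)))
            = (Q.map lab).map fun i => clusterCost dist (M i) := by simp [Function.comp_def]
        rw [h1, ← List.sum_toFinset _ hlnd]
        refine (Finset.sum_le_sum fun i _ => hcost i).trans (le_trans ?_ hD)
        exact Finset.sum_le_sum_of_subset_of_nonneg (Finset.subset_univ _)
          fun i _ _ => h.distSum_nonneg _ _

end Clusters

/-! ### Correctness of the algorithm -/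

section Correctness

variable {dist : ∀ d : ℕ, (Fin d → ℝ) → (Fin d → ℝ) → ℝ} {d : ℕ}

/-- A weighted vector as a list of coordinates with a weight.  The machine works with lists, whose
type does not depend on the dimension. -/
def flatVec (y : (Fin d → ℤ) × ℕ) : List ℤ × ℕ := (List.ofFn y.1, y.2)

theorem flatVec_injective : Function.Injective (flatVec (d := d)) := by
  rintro ⟨x, m⟩ ⟨y, n⟩ h
  simp only [flatVec, Prod.mk.injEq, List.ofFn_inj] at h
  exact Prod.ext h.1 h.2

/-- The distinct vectors with multiplicities, as lists of coordinates. -/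
def flatWeighted (X : List (Fin d → ℤ)) : List (List ℤ × ℕ) := weighted (X.map List.ofFn)

theorem flatWeighted_eq (X : List (Fin d → ℤ)) :
    flatWeighted X = (weighted X).map flatVec := by
  have hinj : Function.Injective (List.ofFn : (Fin d → ℤ) → List ℤ) := List.ofFn_injective
  simp only [flatWeighted, weighted, List.dedup_map_of_injective hinj, List.map_map]
  refine List.map_congr_left fun x _ => ?_
  refine Prod.ext rfl ?_
  simp only [Function.comp_apply, flatVec, List.count, List.countP_map]
  refine List.countP_congr fun y _ => ?_
  simp [hinj.eq_iff]

theorem nodup_flatWeighted (X : List (Fin d → ℤ)) : (flatWeighted X).Nodup := nodup_weighted _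

theorem flatWeighted_ne_nil {X : List (Fin d → ℤ)} (hX : X ≠ []) : flatWeighted X ≠ [] :=
  weighted_ne_nil (by simpa using hX)

open Classical in
/-- A cluster of cells of vectors in list form is acceptable at cost `δ`. -/
noncomputable def acceptable (dist : ∀ d : ℕ, (Fin d → ℝ) → (Fin d → ℝ) → ℝ) (d : ℕ)
    (G : List (List (List ℤ × ℕ))) (δ : ℝ) : Bool :=
  decide (∃ G' : List (List ((Fin d → ℤ) × ℕ)), G = G'.map (List.map flatVec) ∧
    Selectable dist G' δ)

theorem acceptable_map {G : List (List ((Fin d → ℤ) × ℕ))} {δ : ℝ} :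
    acceptable dist d (G.map (List.map flatVec)) δ = true ↔ Selectable dist G δ := by
  simp only [acceptable, decide_eq_true_eq]
  constructor
  · rintro ⟨G', h1, h2⟩
    rwa [List.map_injective_iff.2 (List.map_injective_iff.2 flatVec_injective) h1]
  · exact fun h => ⟨G, rfl, h⟩

theorem exists_map_eq {A B : Type} {e : A → B} {l : List B} (h : ∀ b ∈ l, ∃ a, e a = b) :
    ∃ l' : List A, l'.map e = l := by
  have : l ∈ Set.range (List.map e) := by
    rw [Set.range_list_map]
    exact h
  exact this

theorem exists_map_map_eq {A B : Type} {e : A → B} {l : List (List B)}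
    (h : ∀ b ∈ l.flatten, ∃ a, e a = b) : ∃ l' : List (List A), l'.map (List.map e) = l :=
  exists_map_eq fun _ hm => exists_map_eq fun b hb => h b (List.mem_flatten.2 ⟨_, hm, hb⟩)

theorem exists_map_map_map_eq {A B : Type} {e : A → B} {l : List (List (List B))}
    (h : ∀ b ∈ l.flatten.flatten, ∃ a, e a = b) :
    ∃ l' : List (List (List A)), l'.map (List.map (List.map e)) = l :=
  exists_map_eq fun _ hm => exists_map_map_eq fun b hb => by
    obtain ⟨c, hc, hb⟩ := List.mem_flatten.1 hb
    exact h b (List.mem_flatten.2 ⟨c, List.mem_flatten.2 ⟨_, hm, hc⟩, hb⟩)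

theorem flatten_map_map {A B : Type} (e : A → B) (l : List (List A)) :
    (l.map (List.map e)).flatten = l.flatten.map e := List.map_flatten.symm

theorem forall₂_comp {A B C : Type} {R : A → B → Prop} {S : B → C → Prop} {T : A → C → Prop}
    (h : ∀ a b c, R a b → S b c → T a c) {l : List A} {m : List B} {n : List C}
    (h₁ : List.Forall₂ R l m) (h₂ : List.Forall₂ S m n) : List.Forall₂ T l n := by
  induction h₁ generalizing n with
  | nil =>
    cases h₂
    exact .nil
  | cons hab _ ih =>
    cases h₂ with
    | cons hbc h₂ => exact .cons (h _ _ _ hab hbc) (ih h₂)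

/-- The clusters of a candidate found by the search come from clusters of weighted vectors. -/
theorem exists_of_mem_search {X : List (Fin d → ℤ)} (hX : X ≠ []) {U : List Unit}
    {P : List (List (List (List ℤ × ℕ)))}
    (hP : ([], P) ∈ search (tests (flatWeighted X)) (flatWeighted X) U) :
    ∃ P' : List (List (List ((Fin d → ℤ) × ℕ))), P = P'.map (List.map (List.map flatVec)) ∧
      P'.flatten.flatten.Perm (weighted X) ∧ (∀ c ∈ P'.flatten, c ≠ []) ∧ (∀ G ∈ P', G ≠ []) ∧
      2 * P'.flatten.length ≤ U.length + 1 := by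
  obtain ⟨h1, -, h2, h3, h4⟩ := searchInv_of_mem_search (flatWeighted_ne_nil hX) hP
  simp only [List.flatten_nil, List.nil_append, List.length_nil, zero_add] at h1 h2 h3 h4
  rw [flatWeighted_eq] at h1
  obtain ⟨P', rfl⟩ : ∃ P' : List (List (List ((Fin d → ℤ) × ℕ))),
      P'.map (List.map (List.map flatVec)) = P := by
    refine exists_map_map_map_eq fun b hb => ?_
    obtain ⟨a, -, ha⟩ := List.mem_map.1 (h1.mem_iff.1 hb)
    exact ⟨a, ha⟩
  rw [flatten_map_map] at h1 h2 h4
  rw [List.length_map] at h4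
  rw [flatten_map_map, List.map_perm_map_iff flatVec_injective] at h1
  refine ⟨P', rfl, h1, ?_, ?_, h4⟩
  · intro c hc h0
    exact h2 _ (List.mem_map_of_mem hc) (by simp [h0])
  · intro G hG h0
    exact h3 _ (List.mem_map_of_mem hG) (by simp [h0])

/-- Soundness: an affordable candidate yields a clustering. -/
theorem kClustering_of_affordable (h : IsDistance dist) {X : List (Fin d → ℤ)} (hX : X ≠ [])
    {k : ℕ} {D : ℝ} {l : List ℝ} {U : List Unit} {P : List (List (List (List ℤ × ℕ)))}
    (hP : P ∈ candidates k (flatWeighted X)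
      (search (tests (flatWeighted X)) (flatWeighted X) U))
    (ha : affordable (acceptable dist d) l D P = true) :
    KClustering dist (X : Multiset (Fin d → ℤ)) k D := by
  rw [mem_candidates] at hP
  obtain ⟨hP, hk⟩ := hP
  obtain ⟨P', rfl, hperm, -, -, -⟩ := exists_of_mem_search hX hP
  obtain ⟨δs, hδ, hsum⟩ := affordable_iff.1 ha
  rw [List.forall₂_map_right_iff] at hδ
  refine kClustering_of_selectable h hperm ?_ (hδ.imp fun _ _ h => acceptable_map.1 h.2) hsum
  rw [flatten_map_map, flatWeighted_eq] at hk
  simpa only [List.length_map] using hk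

/-- Completeness: in a yes-instance with more than `k` distinct vectors, the search finds an
affordable candidate. -/
theorem exists_affordable (h : IsDistance dist) {α : ℝ} (hα : 0 < α)
    (hprop : AlphaProperty dist α) {X : List (Fin d → ℤ)} {k : ℕ} (hk : 1 ≤ k) {D : ℝ}
    {l : List ℝ} (hl : IsCostList dist (X : Multiset (Fin d → ℤ)) D l)
    (hkX : k < (flatWeighted X).length) {U : List Unit} (hU : 2 * ⌊2 * D / α⌋₊ ≤ U.length)
    (hcl : KClustering dist (X : Multiset (Fin d → ℤ)) k D) :
    ∃ P ∈ candidates k (flatWeighted X) (search (tests (flatWeighted X)) (flatWeighted X) U),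
      affordable (acceptable dist d) l D P = true := by
  obtain ⟨f, S, hS, hSα, hS0, hQ⟩ := exists_composite h hprop hk hl hcl
  have hX : X ≠ [] := by
    rintro rfl
    simp [flatWeighted, weighted] at hkX
  have hlen : S.length ≤ ⌊2 * D / α⌋₊ := Nat.le_floor (by rw [le_div_iff₀ hα]; linarith)
  have hext : ∀ y, Function.extend flatVec f (fun _ => ⟨0, hk⟩) (flatVec y) = f y :=
    fun y => flatVec_injective.extend_apply _ _ _
  obtain ⟨P, hP, Q, hQP, hlab, hpw, hperm, -⟩ := exists_compatible_search
    (Function.extend flatVec f fun _ => ⟨0, hk⟩) (nodup_flatWeighted X)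
    (S := S.map flatVec) (U := U) (by rw [flatWeighted_eq]; exact hS.map _)
    (by
      intro h0
      have := hS0 (by simpa using h0)
      rw [flatWeighted_eq, List.length_map] at hkX
      omega)
    (by rw [List.length_map]; omega)
  obtain ⟨P', rfl, -, -, -, -⟩ := exists_of_mem_search hX hP
  simp only [List.flatten_nil, List.filter_nil, List.append_nil] at hperm
  obtain ⟨Q, rfl⟩ : ∃ Q' : List (List ((Fin d → ℤ) × ℕ)), Q'.map (List.map flatVec) = Q := by
    refine exists_map_map_eq fun b hb => ?_
    obtain ⟨a, -, ha⟩ := List.mem_map.1 (hperm.mem_iff.1 hb)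
    exact ⟨a, ha⟩
  rw [flatten_map_map, List.map_perm_map_iff flatVec_injective] at hperm
  simp only [List.forall₂_map_left_iff, List.forall₂_map_right_iff,
    List.mem_map_of_injective flatVec_injective] at hQP
  obtain ⟨hcount, δs, hδ, hsum⟩ := hQ Q
    (by
      intro q hq
      obtain ⟨h1, h2⟩ := hlab _ (List.mem_map_of_mem hq)
      refine ⟨by simpa using h1, fun x hx y hy => ?_⟩
      have := h2 _ (List.mem_map_of_mem hx) _ (List.mem_map_of_mem hy)
      rwa [hext, hext] at this)
    (by
      rw [List.pairwise_map] at hpw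
      refine hpw.imp fun {q r} hqr x hx y hy => ?_
      have := hqr _ (List.mem_map_of_mem hx) _ (List.mem_map_of_mem hy)
      rwa [hext, hext] at this)
    hperm
  refine ⟨_, mem_candidates.2 ⟨hP, ?_⟩, affordable_iff.2 ⟨δs, ?_, hsum⟩⟩
  · have h1 := hQP.length_eq
    have h2 := (forall₂_flatten hQP).length_eq
    have h3 := hperm.length_eq
    rw [flatten_map_map, flatWeighted_eq]
    simp only [List.length_map]
    omega
  · rw [List.forall₂_map_right_iff]
    refine forall₂_comp (fun δ q G hq hG => ?_) hδ hQP
    obtain ⟨h1, c, hc⟩ := hq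
    exact ⟨h1, acceptable_map.2 ⟨q, hG, c, hc⟩⟩

/-- The program for Cluster Selection decides which clusters of the candidates are acceptable. -/
theorem answers_of_selectionSolvable {ι : Type} {prim : ι → ℝ → ℝ → ℝ} {Φ : ℕ → ℕ → ℝ → ℝ → ℝ}
    (hΦ : IsTimeBound Φ) {q : Code ι}
    (hq : ∀ I : SelectionInstance d,
      Decides prim q I.input (I.IsYes dist) (Φ I.size d I.groups.length I.budget))
    (hd : 1 ≤ d) {α D : ℝ} (hα : 0 < α) (hD : 0 ≤ D) {X : List (Fin d → ℤ)} (hX : X ≠ [])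
    {l : List ℝ} (hl : ∀ δ ∈ l, 0 ≤ δ ∧ δ ≤ D) {U : List Unit} (hU : U.length ≤ 2 * ⌊2 * D / α⌋₊)
    {k : ℕ} {P : List (List (List (List ℤ × ℕ)))}
    (hP : P ∈ candidates k (flatWeighted X)
      (search (tests (flatWeighted X)) (flatWeighted X) U)) :
    Answers prim q d (acceptable dist d) l P ⌊Φ X.length d (2 * D / α) D⌋₊ := by
  obtain ⟨P', rfl, hperm, hne, hne', hlen⟩ := exists_of_mem_search hX (mem_candidates.1 hP).1
  intro G₀ hG₀ δ hδ
  obtain ⟨G, hG, rfl⟩ := List.mem_map.1 hG₀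
  have hsub : G.Sublist P'.flatten := List.sublist_flatten_of_mem hG
  have hperm' := hperm.map Prod.fst
  rw [map_fst_weighted] at hperm'
  let I : SelectionInstance d :=
    { groups := G
      budget := δ
      groups_ne := hne' G hG
      group_ne := fun c hc => hne c (hsub.mem hc)
      nodup := (hperm'.nodup_iff.2 X.nodup_dedup).sublist (hsub.flatten.map _)
      weight_pos := fun y hy => by
        obtain ⟨h1, h2⟩ := mem_weighted.1 (hperm.mem_iff.1 (hsub.flatten.mem hy))
        rw [h2]
        exact List.count_pos_iff.2 h1
      budget_nonneg := (hl δ hδ).1 }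
  obtain ⟨u, t, hrun, ht, hu⟩ := hq I
  have hsize : I.size ≤ X.length :=
    (hsub.flatten.length_le.trans_eq hperm.length_eq).trans (length_weighted_le X)
  have hsize1 : 1 ≤ I.size := by
    refine (List.length_pos_iff.2 (hne' G hG)).trans_le ?_
    exact length_le_length_flatten fun c hc => hne c (hsub.mem hc)
  have hgroups : (G.length : ℝ) ≤ 2 * D / α := by
    have h1 : G.length ≤ ⌊2 * D / α⌋₊ := by
      have := hsub.length_le
      omega
    exact (Nat.cast_le.2 h1).trans (Nat.floor_le (by positivity))
  refine ⟨u, ⟨t, Nat.le_floor (ht.trans ?_), ?_⟩, hu.trans acceptable_map.symm⟩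
  · exact hΦ.mono _ _ _ _ _ _ _ _ hsize1 hd (Nat.cast_nonneg _) (hl δ hδ).1 hsize le_rfl hgroups
      (hl δ hδ).2
  · convert hrun using 1
    simp only [SelectionInstance.input, enc, List.map_map, I, Function.comp_def, flatVec, Val.ofVec,
      List.map_ofFn]

end Correctness

/-! ### The program -/

section Machine

variable {ι : Type} {prim : ι → ℝ → ℝ → ℝ}

/-- On `(r, α)`: a list with two entries for every time that `α` can be subtracted from `r`. -/
def unaryCode : Code ι :=
  .comp (.comp .tail .tail)
    (.comp
      (.loop (.le (.comp .head .tail) .head)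
        (.cons (.sub .head (.comp .head .tail))
          (.cons (.comp .head .tail) (.cons .nil (.cons .nil (.comp .tail .tail))))))
      (.cons .head (.cons .tail .nil)))

theorem runsIn_unaryCode {r α : ℝ} {n : ℕ} (h₁ : n * α ≤ r) (h₂ : r < (n + 1) * α) :
    RunsIn prim unaryCode (enc (r, α)) (enc (List.replicate (2 * n) ())) (40 * n + 30) := by
  have hloop : ∀ (n : ℕ) (r : ℝ) (U : List Unit), n * α ≤ r → r < (n + 1) * α →
      ∃ r' : ℝ, RunsIn prim (.loop (.le (.comp .head .tail) .head)
        (.cons (.sub .head (.comp .head .tail))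
          (.cons (.comp .head .tail) (.cons .nil (.cons .nil (.comp .tail .tail))))) : Code ι)
        (enc (r, α, U)) (enc (r', α, List.replicate (2 * n) () ++ U)) (40 * n + 10) := by
    intro n
    induction n with
    | zero =>
      intro r U h₁ h₂
      refine ⟨r, RunsIn.mono (RunsIn.loop_done (s := 5) ?_) (by omega)⟩
      have h := RunsIn.le (prim := prim) ((RunsIn.tail (enc r) (enc (α, U))).comp
        (RunsIn.head (enc α) (enc U))) (RunsIn.head (enc r) (enc (α, U)))
      have hlt : ¬ α ≤ r := not_le.2 (by simpa using h₂)
      rwa [decide_eq_false hlt] at h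
    | succ n ih =>
      intro r U h₁ h₂
      push_cast at h₁ h₂
      have hle : α ≤ r := by
        have h3 : 0 < α := by nlinarith
        nlinarith [mul_nonneg (Nat.cast_nonneg n : (0 : ℝ) ≤ n) h3.le]
      obtain ⟨r', hr'⟩ := ih (r - α) (() :: () :: U) (by linarith) (by linarith)
      have hα : RunsIn prim (.comp .head .tail) (enc (r, α, U)) (.num α) 3 :=
        (RunsIn.tail _ _).comp (RunsIn.head _ _)
      have hr : RunsIn prim .head (enc (r, α, U)) (.num r) 1 := RunsIn.head _ _
      have hU : RunsIn prim (.comp .tail .tail) (enc (r, α, U)) (enc U) 3 :=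
        (RunsIn.tail _ _).comp (RunsIn.tail _ _)
      have hc := hα.le hr
      rw [decide_eq_true hle] at hc
      have hb := (hr.sub hα).cons (hα.cons ((RunsIn.nil _).cons ((RunsIn.nil _).cons hU)))
      have hl : List.replicate (2 * (n + 1)) () ++ U
          = List.replicate (2 * n) () ++ () :: () :: U := by
        rw [mul_add, mul_one, List.replicate_add, List.append_assoc]
        rfl
      rw [hl]
      exact ⟨r', (hc.loop_step (by simp) hb hr').mono (by omega)⟩
  obtain ⟨r', hr'⟩ := hloop n r [] h₁ h₂
  rw [List.append_nil] at hr'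
  refine (RunsIn.comp (RunsIn.comp ((RunsIn.head _ _).cons ((RunsIn.tail _ _).cons
    (RunsIn.nil _))) hr') ((RunsIn.tail _ _).comp (RunsIn.tail _ _))).mono (by omega)

/-- Component `n` of a tuple. -/
def argCode : ℕ → Code ι
  | 0 => .head
  | n + 1 => .comp (argCode n) .tail

theorem runsIn_argCode_zero (a b : Val) : RunsIn prim (argCode 0) (.cons a b) a 1 :=
  RunsIn.head a b

theorem runsIn_argCode_succ {n t : ℕ} {a b u : Val} (h : RunsIn prim (argCode n) b u t) :
    RunsIn prim (argCode (n + 1)) (.cons a b) u (t + 2) :=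
  ((RunsIn.tail a b).comp h).mono (by omega)

/-- The input is a tuple; the final `nil` of the list represents the element of `Unit`. -/
theorem clusteringInput_eq {d : ℕ} (X : List (Fin d → ℤ)) (k : ℕ) (D α : ℝ) (l : List ℝ) :
    clusteringInput X k D α l = enc (d, k, D, α, l, X.map List.ofFn, ()) := by
  have h : (Val.ofVec : (Fin d → ℤ) → Val) = fun x => enc (List.ofFn x) := by
    funext x
    simp only [Val.ofVec, enc, List.map_ofFn, Function.comp_def]
  rw [clusteringInput, h]
  simp only [enc, List.map_map, Val.ofList, Function.comp_def]

/-- With `T` the number of times that `α` fits into `2 D`, there is a program that computes whether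
there are at most `k` distinct vectors or some candidate is affordable.  Its running time is linear
in the length of the list `l` and the time `B` of the program `q`, and polynomial in a bound `M` on
the size of the vectors, the number of steps and the number of states of the search. -/
theorem exists_clustering_code (q : Code ι) :
    ∃ (c : Code ι) (p : ℕ → ℕ), PolyFn p ∧ ∀ (d : ℕ) (X : List (Fin d → ℤ)) (k : ℕ) (D α : ℝ)
      (l : List ℝ) (acc : List (List (List ℤ × ℕ)) → ℝ → Bool) (T B M : ℕ), X ≠ [] →
      T * α ≤ D + D → D + D < (T + 1) * α →
      sz (X.map List.ofFn) ≤ M → 2 * T ≤ M →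
      ((tests (flatWeighted X)).length + T + 1) ^ (2 * T) ≤ M →
      (∀ P ∈ candidates k (flatWeighted X) (search (tests (flatWeighted X)) (flatWeighted X)
        (List.replicate (2 * T) ())), Answers prim q d acc l P B) →
      RunsIn prim c (clusteringInput X k D α l)
        (enc (decide ((flatWeighted X).length ≤ k) ||
          (candidates k (flatWeighted X) (search (tests (flatWeighted X)) (flatWeighted X)
            (List.replicate (2 * T) ()))).any (affordable acc l D)))
        (p M * ((l.length + 1) * (B + 1))) := by
  have heq : PolyEq prim (List ℤ × ℕ) := PolyEq.int.list.prod PolyEq.nat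
  obtain ⟨c₁, p₁, hp₁, hc₁⟩ := polyTime_weighted (PolyEq.int (prim := prim)).list
  obtain ⟨c₂, p₂, hp₂, hc₂⟩ := polyTime_tests (prim := prim) (A := List ℤ × ℕ)
  obtain ⟨c₃, p₃, hp₃, hc₃⟩ := exists_search_code heq
  obtain ⟨c₄, p₄, hp₄, hc₄⟩ := polyTime_candidates (prim := prim) (A := List ℤ × ℕ)
  obtain ⟨c₅, p₅, hp₅, hc₅⟩ := (PolyTime.id (prim := prim)
    (A := List (List ℤ × ℕ) × ℕ)).fst.length.le PolyTime.id.snd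
  -- The programs `c₆`, `c₇` and `c₈` produce `(U, Y, input)`, `(tests, U, Y, input)` and
  -- `(states, tests, U, Y, input)`; the answer is computed from the latter.
  let c₆ : Code ι := .cons (.comp unaryCode (.cons (.add (argCode 2) (argCode 2)) (argCode 3)))
    (.cons (.comp c₁ (argCode 5)) .id)
  let c₇ : Code ι := .cons (.comp c₂ (argCode 1)) .id
  let c₈ : Code ι := .cons (.comp c₃ (.cons (argCode 0)
    (.cons (.cons (.cons (.cons (argCode 2) .nil) .nil) .nil) (argCode 1)))) .id
  let c₉ : Code ι := .comp c₄ (.cons (argCode 5) (.cons (argCode 3) (argCode 0)))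
  let c₁₀ : Code ι := .comp (foldCode (affordStep q))
    (.cons (.cons (argCode 4) (.cons (argCode 8) (argCode 6))) (.cons .nil c₉))
  let c₁₁ : Code ι := .ite (.comp c₅ (.cons (argCode 3) (argCode 5))) .one c₁₀
  -- Size bounds: `N` for the input, `Y` and the tests, `Q` for the states, `R` for the candidates.
  let N : ℕ → ℕ := fun M => M + p₁ M + p₂ (p₁ M)
  have hN : PolyFn N := (PolyFn.id.add hp₁).add (hp₂.comp hp₁)
  let Q : ℕ → ℕ := fun M => 1 + N M * (1 + 6 * N M)
  have hQ : PolyFn Q := (PolyFn.const 1).add (hN.mul ((PolyFn.const 1).add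
    ((PolyFn.const 6).mul hN)))
  let R : ℕ → ℕ := fun M => p₄ (3 + N M + Q M)
  have hR : PolyFn R := hp₄.comp (((PolyFn.const 3).add hN).add hQ)
  refine ⟨.comp c₁₁ (.comp c₈ (.comp c₇ c₆)), fun M => 40 * M + p₁ M + p₂ (N M) + p₃ (N M) +
    p₅ (N M + 2) + R M + (R M * (R M * 90 + 90) + 9) + 1000, ?_, ?_⟩
  · exact (((((((PolyFn.const 40).mul PolyFn.id).add hp₁).add (hp₂.comp hN)).add
      (hp₃.comp hN)).add (hp₅.comp (hN.add (PolyFn.const 2)))).add hR).add ((hR.mul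
      ((hR.mul (PolyFn.const 90)).add (PolyFn.const 90))).add (PolyFn.const 9)) |>.add
      (PolyFn.const 1000)
  intro d X k D α l acc T B M hX hT₁ hT₂ hszX hTM hw hq
  set Y := flatWeighted X with hY
  set ts := tests Y with hts
  set U := List.replicate (2 * T) () with hU
  have hUlen : U.length = 2 * T := by simp [hU]
  have hYne : Y ≠ [] := flatWeighted_ne_nil hX
  have hszY : sz Y ≤ p₁ M := (hc₁ (X.map List.ofFn)).2.trans (hp₁.mono hszX)
  have hszts : sz ts ≤ p₂ (p₁ M) := (hc₂ Y).2.trans (hp₂.mono hszY)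
  have hMN : M ≤ N M := by simp only [N]; omega
  have hYN : sz Y ≤ N M := by simp only [N]; omega
  have htsN : sz ts ≤ N M := by simp only [N]; omega
  set S := search ts Y U with hS
  set Ps := candidates k Y S with hPs
  have hwU : ts.length + (U.length + 1) / 2 + 1 ≤ ts.length + T + 1 := by rw [hUlen]; omega
  have hszS : sz S ≤ Q M := by
    refine (sz_search_le hYne hwU).trans ?_
    rw [hUlen]
    exact Nat.add_le_add_left (Nat.mul_le_mul (hw.trans hMN)
      (Nat.add_le_add_left (Nat.mul_le_mul_left 6 hYN) 1)) 1
  have hsz4 : sz (k, Y, S) ≤ 3 + N M + Q M := by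
    simp only [sz_pair, sz_nat]
    omega
  have hszPs : sz Ps ≤ R M := (hc₄ (k, Y, S)).2.trans (hp₄.mono hsz4)
  rw [clusteringInput_eq]
  set v := enc (d, k, D, α, l, X.map List.ofFn, ()) with hv
  have a₁ : RunsIn prim (argCode 1) v (enc k) 3 :=
    runsIn_argCode_succ (runsIn_argCode_zero _ _)
  have a₂ : RunsIn prim (argCode 2) v (.num D) 5 :=
    runsIn_argCode_succ (runsIn_argCode_succ (runsIn_argCode_zero _ _))
  have a₃ : RunsIn prim (argCode 3) v (.num α) 7 :=
    runsIn_argCode_succ (runsIn_argCode_succ (runsIn_argCode_succ (runsIn_argCode_zero _ _)))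
  have a₄ : RunsIn prim (argCode 4) v (enc l) 9 :=
    runsIn_argCode_succ (runsIn_argCode_succ (runsIn_argCode_succ (runsIn_argCode_succ
      (runsIn_argCode_zero _ _))))
  have a₅ : RunsIn prim (argCode 5) v (enc (X.map List.ofFn)) 11 :=
    runsIn_argCode_succ (runsIn_argCode_succ (runsIn_argCode_succ (runsIn_argCode_succ
      (runsIn_argCode_succ (runsIn_argCode_zero _ _)))))
  have r₆ := (((a₂.add a₂).cons a₃).comp (runsIn_unaryCode hT₁ hT₂)).cons
    ((a₅.comp (hc₁ (X.map List.ofFn)).1).cons (RunsIn.id v))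
  set v₆ := Val.cons (enc U) (.cons (enc Y) v) with hv₆
  have r₇ : RunsIn prim c₇ v₆ (.cons (enc ts) v₆) (3 + p₂ (sz Y) + 1 + 1 + 1) :=
    ((runsIn_argCode_succ (runsIn_argCode_zero _ _)).comp (hc₂ Y).1).cons (RunsIn.id _)
  set v₇ := Val.cons (enc ts) v₆ with hv₇
  have b₁ : RunsIn prim (argCode 1) v₇ (enc U) 3 := runsIn_argCode_succ (runsIn_argCode_zero _ _)
  have b₂ : RunsIn prim (argCode 2) v₇ (enc Y) 5 :=
    runsIn_argCode_succ (runsIn_argCode_succ (runsIn_argCode_zero _ _))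
  have r₈ : RunsIn prim c₈ v₇ (.cons (enc S) v₇) _ :=
    (((runsIn_argCode_zero _ _).cons (((((b₂.cons (RunsIn.nil _)).cons (RunsIn.nil _)).cons
      (RunsIn.nil _))).cons b₁)).comp (hc₃ ts Y U (ts.length + T + 1) (N M) hYne hwU
        (by rw [hUlen]; exact hw.trans hMN) htsN hYN (by rw [hUlen]; exact hTM.trans hMN))).cons
      (RunsIn.id _)
  set v₈ := Val.cons (enc S) v₇ with hv₈
  have d₀ : RunsIn prim (argCode 4) v₈ (enc d) 9 :=
    runsIn_argCode_succ (runsIn_argCode_succ (runsIn_argCode_succ (runsIn_argCode_succ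
      (runsIn_argCode_zero _ _))))
  have d₁ : RunsIn prim (argCode 5) v₈ (enc k) 11 :=
    runsIn_argCode_succ (runsIn_argCode_succ (runsIn_argCode_succ (runsIn_argCode_succ a₁)))
  have d₂ : RunsIn prim (argCode 6) v₈ (enc D) 13 :=
    runsIn_argCode_succ (runsIn_argCode_succ (runsIn_argCode_succ (runsIn_argCode_succ a₂)))
  have d₄ : RunsIn prim (argCode 8) v₈ (enc l) 17 :=
    runsIn_argCode_succ (runsIn_argCode_succ (runsIn_argCode_succ (runsIn_argCode_succ a₄)))
  have dY : RunsIn prim (argCode 3) v₈ (enc Y) 7 :=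
    runsIn_argCode_succ (runsIn_argCode_succ (runsIn_argCode_succ (runsIn_argCode_zero _ _)))
  have r₉ : RunsIn prim c₉ v₈ (enc Ps) _ :=
    (d₁.cons (dY.cons (runsIn_argCode_zero _ _))).comp (hc₄ (k, Y, S)).1
  have hfold := runsIn_affordable (m := R M) hq (fun P hP => by
    have h1 := length_le_sz P
    have h2 := sz_le_of_mem hP
    omega) D
  have r₁₀ := ((d₀.cons (d₄.cons d₂)).cons ((RunsIn.nil _).cons r₉)).comp hfold
  have r₅ : RunsIn prim (.comp c₅ (.cons (argCode 3) (argCode 5))) v₈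
      (enc (decide (Y.length ≤ k))) _ := (dY.cons d₁).comp (hc₅ (Y, k)).1
  set a := (l.length + 1) * (B + 1) with ha
  have ha1 : 1 ≤ a := Nat.mul_pos (Nat.succ_pos _) (Nat.succ_pos _)
  have hR4 : p₄ (sz (k, Y, S)) ≤ R M := hp₄.mono hsz4
  have hcost : Ps.length * (R M * (l.length * (B + 90) + 80) + 90) + 9
      ≤ (R M * (R M * 90 + 90) + 9) * a := by
    have h1 : Ps.length ≤ R M := by
      have := length_le_sz Ps
      omega
    have h2 : l.length * (B + 90) + 80 ≤ 90 * a := by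
      rw [ha]
      nlinarith [Nat.zero_le (l.length * B)]
    calc Ps.length * (R M * (l.length * (B + 90) + 80) + 90) + 9
        ≤ R M * (R M * (90 * a) + 90 * a) + 9 * a := by
          gcongr
          · omega
          · omega
      _ = (R M * (R M * 90 + 90) + 9) * a := by ring
  have r₁₁ : RunsIn prim c₁₁ v₈ (enc (decide (Y.length ≤ k) || Ps.any (affordable acc l D)))
      (p₅ (N M + 2) + R M + (R M * (R M * 90 + 90) + 9) * a + 200) := by
    have h5 : p₅ (sz (Y, k)) ≤ p₅ (N M + 2) := hp₅.mono (by
      simp only [sz_pair, sz_nat]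
      omega)
    have h := (r₅.ite (t := R M + (R M * (R M * 90 + 90) + 9) * a + 150)
      (fun _ => (RunsIn.one v₈).mono (Nat.le_add_left_of_le (by omega)))
      (fun _ => r₁₀.mono (by omega))).mono
        (B' := p₅ (N M + 2) + R M + (R M * (R M * 90 + 90) + 9) * a + 200) (by omega)
    convert h using 1
    cases decide (Y.length ≤ k) <;> rfl
  refine ((((r₆.comp r₇).comp r₈)).comp r₁₁).mono ?_
  have e₁ : p₁ (sz (X.map List.ofFn)) ≤ p₁ M := hp₁.mono hszX
  have e₂ : p₂ (sz Y) ≤ p₂ (N M) := hp₂.mono hYN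
  have e₃ := Nat.le_mul_of_pos_right
    (40 * M + p₁ M + p₂ (N M) + p₃ (N M) + p₅ (N M + 2) + R M + 1000) ha1
  have e₄ : (40 * M + p₁ M + p₂ (N M) + p₃ (N M) + p₅ (N M + 2) + R M +
      (R M * (R M * 90 + 90) + 9) + 1000) * a
      = (40 * M + p₁ M + p₂ (N M) + p₃ (N M) + p₅ (N M + 2) + R M + 1000) * a +
        (R M * (R M * 90 + 90) + 9) * a := by ring
  beta_reduce
  rw [e₄]
  omega

end Machine

/-! ### Estimates -/

/-- The tangent of `D log₂ D` at `1/2` shows that `D log₂ D + 1` dominates a multiple of `D + 1`. -/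
theorem le_mul_logb_add_one {D : ℝ} (hD : 0 ≤ D) : (D + 1) / 4 ≤ D * Real.logb 2 D + 1 := by
  rcases hD.eq_or_lt with rfl | hD
  · norm_num
  have h2 : (0.6931 : ℝ) < Real.log 2 := by linarith [Real.log_two_gt_d9]
  have h3 : Real.log 2 < 0.6932 := by linarith [Real.log_two_lt_d9]
  have h1 := Real.one_sub_inv_le_log_of_pos (show 0 < 2 * D by positivity)
  rw [Real.log_mul two_ne_zero hD.ne'] at h1
  have h4 : D - 1 / 2 ≤ D * Real.log 2 + D * Real.log D := by
    have h5 := mul_le_mul_of_nonneg_left h1 hD.le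
    have h6 : D * (1 - (2 * D)⁻¹) = D - 1 / 2 := by field_simp
    linarith
  rw [Real.logb, ← mul_div_assoc, ← sub_le_iff_le_add, le_div_iff₀ (by linarith)]
  nlinarith

/-- The exponent in the bound on the number of states is `O(D log D + 1)`. -/
theorem exists_exponent_bound {α : ℝ} (hα : 0 < α) :
    ∃ K : ℕ, ∀ D : ℝ, 0 ≤ D →
      5 + 4 * (⌊2 * D / α⌋₊ : ℝ) + 2 * ⌊2 * D / α⌋₊ * Real.logb 2 ⌊2 * D / α⌋₊
        ≤ K * (D * Real.logb 2 D + 1) := by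
  set β := 2 / α with hβ
  have hβ0 : 0 < β := by positivity
  obtain ⟨K, hK⟩ := exists_nat_ge (20 + 16 * β + 2 * (4 * β * |Real.logb 2 β| + β))
  refine ⟨K, fun D hD => ?_⟩
  have hh := le_mul_logb_add_one hD
  set h := D * Real.logb 2 D + 1 with hhdef
  have hTle : (⌊2 * D / α⌋₊ : ℝ) ≤ β * D := by
    refine (Nat.floor_le (by positivity)).trans (le_of_eq ?_)
    rw [hβ]
    ring
  set T := ⌊2 * D / α⌋₊
  have hh0 : 0 ≤ h := by linarith
  have hDh : D ≤ 4 * h := by linarith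
  have hβD : β * D ≤ 4 * β * h := by nlinarith
  have hlog : (T : ℝ) * Real.logb 2 T ≤ (4 * β * |Real.logb 2 β| + β) * h := by
    rcases Nat.eq_zero_or_pos T with h0 | h0
    · rw [h0]
      simp only [Nat.cast_zero, zero_mul]
      positivity
    · have hT1 : (1 : ℝ) ≤ T := by exact_mod_cast h0
      have hD0 : 0 < D := by
        rcases hD.eq_or_lt with rfl | hD0
        · linarith
        · exact hD0
      have h1 : Real.logb 2 T ≤ Real.logb 2 β + Real.logb 2 D := by
        rw [← Real.logb_mul hβ0.ne' hD0.ne']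
        exact Real.logb_le_logb_of_le one_lt_two (by linarith) hTle
      have h2 : (T : ℝ) * Real.logb 2 D ≤ β * h := by
        rcases le_or_gt 0 (Real.logb 2 D) with hp | hn
        · calc (T : ℝ) * Real.logb 2 D ≤ β * D * Real.logb 2 D :=
                mul_le_mul_of_nonneg_right hTle hp
            _ = β * (h - 1) := by rw [hhdef]; ring
            _ ≤ β * h := by nlinarith
        · exact (mul_nonpos_of_nonneg_of_nonpos (by linarith) hn.le).trans (by positivity)
      have h3 : (T : ℝ) * Real.logb 2 β ≤ 4 * β * |Real.logb 2 β| * h := by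
        calc (T : ℝ) * Real.logb 2 β ≤ T * |Real.logb 2 β| :=
              mul_le_mul_of_nonneg_left (le_abs_self _) (by linarith)
          _ ≤ 4 * β * h * |Real.logb 2 β| :=
              mul_le_mul_of_nonneg_right (hTle.trans hβD) (abs_nonneg _)
          _ = 4 * β * |Real.logb 2 β| * h := by ring
      nlinarith
  calc 5 + 4 * (T : ℝ) + 2 * T * Real.logb 2 T
      ≤ (20 + 16 * β + 2 * (4 * β * |Real.logb 2 β| + β)) * h := by nlinarith
    _ ≤ K * h := mul_le_mul_of_nonneg_right hK hh0

/-- The number of states is at most `2 ^ O(T log T + 1) n²`, because `x ^ m ≤ m! eˣ`. -/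
theorem states_le {L T n : ℕ} (hL : 2 ^ L ≤ 2 * n) :
    (L + T + 1) ^ (2 * T) ≤ (2 * T) ^ (2 * T) * (16 * 4 ^ T * n ^ 2) := by
  have h1 : (L + T + 1) ^ (2 * T) ≤ (2 * T).factorial * 4 ^ (L + T + 1) := by
    have h2 := Real.pow_div_factorial_le_exp (x := ((L + T + 1 : ℕ) : ℝ)) (Nat.cast_nonneg _)
      (2 * T)
    have h3 : Real.exp ((L + T + 1 : ℕ) : ℝ) ≤ 4 ^ (L + T + 1) := by
      rw [← Real.exp_one_pow]
      exact pow_le_pow_left₀ (Real.exp_pos _).le (by linarith [Real.exp_one_lt_d9]) _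
    rw [div_le_iff₀ (by positivity)] at h2
    have h4 : (((L + T + 1) ^ (2 * T) : ℕ) : ℝ)
        ≤ (((2 * T).factorial * 4 ^ (L + T + 1) : ℕ) : ℝ) := by
      push_cast at h2 h3 ⊢
      nlinarith [mul_le_mul_of_nonneg_right h3
        (Nat.cast_nonneg (2 * T).factorial : (0 : ℝ) ≤ ((2 * T).factorial : ℝ))]
    exact_mod_cast h4
  refine h1.trans (Nat.mul_le_mul (Nat.factorial_le_pow _) ?_)
  have h5 : (4 : ℕ) ^ L ≤ 4 * n ^ 2 := by
    calc (4 : ℕ) ^ L = (2 ^ L) ^ 2 := by rw [← pow_mul, mul_comm, pow_mul]; norm_num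
      _ ≤ (2 * n) ^ 2 := Nat.pow_le_pow_left hL 2
      _ = 4 * n ^ 2 := by ring
  calc (4 : ℕ) ^ (L + T + 1) = 4 ^ L * 4 ^ T * 4 := by rw [pow_succ, pow_add]
    _ ≤ 4 * n ^ 2 * 4 ^ T * 4 := by gcongr
    _ = 16 * 4 ^ T * n ^ 2 := by ring

/-- For `T = 0` both sides are `1`, as the junk value of the logarithm is multiplied by `0`. -/
theorem self_pow_eq_rpow (T : ℕ) :
    ((2 * T : ℕ) : ℝ) ^ (2 * T) = (2 : ℝ) ^ (2 * T + 2 * T * Real.logb 2 T : ℝ) := by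
  rcases Nat.eq_zero_or_pos T with rfl | hT
  · simp
  have hT' : (0 : ℝ) < T := by exact_mod_cast hT
  have h1 : (2 : ℝ) ^ (1 + Real.logb 2 T) = ((2 * T : ℕ) : ℝ) := by
    rw [Real.rpow_add two_pos, Real.rpow_one, Real.rpow_logb two_pos (by norm_num) hT']
    push_cast
    ring
  rw [← h1, ← Real.rpow_natCast, ← Real.rpow_mul two_pos.le]
  congr 1
  push_cast
  ring

/-- The sum of the size of the input, the number of steps and the number `W` of states of the search is
at most `2 ^ O(T log T + 1) z²` for `z = n d`. -/
theorem size_parameter_le {T n z : ℕ} {W : ℕ} (hn : n ≤ z) (hz : 1 ≤ z)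
    (hW : W ≤ (2 * T) ^ (2 * T) * (16 * 4 ^ T * n ^ 2)) :
    ((5 * z + 2 * T + W + 2 : ℕ) : ℝ)
      ≤ 2 ^ (5 + 4 * (T : ℝ) + 2 * T * Real.logb 2 T) * (z : ℝ) ^ 2 := by
  have h1 : 1 ≤ (2 * T) ^ (2 * T) := by
    rcases Nat.eq_zero_or_pos T with rfl | hT
    · simp
    · exact Nat.one_le_pow _ _ (by omega)
  have h2 : T + 1 ≤ 4 ^ T := Nat.lt_pow_self (by norm_num)
  have h3 : z ≤ z ^ 2 := by nlinarith
  have h4 : 5 * z + 2 * T + 2 ≤ (2 * T) ^ (2 * T) * (7 * 4 ^ T * z ^ 2) := by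
    calc 5 * z + 2 * T + 2 ≤ 7 * (T + 1) * z := by nlinarith
      _ ≤ 7 * 4 ^ T * z ^ 2 := by gcongr
      _ ≤ (2 * T) ^ (2 * T) * (7 * 4 ^ T * z ^ 2) := Nat.le_mul_of_pos_left _ h1
  have h5 : 5 * z + 2 * T + W + 2 ≤ (2 * T) ^ (2 * T) * (32 * 4 ^ T * z ^ 2) := by
    calc 5 * z + 2 * T + W + 2 = 5 * z + 2 * T + 2 + W := by ring
      _ ≤ (2 * T) ^ (2 * T) * (7 * 4 ^ T * z ^ 2) + (2 * T) ^ (2 * T) * (16 * 4 ^ T * z ^ 2) :=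
        Nat.add_le_add h4 (hW.trans (by gcongr))
      _ = (2 * T) ^ (2 * T) * (23 * 4 ^ T * z ^ 2) := by ring
      _ ≤ _ := by gcongr; norm_num
  have h6 : (2 : ℝ) ^ (5 + 4 * (T : ℝ) + 2 * T * Real.logb 2 T)
      = ((2 * T : ℕ) : ℝ) ^ (2 * T) * (32 * 4 ^ T) := by
    have h7 : (32 * 4 ^ T : ℝ) = 2 ^ (5 + 2 * (T : ℝ)) := by
      rw [Real.rpow_add two_pos, Real.rpow_mul two_pos.le, Real.rpow_natCast]
      norm_num
    rw [self_pow_eq_rpow, h7, ← Real.rpow_add two_pos]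
    congr 1
    ring
  rw [h6]
  refine (Nat.cast_le.2 h5).trans (le_of_eq ?_)
  push_cast
  ring

theorem sz_ofFn_le {d : ℕ} {X : List (Fin d → ℤ)} (hX : X ≠ []) (hd : 1 ≤ d) :
    sz (X.map List.ofFn) ≤ 5 * (X.length * d) := by
  have h1 : ∀ x ∈ X.map List.ofFn, sz x ≤ 1 + d * 2 := by
    intro x hx
    obtain ⟨y, -, rfl⟩ := List.mem_map.1 hx
    simpa using sz_le_of_forall (l := List.ofFn y) (m := 1) (by simp)
  have h2 := sz_le_of_forall h1
  have h3 := List.length_pos_iff.2 hX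
  rw [List.length_map] at h2
  nlinarith

end Clust

theorem mainTheorem3 {ι : Type} (prim : ι → ℝ → ℝ → ℝ)
    (dist : ∀ d : ℕ, (Fin d → ℝ) → (Fin d → ℝ) → ℝ) (hdist : IsDistance dist)
    (α : ℝ) (hα : 0 < α) (hprop : AlphaProperty dist α)
    (Φ : ℕ → ℕ → ℝ → ℝ → ℝ) (hΦ : IsTimeBound Φ)
    (hsel : SelectionSolvableInTime prim dist Φ) :
    ∃ (p : Code ι) (K : ℕ), ∀ (d : ℕ) (X : List (Fin d → ℤ)) (k : ℕ) (D : ℝ) (𝒟 : List ℝ),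
      1 ≤ d → X ≠ [] → 1 ≤ k → 0 ≤ D → IsCostList dist (X : Multiset (Fin d → ℤ)) D 𝒟 →
      Decides prim p (clusteringInput X k D α 𝒟) (KClustering dist (X : Multiset (Fin d → ℤ)) k D)
        ((2 : ℝ) ^ ((K : ℝ) * (D * Real.logb 2 D + 1)) * ((X.length : ℝ) * (d : ℝ)) ^ K
          * (𝒟.length : ℝ) * Φ X.length d (2 * D / α) D) := by
  obtain ⟨q, hq⟩ := hsel
  obtain ⟨c, p, hp, hc⟩ := exists_clustering_code (prim := prim) q
  obtain ⟨K₀, hK₀⟩ := hp.bound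
  obtain ⟨K₁, hK₁⟩ := exists_exponent_bound hα
  refine ⟨c, K₁ * K₀ + 8 + 2 * K₀, fun d X k D 𝒟 hd hX hk hD h𝒟 => ?_⟩
  set T := ⌊2 * D / α⌋₊ with hT
  set Y := flatWeighted X with hY
  set B := ⌊Φ X.length d (2 * D / α) D⌋₊ with hB
  set z := X.length * d with hz
  have hn : 1 ≤ X.length := List.length_pos_iff.2 hX
  have hnz : X.length ≤ z := Nat.le_mul_of_pos_right _ hd
  have hYX : Y.length ≤ X.length := by
    simpa [hY, flatWeighted] using length_weighted_le (X.map List.ofFn)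
  have hW := states_le (T := T)
    ((two_pow_length_tests_le (flatWeighted_ne_nil hX)).trans (Nat.mul_le_mul_left 2 hYX))
  have h2D : 0 ≤ 2 * D / α := by positivity
  have hrun := hc d X k D α 𝒟 (acceptable dist d) T B
    (5 * z + 2 * T + ((tests Y).length + T + 1) ^ (2 * T)) hX
    (by
      have := (le_div_iff₀ hα).1 (Nat.floor_le h2D)
      linarith)
    (by
      have := (div_lt_iff₀ hα).1 (Nat.lt_floor_add_one (2 * D / α))
      linarith)
    ((sz_ofFn_le hX hd).trans (by omega)) (by omega) (Nat.le_add_left _ _)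
    (fun P hP => answers_of_selectionSolvable hΦ (fun I => hq d I hd) hd hα hD hX h𝒟.1
      (by rw [List.length_replicate]) hP)
  obtain ⟨t, ht, hrun⟩ := hrun
  refine ⟨_, t, hrun, ?_, ?_⟩
  · have hΦ1 : 1 ≤ Φ X.length d (2 * D / α) D := hΦ.one_le _ _ _ _ hn hd h2D hD
    have hBΦ : (B : ℝ) ≤ Φ X.length d (2 * D / α) D := Nat.floor_le (by linarith)
    -- A single vector is a cluster of cost zero, hence the list of costs is not empty.
    have h𝒟1 : (1 : ℝ) ≤ 𝒟.length := by
      obtain ⟨x, l, hxl⟩ := List.exists_cons_of_ne_nil hX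
      have h0 : clusterCost dist {x} ≤ D := by
        refine (hdist.clusterCost_le {x} (toReal x)).trans ?_
        simpa [distSum, hdist.self] using hD
      have h1 := h𝒟.2 {x} (by rw [hxl]; simp) (by simp) h0
      exact_mod_cast List.length_pos_of_mem h1
    have hz1 : 1 ≤ z := hn.trans hnz
    have hz1' : (1 : ℝ) ≤ z := by exact_mod_cast hz1
    have hh := le_mul_logb_add_one hD
    have hK := hK₁ D hD
    set h := D * Real.logb 2 D + 1 with hhdef
    have hpM : (p (5 * z + 2 * T + ((tests Y).length + T + 1) ^ (2 * T)) : ℝ)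
        ≤ 2 ^ ((K₁ * K₀ : ℝ) * h) * (z : ℝ) ^ (2 * K₀) := by
      calc (p (5 * z + 2 * T + ((tests Y).length + T + 1) ^ (2 * T)) : ℝ)
          ≤ ((5 * z + 2 * T + ((tests Y).length + T + 1) ^ (2 * T) + 2 : ℕ) : ℝ) ^ K₀ := by
            exact_mod_cast hK₀ _
        _ ≤ (2 ^ (K₁ * h) * (z : ℝ) ^ 2) ^ K₀ := by
            refine pow_le_pow_left₀ (Nat.cast_nonneg _)
              ((size_parameter_le hnz hz1 hW).trans ?_) _
            gcongr
            exact one_le_two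
        _ = 2 ^ ((K₁ * K₀ : ℝ) * h) * (z : ℝ) ^ (2 * K₀) := by
            rw [mul_pow, ← pow_mul, ← Real.rpow_natCast ((2 : ℝ) ^ (K₁ * h)),
              ← Real.rpow_mul two_pos.le]
            congr 2
            ring
    have h4 : (4 : ℝ) ≤ 2 ^ (8 * h) := by
      calc (4 : ℝ) = 2 ^ (2 : ℝ) := by norm_num
        _ ≤ 2 ^ (8 * h) := Real.rpow_le_rpow_of_exponent_le one_le_two (by linarith)
    have hh0 : 0 ≤ h := by linarith
    calc (t : ℝ) ≤ (p (5 * z + 2 * T + ((tests Y).length + T + 1) ^ (2 * T)) : ℝ) *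
          ((𝒟.length + 1) * (B + 1)) := by exact_mod_cast ht
      _ ≤ 2 ^ ((K₁ * K₀ : ℝ) * h) * (z : ℝ) ^ (2 * K₀) *
          ((2 * 𝒟.length) * (2 * Φ X.length d (2 * D / α) D)) := by
        gcongr <;> linarith
      _ = 4 * 2 ^ ((K₁ * K₀ : ℝ) * h) * (z : ℝ) ^ (2 * K₀) * 𝒟.length *
          Φ X.length d (2 * D / α) D := by ring
      _ ≤ 2 ^ (((K₁ * K₀ + 8 + 2 * K₀ : ℕ) : ℝ) * h) * (z : ℝ) ^ (K₁ * K₀ + 8 + 2 * K₀) *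
          𝒟.length * Φ X.length d (2 * D / α) D := by
        have h5 : 4 * (2 : ℝ) ^ ((K₁ * K₀ : ℝ) * h)
            ≤ 2 ^ (((K₁ * K₀ + 8 + 2 * K₀ : ℕ) : ℝ) * h) := by
          calc 4 * (2 : ℝ) ^ ((K₁ * K₀ : ℝ) * h)
              ≤ 2 ^ (8 * h) * (2 : ℝ) ^ ((K₁ * K₀ : ℝ) * h) := by gcongr
            _ = 2 ^ ((K₁ * K₀ + 8 : ℝ) * h) := by
              rw [← Real.rpow_add two_pos]
              congr 1
              ring
            _ ≤ _ := by
              refine Real.rpow_le_rpow_of_exponent_le one_le_two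
                (mul_le_mul_of_nonneg_right ?_ hh0)
              push_cast
              linarith [(Nat.cast_nonneg K₀ : (0 : ℝ) ≤ K₀)]
        have h6 : (z : ℝ) ^ (2 * K₀) ≤ (z : ℝ) ^ (K₁ * K₀ + 8 + 2 * K₀) :=
          pow_le_pow_right₀ hz1' (by omega)
        gcongr
      _ = _ := by
        rw [hz]
        push_cast
        rfl
  · have hbool : ∀ b : Bool, Enc.enc b ≠ Val.nil ↔ b = true := by
      intro b
      cases b <;> simp
    rw [hbool, Bool.or_eq_true, decide_eq_true_eq, List.any_eq_true]
    constructor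
    · rintro (hkY | ⟨P, hP, ha⟩)
      · -- Every distinct vector is a cluster of its own.
        refine kClustering_of_selection hdist [] (weighted X) (by simp) ?_ (by simpa using hD)
        rw [flatWeighted_eq, List.length_map] at hkY
        simpa using hkY
      · exact kClustering_of_affordable hdist hX hP ha
    · intro hcl
      by_cases hkY : Y.length ≤ k
      · exact Or.inl hkY
      · exact Or.inr (exists_affordable hdist hα hprop hk h𝒟 (not_le.1 hkY)
          (by rw [List.length_replicate]) hcl)
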